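/- **Setting.** Let $\mathbb T=\mathbb R/\mathbb Z$, identified with $[0,1)$ where convenient, let $a\in(0,1)$, and let $T:\mathbb T^2\to\mathbb T^2$ be the generalized baker map $$T(\xi,x)=(\tau(\xi),ax)\ \text{ if }\xi\in[0,a),\qquad T(\xi,x)=(\tau(\xi),a+(1-a)x)\ \text{ if }\xi\in[a,1),$$ where $\tau(\xi)=\xi/a$ on $[0,a)$ and $\tau(\xi)=(\xi-a)/(1-a)$ on $[a,1)$. Put $\sigma(\xi)=1/\tau'(\xi)$, i.e. $\sigma=a$ on $[0,a)$ and $\sigma=1-a$ on $[a,1)$. Let $(f_x)_{x\in\mathbb T}$ be uniformly bounded $C^3$ maps $\mathbb R\to\mathbb R$ with $f_x'>0$ and negative Schwarzian derivative, such that $(x,y)\mapsto f_x(y)$ is continuous, and let $f(\xi,x,y)=(T(\xi,x),f_x(y))$ on $\mathbb T^2\times\mathbb R$. Let ${\rm GA}=\bigcap_{n\ge0}f^n(\mathbb T^2\times\mathbb R)$ and, for $\theta\in\mathbb T^2$, let $\varphi^+(\theta)$ and $\varphi^-(\theta)$ be the supremum and the infimum of $\{y:(\theta,y)\in{\rm GA}\}$.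 Let $\varphi^*(\theta)$ be the supremum of those $y\in[\varphi^-(\theta),\varphi^+(\theta)]$ for which $|f^n_\theta(y)-\varphi^-(T^n\theta)|\to0$ as $n\to\infty$, where $f^n(\theta,y)=(T^n\theta,f^n_\theta(y))$. Assume that there are compact non-degenerate intervals $I\subseteq J^\circ$, $J\subseteq\mathbb R$, such that $f(\mathbb T^2\times J)\subseteq\mathbb T^2\times I^\circ$, $\inf_{(x,y)\in\mathbb T\times J}\tau'(x)f'_{\tau(x)}(y)>1$, the map $(x,y)\mapsto f_x(y)$ is $C^2$ on $\mathbb T\times J$, and $\varphi^\pm$ take values in $I$. *Strong stable fibres.* With $\Gamma(\xi,x,y)=\sigma(\xi)/f_x'(y)$ and $A(\xi,x,y)=\frac{\partial f_x}{\partial x}(y)/f_x'(y)$ let $$X_3=-\sum_{k\ge0}\Big(\prod_{j<k}\Gamma\circ f^j\Big)\cdot A\circ f^k .$$ Here $x$ ranges over $[0,1]$, and $f$ is extended to $x=1$ by the same formulas. A strong stable fibre in the $\xi$-plane is the graph $\{(u,\ell(u)):u\in D\}$ of the maximal solution $\ell:D\to J$ of $\ell'(u)=X_3(\xi,u,\ell(u))$,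 $\ell(x)=y$, for some $(x,y)\in[0,1]\times J$, where $D\subseteq[0,1]$ is an interval containing $x$. *Filled-in closures.* Let $\widetilde{\mathcal G\varphi^\pm}$ be the set of all $(\theta,y)$ such that $y_1\le y\le y_2$ for some $y_1,y_2$ with $(\theta,y_1),(\theta,y_2)$ in the closure of the graph of $\varphi^\pm$ in $\mathbb T^2\times\mathbb R$. Let $\varphi^{+-}(\theta)=\inf\{y:(\theta,y)\in\widetilde{\mathcal G\varphi^+}\}$ and $\varphi^{-+}(\theta)=\sup\{y:(\theta,y)\in\widetilde{\mathcal G\varphi^-}\}$. *Measures.* For a probability measure $\nu$ on $\mathbb T^2$ let $\nu^{(1)}$ be its first marginal, $\nu_\varphi=\nu\circ({\rm id},\varphi)^{-1}$, and $\lambda^i(\nu)=\int\log f_\theta'(\varphi^i(\theta))\,d\nu(\theta)$ for $i\in\{-,*,+\}$, where $f_{(\xi,x)}=f_x$. Let $(\nu_{\varphi^*})_\xi$ be the conditional measures of $\nu_{\varphi^*}$ on the planes $\{\xi\}\times\mathbb T\times\mathbb R$. A $T$-invariant probability measure $\nu$ is called Gibbs if there are a potential $\psi:\mathbb T^2\to\mathbb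 R$ that is Hölder continuous with respect to the symbolic coding of $T$ by $\{[0,a),[a,1)\}$ as the two-sided full shift, and constants $P\in\mathbb R$, $K>0$, such that for all $n\ge0$ and all $\theta$ the set $C_n(\theta)$ of points whose symbols at times $0,\dots,n-1$ agree with those of $\theta$ satisfies $$K^{-1}\le\nu(C_n(\theta))\,\exp\Big(nP-\sum_{k<n}\psi(T^k\theta)\Big)\le K .$$ **Theorem (fine structure in case A).** Assume $\widetilde{\mathcal G\varphi^+}\cap\widetilde{\mathcal G\varphi^-}=\emptyset$ (case A), and let $\nu$ be an ergodic $T$-invariant Gibbs measure. Then for $\nu^{(1)}$-a.e. $\xi$ there is a unique strong stable fibre $\gamma^*_\xi$ in the $\xi$-plane that carries $(\nu_{\varphi^*})_\xi$, and exactly one of the following cases occurs. - **A$_\nu1$.** $\nu_{\varphi^+}$ is the only $f$-invariant measure projecting to $\nu$ that is carried by $\widetilde{\mathcal G\varphi^+}$, and $\nu_{\varphi^-}$ is the only one that is carried by $\widetilde{\mathcal G\varphi^-}$. For $\nu^{(1)}$-a.e. $\xi$, $\gamma^*_\xi$ is disjoint from $\widetilde{\mathcal G\varphi^+}$ and from $\widetilde{\mathcal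 G\varphi^-}$. Moreover $\lambda^\pm(\nu)<0$ and $\lambda^*(\nu)>0$. - **A$_\nu2^+$.** Every $f$-invariant measure projecting to $\nu$ is carried by $\widetilde{\mathcal G\varphi^+}\cup\widetilde{\mathcal G\varphi^-}$, and $\nu_{\varphi^*}$ is carried by the graph of $\varphi^{+-}$. For $\nu^{(1)}$-a.e. $\xi$, $\gamma_\xi^*=\{(u,\varphi^{+-}(\xi,u)):u\in[0,1]\}$. Moreover, either (a) $\varphi^{+-}<\varphi^+$ $\nu$-a.s., $\lambda^\pm(\nu)<0$ and $\lambda^*(\nu)>0$, or (b) $\varphi^{+-}=\varphi^+$ $\nu$-a.s., $\lambda^-(\nu)<0$ and $\lambda^+(\nu)=\lambda^*(\nu)=0$. - **A$_\nu2^-$.** Every $f$-invariant measure projecting to $\nu$ is carried by $\widetilde{\mathcal G\varphi^+}\cup\widetilde{\mathcal G\varphi^-}$, and $\nu_{\varphi^*}$ is carried by the graph of $\varphi^{-+}$. For $\nu^{(1)}$-a.e. $\xi$, $\gamma_\xi^*=\{(u,\varphi^{-+}(\xi,u)):u\in[0,1]\}$. Moreover, either (a) $\varphi^{-+}>\varphi^-$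 $\nu$-a.s., $\lambda^\pm(\nu)<0$ and $\lambda^*(\nu)>0$, or (b) $\varphi^{-+}=\varphi^-$ $\nu$-a.s., $\lambda^+(\nu)<0$ and $\lambda^-(\nu)=\lambda^*(\nu)=0$. -/

import Mathlib

open MeasureTheory Filter Topology

/-! ### Generalized baker map on the two-torus and the skew product over it

The one-dimensional torus is `UnitAddCircle = ℝ / ℤ`. -/

/-- The representative in `[0, 1)` of a point of the circle. -/
noncomputable def rep (x : UnitAddCircle) : ℝ :=
  (AddCircle.equivIco (1 : ℝ) 0 x : ℝ)

/-- The piecewise linear expanding circle map `τ` with two full branches on `[0, a)`, `[a, 1)`. -/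
noncomputable def tau (a : ℝ) (x : UnitAddCircle) : UnitAddCircle :=
  if rep x < a then ((rep x / a : ℝ) : UnitAddCircle)
  else (((rep x - a) / (1 - a) : ℝ) : UnitAddCircle)

/-- The slope `τ'(x)`, i.e. `1 / a` on `[0, a)` and `1 / (1 - a)` on `[a, 1)`. -/
noncomputable def tauSlope (a : ℝ) (x : UnitAddCircle) : ℝ :=
  if rep x < a then a⁻¹ else (1 - a)⁻¹

/-- The generalized baker map `T(ξ, x)`. -/
noncomputable def baker (a : ℝ) (θ : UnitAddCircle × UnitAddCircle) :
    UnitAddCircle × UnitAddCircle :=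
  if rep θ.1 < a then (tau a θ.1, ((a * rep θ.2 : ℝ) : UnitAddCircle))
  else (tau a θ.1, ((a + (1 - a) * rep θ.2 : ℝ) : UnitAddCircle))

/-- The skew product `f(ξ, x, y) = (T(ξ, x), f_x(y))`. -/
noncomputable def skew (a : ℝ) (F : UnitAddCircle → ℝ → ℝ)
    (p : (UnitAddCircle × UnitAddCircle) × ℝ) : (UnitAddCircle × UnitAddCircle) × ℝ :=
  (baker a p.1, F p.1.2 p.2)

/-- The global attractor `⋂ₙ fⁿ(𝕋² × ℝ)`. -/
def globalAttractor (a : ℝ) (F : UnitAddCircle → ℝ → ℝ) :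
    Set ((UnitAddCircle × UnitAddCircle) × ℝ) :=
  ⋂ n : ℕ, Set.range ((skew a F)^[n])

/-- The upper bounding graph `φ⁺` of the global attractor. -/
noncomputable def phiPlus (a : ℝ) (F : UnitAddCircle → ℝ → ℝ)
    (θ : UnitAddCircle × UnitAddCircle) : ℝ :=
  sSup {y : ℝ | (θ, y) ∈ globalAttractor a F}

/-- The lower bounding graph `φ⁻` of the global attractor. -/
noncomputable def phiMinus (a : ℝ) (F : UnitAddCircle → ℝ → ℝ)
    (θ : UnitAddCircle × UnitAddCircle) : ℝ :=
  sInf {y : ℝ | (θ, y) ∈ globalAttractor a F}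

/-- The third graph `φ*`: the upper boundary, inside `[φ⁻(θ), φ⁺(θ)]`, of the set of points whose
orbits are asymptotic to the graph of `φ⁻`. That set contains `φ⁻(θ)` and is an interval. -/
noncomputable def phiStar (a : ℝ) (F : UnitAddCircle → ℝ → ℝ)
    (θ : UnitAddCircle × UnitAddCircle) : ℝ :=
  sSup {y : ℝ | phiMinus a F θ ≤ y ∧ y ≤ phiPlus a F θ ∧
    Tendsto (fun n : ℕ => |((skew a F)^[n] (θ, y)).2 - phiMinus a F ((baker a)^[n] θ)|)
      atTop (𝓝 0)}

/-! ### Standing hypotheses -/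

/-- The Schwarzian derivative `g''' / g' - (3/2) (g'' / g')²`. -/
noncomputable def schwarzian (g : ℝ → ℝ) (y : ℝ) : ℝ :=
  iteratedDeriv 3 g y / deriv g y - 3 / 2 * (iteratedDeriv 2 g y / deriv g y) ^ 2

/-- The standing hypotheses on the baker parameter `a`, the fibre maps `f_x = F x` and the
intervals `I = [iL, iU] ⊆ J = [jL, jU]`. -/
structure IsBakerDrivenSystem (a : ℝ) (F : UnitAddCircle → ℝ → ℝ) (iL iU jL jU : ℝ) : Prop where
  a_pos : 0 < a
  a_lt_one : a < 1
  /-- the fibre maps depend continuously on `x` -/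
  continuous : Continuous (fun p : UnitAddCircle × ℝ => F p.1 p.2)
  /-- the fibre maps are uniformly bounded -/
  bounded : ∃ M : ℝ, ∀ x y, |F x y| ≤ M
  contDiff_fibre : ∀ x, ContDiff ℝ 3 (F x)
  deriv_pos : ∀ x y, 0 < deriv (F x) y
  schwarzian_neg : ∀ x y, schwarzian (F x) y < 0
  /-- `I` is contained in the interior of `J`, and both are non-degenerate -/
  jL_lt_iL : jL < iL
  iL_lt_iU : iL < iU
  iU_lt_jU : iU < jU
  /-- `f` maps `𝕋² × J` into `𝕋² × I°` -/
  mapsTo : ∀ x, Set.MapsTo (F x) (Set.Icc jL jU) (Set.Ioo iL iU)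
  /-- partial hyperbolicity: `inf τ'(x) f'_{τ(x)}(y) > 1` over `𝕋 × J` -/
  partially_hyperbolic : ∃ c : ℝ, 1 < c ∧ ∀ x, ∀ y ∈ Set.Icc jL jU,
    c ≤ tauSlope a x * deriv (F (tau a x)) y
  /-- `(x, y) ↦ f_x(y)` is `C²` on `𝕋 × J` -/
  contDiffOn : ContDiffOn ℝ 2 (fun p : ℝ × ℝ => F (p.1 : UnitAddCircle) p.2)
    (Set.univ ×ˢ Set.Icc jL jU)
  /-- the graphs `φ⁻`, `φ⁺` take their values in `I` -/
  phiMinus_mem : ∀ θ, phiMinus a F θ ∈ Set.Icc iL iU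
  phiPlus_mem : ∀ θ, phiPlus a F θ ∈ Set.Icc iL iU

/-! ### Filled-in closures of the bounding graphs -/

/-- The filled-in closure of the graph of `φ`. -/
def filledClosure (φ : UnitAddCircle × UnitAddCircle → ℝ) :
    Set ((UnitAddCircle × UnitAddCircle) × ℝ) :=
  {p | ∃ y₁ y₂ : ℝ, (p.1, y₁) ∈ closure (Set.range fun θ => (θ, φ θ)) ∧
    (p.1, y₂) ∈ closure (Set.range fun θ => (θ, φ θ)) ∧ y₁ ≤ p.2 ∧ p.2 ≤ y₂}

/-- The lower bounding graph `φ⁺⁻` of the filled-in closure of the graph of `φ⁺`. -/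
noncomputable def phiPlusMinus (a : ℝ) (F : UnitAddCircle → ℝ → ℝ)
    (θ : UnitAddCircle × UnitAddCircle) : ℝ :=
  sInf {y : ℝ | (θ, y) ∈ filledClosure (phiPlus a F)}

/-- The upper bounding graph `φ⁻⁺` of the filled-in closure of the graph of `φ⁻`. -/
noncomputable def phiMinusPlus (a : ℝ) (F : UnitAddCircle → ℝ → ℝ)
    (θ : UnitAddCircle × UnitAddCircle) : ℝ :=
  sSup {y : ℝ | (θ, y) ∈ filledClosure (phiMinus a F)}

/-! ### Strong stable fibres

Along strong stable fibres the `x`-coordinate is taken in the closed unit interval `[0, 1]`, so the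
skew product is used in the coordinates `(ξ, x, y) ∈ [0, 1) × [0, 1] × ℝ`. -/

/-- The contraction rate `σ(ξ)` of the baker map in the `x`-direction. -/
noncomputable def sigmaRate (a ξ : ℝ) : ℝ := if ξ < a then a else 1 - a

/-- The skew product in interval coordinates `(ξ, x, y)`. -/
noncomputable def skewI (a : ℝ) (F : UnitAddCircle → ℝ → ℝ) (p : ℝ × ℝ × ℝ) : ℝ × ℝ × ℝ :=
  if p.1 < a then (p.1 / a, a * p.2.1, F (p.2.1 : UnitAddCircle) p.2.2)
  else ((p.1 - a) / (1 - a), a + (1 - a) * p.2.1, F (p.2.1 : UnitAddCircle) p.2.2)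

/-- `Γ(ξ, x, y) = σ(ξ) / f_x'(y)`. -/
noncomputable def gammaRatio (a : ℝ) (F : UnitAddCircle → ℝ → ℝ) (p : ℝ × ℝ × ℝ) : ℝ :=
  sigmaRate a p.1 / deriv (F (p.2.1 : UnitAddCircle)) p.2.2

/-- `A(ξ, x, y) = (∂f_x/∂x)(y) / f_x'(y)`. -/
noncomputable def slopeTerm (F : UnitAddCircle → ℝ → ℝ) (p : ℝ × ℝ × ℝ) : ℝ :=
  deriv (fun u : ℝ => F (u : UnitAddCircle) p.2.2) p.2.1 /
    deriv (F (p.2.1 : UnitAddCircle)) p.2.2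

/-- The third component `X₃ = - ∑ₖ (∏_{j<k} Γ ∘ fʲ) · (A ∘ fᵏ)` of the strong stable direction field
`(0, 1, X₃)`. -/
noncomputable def X3 (a : ℝ) (F : UnitAddCircle → ℝ → ℝ) (ξ x y : ℝ) : ℝ :=
  -∑' k : ℕ, (∏ j ∈ Finset.range k, gammaRatio a F ((skewI a F)^[j] (ξ, x, y))) *
    slopeTerm F ((skewI a F)^[k] (ξ, x, y))

/-- `l : D → J` solves `l' = X₃(ξ, u, l(u))` on the interval `D ⊆ [0, 1]`, with `l(x) = y`. -/
def IsFibreSolution (a : ℝ) (F : UnitAddCircle → ℝ → ℝ) (jL jU ξ x y : ℝ)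
    (D : Set ℝ) (l : ℝ → ℝ) : Prop :=
  D ⊆ Set.Icc 0 1 ∧ D.OrdConnected ∧ x ∈ D ∧ l x = y ∧ Set.MapsTo l D (Set.Icc jL jU) ∧
    ∀ u ∈ D, HasDerivWithinAt l (X3 a F ξ u (l u)) D u

/-- `γ` is (the graph of) a strong stable fibre in the `ξ`-plane: the graph of the unique maximal
solution through some point `(x, y) ∈ [0, 1] × J`. -/
def IsStrongStableFibre (a : ℝ) (F : UnitAddCircle → ℝ → ℝ) (jL jU : ℝ) (ξ : UnitAddCircle)
    (γ : Set (ℝ × ℝ)) : Prop :=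
  ∃ x ∈ Set.Icc (0 : ℝ) 1, ∃ y ∈ Set.Icc jL jU, ∃ (D : Set ℝ) (l : ℝ → ℝ),
    IsFibreSolution a F jL jU (rep ξ) x y D l ∧
    (∀ (D' : Set ℝ) (l' : ℝ → ℝ), IsFibreSolution a F jL jU (rep ξ) x y D' l' →
      D' ⊆ D ∧ Set.EqOn l' l D') ∧
    γ = (fun u : ℝ => (u, l u)) '' D

/-! ### Measures -/

/-- The exponent `λ(ν) = ∫ log f_θ'(φ(θ)) dν(θ)` of a graph `φ`. -/
noncomputable def graphExponent (F : UnitAddCircle → ℝ → ℝ)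
    (ν : Measure (UnitAddCircle × UnitAddCircle)) (φ : UnitAddCircle × UnitAddCircle → ℝ) : ℝ :=
  ∫ θ, Real.log (deriv (F θ.2) (φ θ)) ∂ν

/-- The lift `ν_φ` of `ν` to the graph of `φ`. -/
noncomputable def graphMeasure (ν : Measure (UnitAddCircle × UnitAddCircle))
    (φ : UnitAddCircle × UnitAddCircle → ℝ) : Measure ((UnitAddCircle × UnitAddCircle) × ℝ) :=
  ν.map fun θ => (θ, φ θ)

/-- `μ` is an `f`-invariant measure that projects to `ν`. -/
def IsInvariantLift (a : ℝ) (F : UnitAddCircle → ℝ → ℝ)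
    (ν : Measure (UnitAddCircle × UnitAddCircle))
    (μ : Measure ((UnitAddCircle × UnitAddCircle) × ℝ)) : Prop :=
  MeasurePreserving (skew a F) μ μ ∧ μ.map Prod.fst = ν

/-- The conditional measures of `μ` on the planes `{ξ} × 𝕋 × ℝ`. -/
noncomputable def planeConditional (μ : Measure ((UnitAddCircle × UnitAddCircle) × ℝ))
    [IsFiniteMeasure (μ.map MeasurableEquiv.prodAssoc)] :
    ProbabilityTheory.Kernel UnitAddCircle (UnitAddCircle × ℝ) :=
  (μ.map MeasurableEquiv.prodAssoc).condKernel

instance (ν : Measure (UnitAddCircle × UnitAddCircle)) [IsFiniteMeasure ν]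
    (φ : UnitAddCircle × UnitAddCircle → ℝ) : IsFiniteMeasure (graphMeasure ν φ) := by
  unfold graphMeasure
  infer_instance

/-- The measure `m` on `𝕋 × ℝ` is carried by `γ ⊆ [0, 1] × ℝ`. -/
def IsCarriedBy (m : Measure (UnitAddCircle × ℝ)) (γ : Set (ℝ × ℝ)) : Prop :=
  m {p | (rep p.1, p.2) ∉ γ} = 0

/-- The points `x`, `x'` have the same itinerary of length `n` with respect to the partition
`{[0, a), [a, 1)}` under `τ`. -/
def SameItinerary (a : ℝ) (n : ℕ) (x x' : UnitAddCircle) : Prop :=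
  ∀ k < n, (rep ((tau a)^[k] x) < a ↔ rep ((tau a)^[k] x') < a)

/-- `ν` is a Gibbs measure for `T` with a Hölder potential `ψ`. The Hölder property refers to the
symbolic coding of `T` as the full two-sided shift on two symbols: the itinerary of `ξ` is the
forward itinerary of `(ξ, x)` under `T`, and that of `x` is the backward one. The Gibbs property is
the two-sided bound `ν(n-cylinder of θ) ≍ exp(∑_{k<n} ψ(Tᵏθ) - n P)`. -/
def IsGibbs (a : ℝ) (ν : Measure (UnitAddCircle × UnitAddCircle)) : Prop :=
  MeasurePreserving (baker a) ν ν ∧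
  ∃ ψ : UnitAddCircle × UnitAddCircle → ℝ,
    (∃ C ρ : ℝ, 0 < ρ ∧ ρ < 1 ∧ ∀ (n : ℕ) (θ θ' : UnitAddCircle × UnitAddCircle),
      SameItinerary a n θ.1 θ'.1 → SameItinerary a n θ.2 θ'.2 → |ψ θ - ψ θ'| ≤ C * ρ ^ n) ∧
    ∃ P K : ℝ, 0 < K ∧ ∀ (n : ℕ) (θ : UnitAddCircle × UnitAddCircle),
      K⁻¹ * Real.exp ((∑ k ∈ Finset.range n, ψ ((baker a)^[k] θ)) - n * P) ≤
          ν.real {θ' | SameItinerary a n θ.1 θ'.1} ∧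
        ν.real {θ' | SameItinerary a n θ.1 θ'.1} ≤
          K * Real.exp ((∑ k ∈ Finset.range n, ψ ((baker a)^[k] θ)) - n * P)

/-! ### The three cases

Here `γ ξ` is the strong stable fibre carrying the conditional measure of `ν_{φ*}` over `ξ`. -/

/-- The case in which the fibres avoid both filled-in closures. -/
def CaseA1 (a : ℝ) (F : UnitAddCircle → ℝ → ℝ) (ν : Measure (UnitAddCircle × UnitAddCircle))
    (γ : UnitAddCircle → Set (ℝ × ℝ)) : Prop :=
  (∀ μ, IsInvariantLift a F ν μ ∧ μ (filledClosure (phiPlus a F))ᶜ = 0 ↔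
    μ = graphMeasure ν (phiPlus a F)) ∧
  (∀ μ, IsInvariantLift a F ν μ ∧ μ (filledClosure (phiMinus a F))ᶜ = 0 ↔
    μ = graphMeasure ν (phiMinus a F)) ∧
  (∀ᵐ ξ ∂(ν.map Prod.fst), ∀ p ∈ γ ξ,
    ((ξ, (p.1 : UnitAddCircle)), p.2) ∉ filledClosure (phiPlus a F) ∧
    ((ξ, (p.1 : UnitAddCircle)), p.2) ∉ filledClosure (phiMinus a F)) ∧
  graphExponent F ν (phiMinus a F) < 0 ∧ graphExponent F ν (phiPlus a F) < 0 ∧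
  0 < graphExponent F ν (phiStar a F)

/-- The case in which the fibres coincide with the graph of `φ⁺⁻`. -/
def CaseA2Plus (a : ℝ) (F : UnitAddCircle → ℝ → ℝ) (ν : Measure (UnitAddCircle × UnitAddCircle))
    (γ : UnitAddCircle → Set (ℝ × ℝ)) : Prop :=
  (∀ μ, IsInvariantLift a F ν μ →
    μ (filledClosure (phiPlus a F) ∪ filledClosure (phiMinus a F))ᶜ = 0) ∧
  graphMeasure ν (phiStar a F) (Set.range fun θ => (θ, phiPlusMinus a F θ))ᶜ = 0 ∧
  (∀ᵐ ξ ∂(ν.map Prod.fst),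
    γ ξ = (fun u : ℝ => (u, phiPlusMinus a F (ξ, (u : UnitAddCircle)))) '' Set.Icc 0 1) ∧
  (((∀ᵐ θ ∂ν, phiPlusMinus a F θ < phiPlus a F θ) ∧
      graphExponent F ν (phiMinus a F) < 0 ∧ graphExponent F ν (phiPlus a F) < 0 ∧
      0 < graphExponent F ν (phiStar a F)) ∨
    ((∀ᵐ θ ∂ν, phiPlusMinus a F θ = phiPlus a F θ) ∧
      graphExponent F ν (phiMinus a F) < 0 ∧ graphExponent F ν (phiPlus a F) = 0 ∧
      graphExponent F ν (phiStar a F) = 0))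

/-- The case in which the fibres coincide with the graph of `φ⁻⁺`. -/
def CaseA2Minus (a : ℝ) (F : UnitAddCircle → ℝ → ℝ) (ν : Measure (UnitAddCircle × UnitAddCircle))
    (γ : UnitAddCircle → Set (ℝ × ℝ)) : Prop :=
  (∀ μ, IsInvariantLift a F ν μ →
    μ (filledClosure (phiPlus a F) ∪ filledClosure (phiMinus a F))ᶜ = 0) ∧
  graphMeasure ν (phiStar a F) (Set.range fun θ => (θ, phiMinusPlus a F θ))ᶜ = 0 ∧
  (∀ᵐ ξ ∂(ν.map Prod.fst),
    γ ξ = (fun u : ℝ => (u, phiMinusPlus a F (ξ, (u : UnitAddCircle)))) '' Set.Icc 0 1) ∧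
  (((∀ᵐ θ ∂ν, phiMinus a F θ < phiMinusPlus a F θ) ∧
      graphExponent F ν (phiMinus a F) < 0 ∧ graphExponent F ν (phiPlus a F) < 0 ∧
      0 < graphExponent F ν (phiStar a F)) ∨
    ((∀ᵐ θ ∂ν, phiMinusPlus a F θ = phiMinus a F θ) ∧
      graphExponent F ν (phiPlus a F) < 0 ∧ graphExponent F ν (phiMinus a F) = 0 ∧
      graphExponent F ν (phiStar a F) = 0))

/-! ### The circle map and the baker map -/

/-! The attractor over `θ = (ξ, x)` depends only on the past of `θ`, hence on `x`; the strong stable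
direction depends on the future, hence on `ξ` as well as on the point of the plane. The proof plays
these two structures against each other.

Three graphs. For an increasing `g` with negative Schwarzian derivative, `(g')^(-1/2)` is strictly
convex, which yields strict inequalities between derivatives and secant slopes at two or three
points. The logarithmic secant slope between two ordered invariant graphs is a coboundary and
integrates to zero (`IsInvariantGraph.integral_log_secant`). Hence two ordered graphs have exponents
with negative sum, three have signs -, +, -, and four cannot coexist. A graph with negative exponent
attracts a neighbourhood on a set of positive measure, so the upper edge of the basin of `φ⁻` and
the lower edge of the basin of `φ⁺` agree almost everywhere, and the exponents follow
(`IsBakerDrivenSystem.trichotomy`). By recurrence every invariant lift lives on `φ⁻`, `φ*`, `φ⁺`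
(`IsBakerDrivenSystem.ae_mem_graphs`).

Rigidity. The field `X3` is Lipschitz in `y`, so its leaves are unique; the skew product maps leaves
to leaves over shrinking intervals, so orbits on one leaf are asymptotic. Take `x`, `x'` independent
over the same `ξ`. Along a subsequence of times the values of `φ⁺` at the two orbits merge, although
`φ⁺` is only measurable. If the leaf through `φ*(ξ, x)` passed above `φ*(ξ, x')`, its orbit would
approach both `φ*` and `φ⁺`, and `φ⁺ - φ*` would tend to zero along a sequence of times, which a
positive function cannot do under a measure preserving map. Exchanging the two points gives
equality; when `φ* = φ⁺`, the graph `φ⁻` plays this role. The Gibbs property gives the conditional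
measures full support, so local leaves chain together into a single one
(`IsBakerDrivenSystem.ae_exists_leaf`).

Position. The region strictly below `φ⁺⁻` is open and its complement is forward invariant. If `φ*`
is strictly below `φ⁺⁻` with positive probability, its orbit returns to a compact part of that
region and, by contraction, so does the orbit of every point of the leaf; hence the whole leaf lies
strictly below. Otherwise semicontinuity squeezes the leaf onto `φ⁺⁻`. The reflection `y ↦ -y` gives
the same alternative for `φ⁻⁺`. The three cases are: `φ*` on `φ⁺⁻`, on `φ⁻⁺`, or strictly between
them. -/

theorem coe_rep (x : UnitAddCircle) : ((rep x : ℝ) : UnitAddCircle) = x :=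
  AddCircle.coe_equivIco

theorem rep_mem (x : UnitAddCircle) : rep x ∈ Set.Ico (0 : ℝ) 1 := by
  have := (AddCircle.equivIco (1 : ℝ) 0 x).2
  simpa [rep] using this

theorem rep_nonneg (x : UnitAddCircle) : 0 ≤ rep x := (rep_mem x).1

theorem rep_lt_one (x : UnitAddCircle) : rep x < 1 := (rep_mem x).2

theorem rep_mem_Icc (x : UnitAddCircle) : rep x ∈ Set.Icc (0 : ℝ) 1 :=
  ⟨rep_nonneg x, (rep_lt_one x).le⟩

theorem rep_coe {t : ℝ} (h0 : 0 ≤ t) (h1 : t < 1) : rep (t : UnitAddCircle) = t := by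
  have h : t ∈ Set.Ico (0 : ℝ) (0 + 1) := ⟨h0, by linarith⟩
  simp [rep, AddCircle.equivIco_coe_eq h]

theorem measurable_rep : Measurable rep :=
  measurable_subtype_coe.comp (AddCircle.measurableEquivIco (1 : ℝ) 0).measurable

theorem continuous_coe_circle : Continuous (fun t : ℝ => (t : UnitAddCircle)) :=
  AddCircle.continuous_mk' 1

theorem circle_coe_one : ((1 : ℝ) : UnitAddCircle) = 0 := AddCircle.coe_period 1

theorem dist_coe_le (s t : ℝ) : dist (s : UnitAddCircle) (t : UnitAddCircle) ≤ |s - t| := by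
  rw [dist_eq_norm, ← AddCircle.coe_sub, UnitAddCircle.norm_eq]
  simpa using round_le (s - t) 0

/-- The left endpoint of the branch of the baker map that contains `ξ`. -/
noncomputable def branchOffset (a ξ : ℝ) : ℝ := if ξ < a then 0 else a

section Baker

variable {a : ℝ}

theorem sigmaRate_pos (h0 : 0 < a) (h1 : a < 1) (ξ : ℝ) : 0 < sigmaRate a ξ := by
  unfold sigmaRate; split_ifs <;> linarith

theorem sigmaRate_le (ξ : ℝ) : sigmaRate a ξ ≤ max a (1 - a) := by
  unfold sigmaRate; split_ifs <;> simp

theorem branchOffset_nonneg (h0 : 0 < a) (ξ : ℝ) : 0 ≤ branchOffset a ξ := by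
  unfold branchOffset; split_ifs <;> linarith

theorem branch_le_one (h1 : a < 1) (ξ : ℝ) : sigmaRate a ξ + branchOffset a ξ ≤ 1 := by
  unfold sigmaRate branchOffset; split_ifs <;> linarith

theorem branch_mem_Icc (h0 : 0 < a) (h1 : a < 1) (ξ : ℝ) {u : ℝ} (hu : u ∈ Set.Icc (0 : ℝ) 1) :
    sigmaRate a ξ * u + branchOffset a ξ ∈ Set.Icc (0 : ℝ) 1 := by
  have hs := sigmaRate_pos h0 h1 ξ
  have hb := branchOffset_nonneg h0 ξ
  have := branch_le_one h1 ξ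
  have h2 := mul_le_mul_of_nonneg_left hu.2 hs.le
  have h3 := mul_nonneg hs.le hu.1
  exact ⟨by linarith, by linarith⟩

theorem branch_mem_Ico (h0 : 0 < a) (h1 : a < 1) (ξ : ℝ) {u : ℝ} (hu : u ∈ Set.Ico (0 : ℝ) 1) :
    sigmaRate a ξ * u + branchOffset a ξ ∈ Set.Ico (0 : ℝ) 1 := by
  have hs := sigmaRate_pos h0 h1 ξ
  have hb := branchOffset_nonneg h0 ξ
  have := branch_le_one h1 ξ
  have h2 := mul_lt_mul_of_pos_left hu.2 hs
  have h3 := mul_nonneg hs.le hu.1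
  exact ⟨by linarith, by linarith⟩

theorem branch_lt_iff (h0 : 0 < a) (h1 : a < 1) (ξ : ℝ) {u : ℝ} (hu : u ∈ Set.Ico (0 : ℝ) 1) :
    sigmaRate a ξ * u + branchOffset a ξ < a ↔ ξ < a := by
  unfold sigmaRate branchOffset
  split_ifs with h
  · simp only [h, iff_true]; nlinarith [hu.1, hu.2]
  · simp only [h, iff_false]; nlinarith [hu.1, hu.2]

theorem rep_tau (h0 : 0 < a) (h1 : a < 1) (x : UnitAddCircle) :
    rep (tau a x) = (rep x - branchOffset a (rep x)) / sigmaRate a (rep x) := by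
  have hx0 := rep_nonneg x
  have hx1 := rep_lt_one x
  unfold tau branchOffset sigmaRate
  split_ifs with h
  · rw [rep_coe (by positivity) (by rwa [div_lt_one h0])]; simp
  · push Not at h
    rw [rep_coe (div_nonneg (by linarith) (by linarith)) (by rw [div_lt_one] <;> linarith)]

theorem rep_eq_tau (h0 : 0 < a) (h1 : a < 1) (x : UnitAddCircle) :
    rep x = sigmaRate a (rep x) * rep (tau a x) + branchOffset a (rep x) := by
  have := sigmaRate_pos h0 h1 (rep x)
  rw [rep_tau h0 h1]; field_simp; ring

theorem tau_coe_branch (h0 : 0 < a) (h1 : a < 1) (ξ : ℝ) {u : ℝ} (hu : u ∈ Set.Icc (0 : ℝ) 1) :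
    tau a ((sigmaRate a ξ * u + branchOffset a ξ : ℝ) : UnitAddCircle) = (u : UnitAddCircle) := by
  have hs := sigmaRate_pos h0 h1 ξ
  have h1' : (0 : ℝ) < 1 - a := by linarith
  rcases hu.2.lt_or_eq with hlt | rfl
  · have hm := branch_mem_Ico h0 h1 ξ ⟨hu.1, hlt⟩
    have hi := branch_lt_iff h0 h1 ξ ⟨hu.1, hlt⟩
    unfold tau
    rw [rep_coe hm.1 hm.2]
    unfold sigmaRate branchOffset at *
    split_ifs at * with h2 h3 h3
    · congr 1; field_simp; ring
    · exact absurd (hi.2 h2) h3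
    · exact absurd (hi.1 h3) h2
    · congr 1; field_simp; ring
  -- At `u = 1` the point is the right end of its branch. It is `a`, which the second branch sends
  -- to `0`, or `1`, which is the fixed point `0` of the circle.
  · rw [circle_coe_one]
    unfold sigmaRate branchOffset
    split_ifs with h2
    · unfold tau
      rw [mul_one, add_zero, rep_coe h0.le h1]
      simp
    · have : ((1 - a) * 1 + a : ℝ) = 1 := by ring
      rw [this, circle_coe_one]
      have h00 : rep (0 : UnitAddCircle) = 0 := by
        have := rep_coe le_rfl (zero_lt_one (α := ℝ)); simpa using this
      simp [tau, h00, h0]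

theorem baker_fst (θ : UnitAddCircle × UnitAddCircle) : (baker a θ).1 = tau a θ.1 := by
  unfold baker; split_ifs <;> rfl

theorem baker_snd (θ : UnitAddCircle × UnitAddCircle) :
    (baker a θ).2 =
      ((sigmaRate a (rep θ.1) * rep θ.2 + branchOffset a (rep θ.1) : ℝ) : UnitAddCircle) := by
  unfold baker sigmaRate branchOffset
  split_ifs
  · simp
  · simp [add_comm]

theorem rep_baker_snd (h0 : 0 < a) (h1 : a < 1) (θ : UnitAddCircle × UnitAddCircle) :
    rep (baker a θ).2 = sigmaRate a (rep θ.1) * rep θ.2 + branchOffset a (rep θ.1) := by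
  have := branch_mem_Ico h0 h1 (rep θ.1) (rep_mem θ.2)
  rw [baker_snd, rep_coe this.1 this.2]

/-- The coordinate `x` stores the past: `τ` undoes one step of the baker map on it. This is why `φ⁺`
and `φ⁻` will depend on `x` only. -/
theorem tau_baker_snd (h0 : 0 < a) (h1 : a < 1) (θ : UnitAddCircle × UnitAddCircle) :
    tau a (baker a θ).2 = θ.2 := by
  rw [baker_snd, tau_coe_branch h0 h1 _ (rep_mem_Icc _), coe_rep]

theorem baker_side (h0 : 0 < a) (h1 : a < 1) (θ : UnitAddCircle × UnitAddCircle) :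
    rep (baker a θ).2 < a ↔ rep θ.1 < a := by
  rw [rep_baker_snd h0 h1, branch_lt_iff h0 h1 _ (rep_mem _)]

theorem baker_iterate_fst (n : ℕ) (θ : UnitAddCircle × UnitAddCircle) :
    ((baker a)^[n] θ).1 = (tau a)^[n] θ.1 := by
  induction n with
  | zero => rfl
  | succ n ih => rw [Function.iterate_succ_apply', baker_fst, ih, Function.iterate_succ_apply']

theorem tau_iterate_baker_snd (h0 : 0 < a) (h1 : a < 1) (n : ℕ)
    (θ : UnitAddCircle × UnitAddCircle) : (tau a)^[n] ((baker a)^[n] θ).2 = θ.2 := by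
  induction n with
  | zero => rfl
  | succ n ih => rw [Function.iterate_succ_apply, Function.iterate_succ_apply', tau_baker_snd h0 h1,
      ih]

theorem baker_surjective (h0 : 0 < a) (h1 : a < 1) : Function.Surjective (baker a) := by
  intro θ
  -- The branch that contains `x` tells which symbol was used last, so the preimage of `ξ` is taken
  -- in the branch on that side.
  let ξ : ℝ := sigmaRate a (rep θ.2) * rep θ.1 + branchOffset a (rep θ.2)
  have hξ : ξ ∈ Set.Ico (0 : ℝ) 1 := branch_mem_Ico h0 h1 _ (rep_mem _)
  have hs : ξ < a ↔ rep θ.2 < a := branch_lt_iff h0 h1 _ (rep_mem _)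
  refine ⟨((ξ : UnitAddCircle), tau a θ.2), Prod.ext ?_ ?_⟩
  · rw [baker_fst]
    exact (tau_coe_branch h0 h1 _ (rep_mem_Icc _)).trans (coe_rep _)
  · rw [baker_snd]
    have e1 : sigmaRate a (rep (ξ : UnitAddCircle)) = sigmaRate a (rep θ.2) := by
      rw [rep_coe hξ.1 hξ.2]; unfold sigmaRate; simp only [hs]
    have e2 : branchOffset a (rep (ξ : UnitAddCircle)) = branchOffset a (rep θ.2) := by
      rw [rep_coe hξ.1 hξ.2]; unfold branchOffset; simp only [hs]
    rw [e1, e2, ← rep_eq_tau h0 h1, coe_rep]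

theorem measurable_coe_circle : Measurable (fun t : ℝ => (t : UnitAddCircle)) :=
  continuous_coe_circle.measurable

theorem measurable_tau : Measurable (tau a) := by
  refine Measurable.ite (measurableSet_lt measurable_rep measurable_const) ?_ ?_
  · exact measurable_coe_circle.comp (measurable_rep.div_const a)
  · exact measurable_coe_circle.comp ((measurable_rep.sub_const a).div_const _)

theorem measurable_sigmaRate : Measurable (sigmaRate a) :=
  Measurable.ite (measurableSet_lt measurable_id measurable_const) measurable_const measurable_const

theorem measurable_branchOffset : Measurable (branchOffset a) :=
  Measurable.ite (measurableSet_lt measurable_id measurable_const) measurable_const measurable_const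

theorem measurable_baker : Measurable (baker a) := by
  have : baker a = fun θ => (tau a θ.1,
      ((sigmaRate a (rep θ.1) * rep θ.2 + branchOffset a (rep θ.1) : ℝ) : UnitAddCircle)) :=
    funext fun θ => Prod.ext (baker_fst θ) (baker_snd θ)
  rw [this]
  have h1 : Measurable fun θ : UnitAddCircle × UnitAddCircle => rep θ.1 :=
    measurable_rep.comp measurable_fst
  have h2 : Measurable fun θ : UnitAddCircle × UnitAddCircle => rep θ.2 :=
    measurable_rep.comp measurable_snd
  exact (measurable_tau.comp measurable_fst).prodMk (measurable_coe_circle.comp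
    (((measurable_sigmaRate.comp h1).mul h2).add (measurable_branchOffset.comp h1)))

theorem continuous_tau (h0 : 0 < a) (h1 : a < 1) : Continuous (tau a) := by
  have h1' : (0 : ℝ) < 1 - a := by linarith
  let g : ℝ → UnitAddCircle := fun t =>
    if t ≤ a then ((t / a : ℝ) : UnitAddCircle) else (((t - a) / (1 - a) : ℝ) : UnitAddCircle)
  have hg : Continuous g := by
    refine Continuous.if_le (continuous_coe_circle.comp (by fun_prop))
      (continuous_coe_circle.comp (by fun_prop)) continuous_id continuous_const ?_
    rintro x rfl
    simp only [sub_self, zero_div]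
    rw [div_self h0.ne', circle_coe_one]; simp
  have e : tau a = AddCircle.liftIco 1 0 g := by
    funext x
    have hx := rep_mem x
    have h2 : AddCircle.liftIco 1 0 g x = g (rep x) := by
      conv_lhs => rw [← coe_rep x]
      exact AddCircle.liftIco_coe_apply (by simpa using hx)
    rw [h2]
    simp only [tau, g]
    rcases lt_trichotomy (rep x) a with h | h | h
    · simp [h, h.le]
    · rw [if_neg (by linarith), if_pos h.le, h, div_self h0.ne', circle_coe_one]; simp
    · rw [if_neg (by linarith), if_neg (by linarith)]
  rw [e]
  refine AddCircle.liftIco_continuous ?_ hg.continuousOn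
  simp only [g]
  rw [if_pos h0.le, if_neg (by linarith), zero_add, div_self h1'.ne', circle_coe_one]
  simp

theorem nhds_coe_circle (t : ℝ) :
    𝓝 (t : UnitAddCircle) = Filter.map (fun s : ℝ => (s : UnitAddCircle)) (𝓝 t) :=
  QuotientAddGroup.nhds_eq _ t

theorem rep_coe_neg {t : ℝ} (h0 : t < 0) (h1 : -1 ≤ t) : rep (t : UnitAddCircle) = t + 1 := by
  have : (t : UnitAddCircle) = ((t + 1 : ℝ) : UnitAddCircle) := by
    rw [AddCircle.coe_add, circle_coe_one, add_zero]
  rw [this, rep_coe (by linarith) (by linarith)]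

/-- The circle map has a local section through every point. -/
theorem tau_section (h0 : 0 < a) (h1 : a < 1) (x : UnitAddCircle) :
    ∃ s : UnitAddCircle → UnitAddCircle, s (tau a x) = x ∧ ContinuousAt s (tau a x) ∧
      ∀ w, tau a (s w) = w := by
  have h1' : (0 : ℝ) < 1 - a := by linarith
  let S : ℝ → UnitAddCircle → UnitAddCircle := fun ξ w =>
    ((sigmaRate a ξ * rep w + branchOffset a ξ : ℝ) : UnitAddCircle)
  have hS : ∀ ξ w, tau a (S ξ w) = w := fun ξ w =>
    (tau_coe_branch h0 h1 ξ (rep_mem_Icc w)).trans (coe_rep w)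
  have hSx : S (rep x) (tau a x) = x := by
    simp only [S]; rw [← rep_eq_tau h0 h1, coe_rep]
  by_cases hx : tau a x = 0
  -- Here `x` is an endpoint of the two branches. To the right of `0` the section uses the branch
  -- that starts at `x`; to the left it uses the branch that ends at `x`, whose left end is `b'`.
  · let b : ℝ := branchOffset a (rep x)
    let b' : ℝ := if rep x < a then a else 0
    have hr0 : rep (0 : UnitAddCircle) = 0 := by
      simpa using rep_coe le_rfl (zero_lt_one (α := ℝ))
    have hxb : (b : UnitAddCircle) = x := by
      rw [hx] at hSx; simpa [S, hr0] using hSx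
    refine ⟨fun w => if rep w < 1 / 2 then S b w else S b' w, ?_, ?_, ?_⟩
    · have hb : S b 0 = x := by
        rw [← hxb]; simp only [S, hr0, b]
        unfold branchOffset; split_ifs <;> simp_all
      simpa [hx, hr0] using hb
    · have e0 : (0 : UnitAddCircle) = ((0 : ℝ) : UnitAddCircle) := by simp
      rw [hx, ContinuousAt, e0, nhds_coe_circle, tendsto_map'_iff]
      let g : ℝ → UnitAddCircle := fun t => if 0 ≤ t then
        ((sigmaRate a b * t + branchOffset a b : ℝ) : UnitAddCircle) else
        ((sigmaRate a b' * (t + 1) + branchOffset a b' : ℝ) : UnitAddCircle)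
      have hg : Continuous g := by
        refine Continuous.if_le (continuous_coe_circle.comp (by fun_prop))
          (continuous_coe_circle.comp (by fun_prop)) continuous_const continuous_id ?_
        rintro t rfl
        simp only [b, b', sigmaRate, branchOffset]
        by_cases h : rep x < a
        · have : ((1 - a) * (0 + 1) + a : ℝ) = 1 := by ring
          simp only [h, h0, if_true, lt_irrefl, if_false, this, circle_coe_one]
          simp
        · simp [h, h0]
      have hgr : (fun t : ℝ => if rep (t : UnitAddCircle) < 1 / 2 then S b t else S b' t)
          =ᶠ[𝓝 0] g := by
        filter_upwards [Ioo_mem_nhds (show (-(1 / 2) : ℝ) < 0 by norm_num)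
          (show (0 : ℝ) < 1 / 2 by norm_num)] with t ht
        simp only [g]
        by_cases h : 0 ≤ t
        · have hr := rep_coe h (by linarith [ht.2])
          rw [if_pos h, if_pos (by rw [hr]; exact ht.2)]
          simp only [S, hr]
        · have hr := rep_coe_neg (not_le.1 h) (by linarith [ht.1])
          rw [if_neg h, if_neg (by rw [hr]; linarith [ht.1])]
          simp only [S, hr]
      have := hg.continuousAt (x := 0)
      have h3 := (this.congr hgr.symm)
      simpa [ContinuousAt, Function.comp_def] using h3
    · intro w
      dsimp only
      split_ifs <;> exact hS _ _
  · refine ⟨S (rep x), hSx, ?_, hS _⟩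
    have : ContinuousAt rep (tau a x) :=
      continuousAt_subtype_val.comp (AddCircle.continuousAt_equivIco 1 0 (by simpa using hx))
    have h2 : ContinuousAt (fun w => sigmaRate a (rep x) * rep w + branchOffset a (rep x))
        (tau a x) := (continuousAt_const.mul this).add continuousAt_const
    exact continuous_coe_circle.continuousAt.comp h2

theorem SameItinerary.abs_sub_le (h0 : 0 < a) (h1 : a < 1) {n : ℕ} {x x' : UnitAddCircle}
    (h : SameItinerary a n x x') : |rep x - rep x'| ≤ max a (1 - a) ^ n := by
  induction n generalizing x x' with
  | zero =>
    rw [pow_zero, abs_le]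
    have := rep_mem x; have := rep_mem x'
    exact ⟨by linarith [rep_nonneg x, rep_lt_one x'], by linarith [rep_nonneg x', rep_lt_one x]⟩
  | succ n ih =>
    have hs : rep x < a ↔ rep x' < a := h 0 (Nat.succ_pos n)
    have h' : SameItinerary a n (tau a x) (tau a x') := fun k hk => by
      simpa only [Function.iterate_succ_apply] using h (k + 1) (by omega)
    have e1 : sigmaRate a (rep x') = sigmaRate a (rep x) := by unfold sigmaRate; simp only [hs]
    have e2 : branchOffset a (rep x') = branchOffset a (rep x) := by
      unfold branchOffset; simp only [hs]
    have hp := sigmaRate_pos h0 h1 (rep x)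
    rw [rep_eq_tau h0 h1 x, rep_eq_tau h0 h1 x', e1, e2]
    calc |_| = sigmaRate a (rep x) * |rep (tau a x) - rep (tau a x')| := by
          rw [add_sub_add_right_eq_sub, ← mul_sub, abs_mul, abs_of_pos hp]
      _ ≤ max a (1 - a) * max a (1 - a) ^ n := by
          gcongr
          · exact sigmaRate_le _
          · exact ih h'
      _ = _ := by ring

theorem max_rate_lt_one (h0 : 0 < a) (h1 : a < 1) : max a (1 - a) < 1 := max_lt h1 (by linarith)

theorem max_rate_pos (h0 : 0 < a) : 0 < max a (1 - a) := lt_max_of_lt_left h0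

theorem skew_iterate_fst (F : UnitAddCircle → ℝ → ℝ) (n : ℕ)
    (p : (UnitAddCircle × UnitAddCircle) × ℝ) : ((skew a F)^[n] p).1 = (baker a)^[n] p.1 := by
  induction n with
  | zero => rfl
  | succ n ih => rw [Function.iterate_succ_apply', Function.iterate_succ_apply', ← ih]; rfl

theorem skew_iterate_succ_snd (F : UnitAddCircle → ℝ → ℝ) (n : ℕ)
    (p : (UnitAddCircle × UnitAddCircle) × ℝ) :
    ((skew a F)^[n + 1] p).2 = F ((baker a)^[n] p.1).2 ((skew a F)^[n] p).2 := by
  rw [Function.iterate_succ_apply', ← skew_iterate_fst F n p]; rfl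

theorem skew_iterate_eq (F : UnitAddCircle → ℝ → ℝ) (n : ℕ)
    (p : (UnitAddCircle × UnitAddCircle) × ℝ) :
    (skew a F)^[n] p = ((baker a)^[n] p.1, ((skew a F)^[n] p).2) :=
  Prod.ext (skew_iterate_fst F n p) rfl

/-- Two points over the same base point `ξ` are contracted by the baker map. -/
theorem abs_rep_baker_iterate_sub (h0 : 0 < a) (h1 : a < 1) (n : ℕ) (ξ x x' : UnitAddCircle) :
    |rep ((baker a)^[n] (ξ, x)).2 - rep ((baker a)^[n] (ξ, x')).2| ≤ max a (1 - a) ^ n := by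
  induction n with
  | zero =>
    rw [pow_zero, abs_le]
    exact ⟨by simp; linarith [rep_nonneg x, rep_lt_one x'],
      by simp; linarith [rep_nonneg x', rep_lt_one x]⟩
  | succ n ih =>
    rw [Function.iterate_succ_apply', Function.iterate_succ_apply', rep_baker_snd h0 h1,
      rep_baker_snd h0 h1, baker_iterate_fst, baker_iterate_fst, add_sub_add_right_eq_sub,
      ← mul_sub, abs_mul, abs_of_pos (sigmaRate_pos h0 h1 _), pow_succ']
    gcongr
    exact sigmaRate_le _

end Baker

/-! ### Maps with negative Schwarzian derivative -/

section Schwarzian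

variable {g : ℝ → ℝ}

theorem hasDerivAt_rpow_neg_half_deriv (hg : ContDiff ℝ 3 g) (hp : ∀ y, 0 < deriv g y) (y : ℝ) :
    HasDerivAt (fun t => deriv g t ^ (-1 / 2 : ℝ))
      (-1 / 2 * deriv g y ^ (-3 / 2 : ℝ) * iteratedDeriv 2 g y) y := by
  have h2 : HasDerivAt (deriv g) (iteratedDeriv 2 g y) y := by
    rw [iteratedDeriv_succ, iteratedDeriv_one]
    have : ContDiff ℝ 2 (deriv g) := hg.deriv' (n := 2)
    exact (this.differentiable (by norm_num) y).hasDerivAt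
  have := h2.rpow_const (p := (-1 / 2 : ℝ)) (Or.inl (hp y).ne')
  convert this using 1
  norm_num; ring

/-- The second derivative of `(g')^(-1/2)` is `-(1/2) (g')^(-1/2)` times the Schwarzian derivative
of `g`. -/
theorem strictConvexOn_rpow_neg_half_deriv (hg : ContDiff ℝ 3 g) (hp : ∀ y, 0 < deriv g y)
    (hs : ∀ y, schwarzian g y < 0) :
    StrictConvexOn ℝ Set.univ (fun t => deriv g t ^ (-1 / 2 : ℝ)) := by
  have hd : deriv (fun t => deriv g t ^ (-1 / 2 : ℝ)) =
      fun y => -1 / 2 * deriv g y ^ (-3 / 2 : ℝ) * iteratedDeriv 2 g y :=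
    funext fun y => (hasDerivAt_rpow_neg_half_deriv hg hp y).deriv
  refine strictConvexOn_of_deriv2_pos convex_univ
    (fun y _ => (hasDerivAt_rpow_neg_half_deriv hg hp y).continuousAt.continuousWithinAt)
    fun y _ => ?_
  have h1 : HasDerivAt (deriv g) (iteratedDeriv 2 g y) y := by
    rw [iteratedDeriv_succ, iteratedDeriv_one]
    have : ContDiff ℝ 2 (deriv g) := hg.deriv' (n := 2)
    exact (this.differentiable (by norm_num) y).hasDerivAt
  have h2 : HasDerivAt (iteratedDeriv 2 g) (iteratedDeriv 3 g y) y := by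
    rw [iteratedDeriv_succ (n := 2)]
    exact ((hg.differentiable_iteratedDeriv 2 (by norm_num)) y).hasDerivAt
  have h3 := ((h1.rpow_const (p := (-3 / 2 : ℝ)) (Or.inl (hp y).ne')).const_mul (-1 / 2 : ℝ)).mul h2
  simp only [Function.iterate_succ, Function.iterate_zero, Function.comp_apply, id]
  rw [hd]
  have h4 := h3.deriv
  have : deriv (fun y => -1 / 2 * deriv g y ^ (-3 / 2 : ℝ) * iteratedDeriv 2 g y) y = _ := h4
  rw [this]
  have hd1 := hp y
  have e1 : deriv g y ^ (-3 / 2 - 1 : ℝ) = deriv g y ^ (-3 / 2 : ℝ) / deriv g y :=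
    Real.rpow_sub_one hd1.ne' _
  rw [e1]
  have hr : 0 < deriv g y ^ (-3 / 2 : ℝ) := Real.rpow_pos_of_pos hd1 _
  have hS := hs y
  unfold schwarzian at hS
  have key : -1 / 2 * (iteratedDeriv 2 g y * (-3 / 2) * (deriv g y ^ (-3 / 2 : ℝ) / deriv g y)) *
      iteratedDeriv 2 g y + -1 / 2 * deriv g y ^ (-3 / 2 : ℝ) * iteratedDeriv 3 g y =
      (-(1 / 2) * deriv g y ^ (-3 / 2 : ℝ) * deriv g y) *
        (iteratedDeriv 3 g y / deriv g y - 3 / 2 * (iteratedDeriv 2 g y / deriv g y) ^ 2) := by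
    field_simp; ring
  rw [key]
  exact mul_pos_of_neg_of_neg (by nlinarith [mul_pos hr hd1]) hS

theorem deriv_eq_inv_sq_rpow (hp : ∀ y, 0 < deriv g y) (y : ℝ) :
    deriv g y = ((deriv g y ^ (-1 / 2 : ℝ)) ^ 2)⁻¹ := by
  rw [← Real.rpow_natCast, ← Real.rpow_mul (hp y).le]
  norm_num [Real.rpow_neg_one]

theorem hasDerivAt_affine_quotient {x p q t : ℝ} (hp : 0 < p) (ht : 0 < p + q * (t - x)) :
    HasDerivAt (fun t => (t - x) / (p * (p + q * (t - x)))) (((p + q * (t - x)) ^ 2)⁻¹) t := by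
  have h1 : HasDerivAt (fun t => t - x) 1 t := (hasDerivAt_id t).sub_const x
  have h2 : HasDerivAt (fun t => p * (p + q * (t - x))) (p * (q * 1)) t :=
    ((h1.const_mul q).const_add p).const_mul p
  refine (h1.div h2 (by positivity)).congr_deriv ?_
  have := ht.ne'
  field_simp
  ring

/-- With `w = (g')^(-1/2)` one has `g' = w⁻²`. The quotient is the increment over `[x, y]` of the
Möbius map whose `w` is the affine function `p + q (t - x)`, so an affine majorant of `w` bounds the
increment of `g` from below. The next lemma treats an affine minorant. -/
theorem lt_sub_of_rpow_lt (hg : ContDiff ℝ 3 g) (hp : ∀ y, 0 < deriv g y) {x y p q : ℝ}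
    (hxy : x < y) (hp0 : 0 < p) (hpos : ∀ t ∈ Set.Icc x y, 0 < p + q * (t - x))
    (hw : ∀ t ∈ Set.Ioo x y, deriv g t ^ (-1 / 2 : ℝ) < p + q * (t - x)) :
    (y - x) / (p * (p + q * (y - x))) < g y - g x := by
  have hd : Differentiable ℝ g := hg.differentiable (by norm_num)
  have hm : StrictMonoOn (fun t => g t - (t - x) / (p * (p + q * (t - x)))) (Set.Icc x y) := by
    refine strictMonoOn_of_deriv_pos (convex_Icc x y) (fun t ht =>
      ((hd t).continuousAt.sub (hasDerivAt_affine_quotient hp0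
        (hpos t ht)).continuousAt).continuousWithinAt) fun t ht => ?_
    rw [interior_Icc] at ht
    have h1 := hpos t ⟨ht.1.le, ht.2.le⟩
    have h2 := ((hd t).hasDerivAt.sub (hasDerivAt_affine_quotient hp0 h1)).deriv
    have h3 : deriv (fun t => g t - (t - x) / (p * (p + q * (t - x)))) t = _ := h2
    rw [h3, deriv_eq_inv_sq_rpow hp t, sub_pos]
    have h4 : 0 < deriv g t ^ (-1 / 2 : ℝ) := Real.rpow_pos_of_pos (hp t) _
    have := hw t ht
    gcongr
  have := hm (Set.left_mem_Icc.2 hxy.le) (Set.right_mem_Icc.2 hxy.le) hxy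
  simp only [sub_self, zero_div, sub_zero] at this
  linarith

theorem sub_lt_of_lt_rpow (hg : ContDiff ℝ 3 g) (hp : ∀ y, 0 < deriv g y) {x y p q : ℝ}
    (hxy : x < y) (hp0 : 0 < p) (hpos : ∀ t ∈ Set.Icc x y, 0 < p + q * (t - x))
    (hw : ∀ t ∈ Set.Ioo x y, p + q * (t - x) < deriv g t ^ (-1 / 2 : ℝ)) :
    g y - g x < (y - x) / (p * (p + q * (y - x))) := by
  have hd : Differentiable ℝ g := hg.differentiable (by norm_num)
  have hm : StrictAntiOn (fun t => g t - (t - x) / (p * (p + q * (t - x)))) (Set.Icc x y) := by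
    refine strictAntiOn_of_deriv_neg (convex_Icc x y) (fun t ht =>
      ((hd t).continuousAt.sub (hasDerivAt_affine_quotient hp0
        (hpos t ht)).continuousAt).continuousWithinAt) fun t ht => ?_
    rw [interior_Icc] at ht
    have h1 := hpos t ⟨ht.1.le, ht.2.le⟩
    have h2 := ((hd t).hasDerivAt.sub (hasDerivAt_affine_quotient hp0 h1)).deriv
    have h3 : deriv (fun t => g t - (t - x) / (p * (p + q * (t - x)))) t = _ := h2
    rw [h3, deriv_eq_inv_sq_rpow hp t, sub_neg]
    have := hw t ht
    gcongr
  have := hm (Set.left_mem_Icc.2 hxy.le) (Set.right_mem_Icc.2 hxy.le) hxy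
  simp only [sub_self, zero_div, sub_zero] at this
  linarith

/-- A map with negative Schwarzian derivative contracts the cross-ratio with two double points. -/
theorem deriv_mul_deriv_lt (hg : ContDiff ℝ 3 g) (hp : ∀ y, 0 < deriv g y)
    (hs : ∀ y, schwarzian g y < 0) {x y : ℝ} (hxy : x < y) :
    deriv g x * deriv g y < ((g y - g x) / (y - x)) ^ 2 := by
  set w : ℝ → ℝ := fun t => deriv g t ^ (-1 / 2 : ℝ) with hw
  have hwp : ∀ t, 0 < w t := fun t => Real.rpow_pos_of_pos (hp t) _
  have hc := strictConvexOn_rpow_neg_half_deriv hg hp hs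
  have hyx : 0 < y - x := sub_pos.2 hxy
  have hL : ∀ t, w x + (w y - w x) / (y - x) * (t - x) =
      (y - t) / (y - x) * w x + (t - x) / (y - x) * w y := fun t => by field_simp; ring
  -- By strict convexity the chord of `w` over `[x, y]` is an affine majorant; its end values give
  -- the factor `w x * w y`.
  have h1 := lt_sub_of_rpow_lt hg hp (p := w x) (q := (w y - w x) / (y - x)) hxy (hwp x)
    (fun t ht => by
      rw [hL]
      rcases ht.1.eq_or_lt with rfl | h
      · simp [hyx.ne', hwp]
      · have h1 : 0 < (t - x) / (y - x) * w y := mul_pos (div_pos (by linarith) hyx) (hwp y)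
        have h2 : 0 ≤ (y - t) / (y - x) * w x :=
          mul_nonneg (div_nonneg (by linarith [ht.2]) hyx.le) (hwp x).le
        linarith)
    (fun t ht => by
      rw [hL]
      have h := hc.2 (Set.mem_univ x) (Set.mem_univ y) hxy.ne
        (div_pos (sub_pos.2 ht.2) hyx) (div_pos (sub_pos.2 ht.1) hyx) (by field_simp; ring)
      simp only [smul_eq_mul] at h
      have ht' : (y - t) / (y - x) * x + (t - x) / (y - x) * y = t := by
        field_simp; ring
      rwa [ht'] at h)
  have e : w x + (w y - w x) / (y - x) * (y - x) = w y := by field_simp; ring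
  rw [e] at h1
  rw [deriv_eq_inv_sq_rpow hp x, deriv_eq_inv_sq_rpow hp y, ← mul_inv, ← mul_pow, ← inv_pow]
  have h3 := mul_pos (hwp x) (hwp y)
  have h4 : (w x * w y)⁻¹ < (g y - g x) / (y - x) := by
    rw [lt_div_iff₀ hyx, inv_mul_eq_div]; exact h1
  exact pow_lt_pow_left₀ h4 (inv_pos.2 h3).le two_ne_zero

/-- By `deriv_mul_deriv_lt` the function `g'(a) / (g t - g a) - 1 / (t - a)` is strictly increasing
for `t > a`. Comparing its values at `b` and `c` and clearing denominators gives the claim. -/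
theorem deriv_left_lt (hg : ContDiff ℝ 3 g) (hp : ∀ y, 0 < deriv g y)
    (hs : ∀ y, schwarzian g y < 0) {a b c : ℝ} (hab : a < b) (hbc : b < c) :
    deriv g a * ((g c - g b) / (c - b)) < (g b - g a) / (b - a) * ((g c - g a) / (c - a)) := by
  have hd : Differentiable ℝ g := hg.differentiable (by norm_num)
  have hm := strictMono_of_deriv_pos hp
  have hR : ∀ t ∈ Set.Ioi a, HasDerivAt (fun t => deriv g a / (g t - g a) - 1 / (t - a))
      (1 / (t - a) ^ 2 - deriv g a * deriv g t / (g t - g a) ^ 2) t := fun t ht => by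
    have h1 : g t - g a ≠ 0 := (sub_pos.2 (hm ht)).ne'
    have h2 : t - a ≠ 0 := (sub_pos.2 ht).ne'
    refine (((hasDerivAt_const t (deriv g a)).div ((hd t).hasDerivAt.sub_const (g a)) h1).sub
      ((hasDerivAt_const t (1 : ℝ)).div ((hasDerivAt_id t).sub_const a) h2)).congr_deriv ?_
    simp; ring
  have hmono : StrictMonoOn (fun t => deriv g a / (g t - g a) - 1 / (t - a)) (Set.Ioi a) := by
    refine strictMonoOn_of_deriv_pos (convex_Ioi a)
      (fun t ht => (hR t ht).continuousAt.continuousWithinAt) fun t ht => ?_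
    rw [interior_Ioi] at ht
    rw [(hR t ht).deriv, sub_pos]
    have h1 : 0 < g t - g a := sub_pos.2 (hm ht)
    have h2 : 0 < t - a := sub_pos.2 ht
    have := deriv_mul_deriv_lt hg hp hs ht
    rw [div_pow, lt_div_iff₀ (by positivity)] at this
    rw [div_lt_div_iff₀ (by positivity) (by positivity)]
    linarith
  have h := hmono hab (hab.trans hbc) hbc
  have g1 : 0 < g b - g a := sub_pos.2 (hm hab)
  have g2 : 0 < g c - g a := sub_pos.2 (hm (hab.trans hbc))
  have g3 : 0 < g c - g b := sub_pos.2 (hm hbc)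
  have d1 : 0 < b - a := sub_pos.2 hab
  have d2 : 0 < c - a := by linarith
  have d3 : 0 < c - b := sub_pos.2 hbc
  dsimp only at h
  have h' : deriv g a * ((g c - g b) / ((g b - g a) * (g c - g a))) <
      (c - b) / ((b - a) * (c - a)) := by
    have e1 : (g c - g b) / ((g b - g a) * (g c - g a)) = 1 / (g b - g a) - 1 / (g c - g a) := by
      field_simp; ring
    have e2 : (c - b) / ((b - a) * (c - a)) = 1 / (b - a) - 1 / (c - a) := by
      field_simp; ring
    rw [e1, e2, mul_sub, mul_one_div, mul_one_div]; linarith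
  have hK : 0 < (g b - g a) * (g c - g a) / (c - b) := by positivity
  have := mul_lt_mul_of_pos_right h' hK
  have e1 : deriv g a * ((g c - g b) / ((g b - g a) * (g c - g a))) *
      ((g b - g a) * (g c - g a) / (c - b)) = deriv g a * ((g c - g b) / (c - b)) := by
    have := g1.ne'; have := g2.ne'; field_simp
  have e2 : (c - b) / ((b - a) * (c - a)) * ((g b - g a) * (g c - g a) / (c - b)) =
      (g b - g a) / (b - a) * ((g c - g a) / (c - a)) := by
    have := d1.ne'; have := d2.ne'; have := d3.ne'; field_simp
  rwa [e1, e2] at this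

/-- The mirror image of `deriv_left_lt`, with the moving point to the left of `c`. -/
theorem deriv_right_lt (hg : ContDiff ℝ 3 g) (hp : ∀ y, 0 < deriv g y)
    (hs : ∀ y, schwarzian g y < 0) {a b c : ℝ} (hab : a < b) (hbc : b < c) :
    deriv g c * ((g b - g a) / (b - a)) < (g c - g b) / (c - b) * ((g c - g a) / (c - a)) := by
  have hd : Differentiable ℝ g := hg.differentiable (by norm_num)
  have hm := strictMono_of_deriv_pos hp
  have hR : ∀ t ∈ Set.Iio c, HasDerivAt (fun t => 1 / (c - t) - deriv g c / (g c - g t))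
      (1 / (c - t) ^ 2 - deriv g t * deriv g c / (g c - g t) ^ 2) t := fun t ht => by
    have h1 : g c - g t ≠ 0 := (sub_pos.2 (hm ht)).ne'
    have h2 : c - t ≠ 0 := (sub_pos.2 ht).ne'
    refine (((hasDerivAt_const t (1 : ℝ)).div ((hasDerivAt_id t).const_sub c) h2).sub
      ((hasDerivAt_const t (deriv g c)).div ((hd t).hasDerivAt.const_sub (g c)) h1)).congr_deriv ?_
    simp; ring
  have hmono : StrictMonoOn (fun t => 1 / (c - t) - deriv g c / (g c - g t)) (Set.Iio c) := by
    refine strictMonoOn_of_deriv_pos (convex_Iio c)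
      (fun t ht => (hR t ht).continuousAt.continuousWithinAt) fun t ht => ?_
    rw [interior_Iio] at ht
    rw [(hR t ht).deriv, sub_pos]
    have h1 : 0 < g c - g t := sub_pos.2 (hm ht)
    have h2 : 0 < c - t := sub_pos.2 ht
    have := deriv_mul_deriv_lt hg hp hs ht
    rw [div_pow, lt_div_iff₀ (by positivity)] at this
    rw [div_lt_div_iff₀ (by positivity) (by positivity)]
    linarith
  have h := hmono (hab.trans hbc) hbc hab
  have g1 : 0 < g b - g a := sub_pos.2 (hm hab)
  have g2 : 0 < g c - g a := sub_pos.2 (hm (hab.trans hbc))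
  have g3 : 0 < g c - g b := sub_pos.2 (hm hbc)
  have d1 : 0 < b - a := sub_pos.2 hab
  have d2 : 0 < c - a := by linarith
  have d3 : 0 < c - b := sub_pos.2 hbc
  dsimp only at h
  have h' : deriv g c * ((g b - g a) / ((g c - g b) * (g c - g a))) <
      (b - a) / ((c - b) * (c - a)) := by
    have e1 : (g b - g a) / ((g c - g b) * (g c - g a)) = 1 / (g c - g b) - 1 / (g c - g a) := by
      field_simp; ring
    have e2 : (b - a) / ((c - b) * (c - a)) = 1 / (c - b) - 1 / (c - a) := by
      field_simp; ring
    rw [e1, e2, mul_sub, mul_one_div, mul_one_div]; linarith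
  have hK : 0 < (g c - g b) * (g c - g a) / (b - a) := by positivity
  have := mul_lt_mul_of_pos_right h' hK
  have e1 : deriv g c * ((g b - g a) / ((g c - g b) * (g c - g a))) *
      ((g c - g b) * (g c - g a) / (b - a)) = deriv g c * ((g b - g a) / (b - a)) := by
    have := g3.ne'; have := g2.ne'; field_simp
  have e2 : (b - a) / ((c - b) * (c - a)) * ((g c - g b) * (g c - g a) / (b - a)) =
      (g c - g b) / (c - b) * ((g c - g a) / (c - a)) := by
    have := d1.ne'; have := d2.ne'; have := d3.ne'; field_simp
  rwa [e1, e2] at this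

/-- The tangent of the convex function `w = (g')^(-1/2)` at `b` is an affine minorant on both sides,
so it bounds both increments of `g` from above. -/
theorem lt_deriv_middle (hg : ContDiff ℝ 3 g) (hp : ∀ y, 0 < deriv g y)
    (hs : ∀ y, schwarzian g y < 0) {a b c : ℝ} (hab : a < b) (hbc : b < c) :
    (g b - g a) / (b - a) * ((g c - g b) / (c - b)) < deriv g b * ((g c - g a) / (c - a)) := by
  set w : ℝ → ℝ := fun t => deriv g t ^ (-1 / 2 : ℝ) with hw
  have hwp : ∀ t, 0 < w t := fun t => Real.rpow_pos_of_pos (hp t) _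
  have hc := strictConvexOn_rpow_neg_half_deriv hg hp hs
  have hm := strictMono_of_deriv_pos hp
  have hdiff : ∀ t, DifferentiableAt ℝ w t := fun t =>
    (hasDerivAt_rpow_neg_half_deriv hg hp t).differentiableAt
  obtain ⟨k, hk⟩ : ∃ k, k = deriv w b := ⟨_, rfl⟩
  have htan : ∀ t, t ≠ b → w b + k * (t - b) < w t := by
    intro t ht
    rcases lt_or_gt_of_ne ht with h | h
    · have := hc.slope_lt_deriv (Set.mem_univ t) (Set.mem_univ b) h (hdiff b)
      rw [← hw, ← hk, slope_def_field, div_lt_iff₀ (sub_pos.2 h)] at this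
      linarith
    · have := hc.deriv_lt_slope (Set.mem_univ b) (Set.mem_univ t) h (hdiff b)
      rw [← hw, ← hk, slope_def_field, lt_div_iff₀ (sub_pos.2 h)] at this
      linarith
  have g1 : 0 < g b - g a := sub_pos.2 (hm hab)
  have g2 : 0 < g c - g a := sub_pos.2 (hm (hab.trans hbc))
  have g3 : 0 < g c - g b := sub_pos.2 (hm hbc)
  have d1 : 0 < b - a := sub_pos.2 hab
  have d2 : 0 < c - a := by linarith
  have d3 : 0 < c - b := sub_pos.2 hbc
  have hC : w b * (w b + k * (c - b)) < (c - b) / (g c - g b) := by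
    -- The Möbius comparison needs a positive tangent up to `c`; if it has become non-positive
    -- there, the bound is trivial.
    by_cases hT : 0 < w b + k * (c - b)
    · have := sub_lt_of_lt_rpow hg hp (p := w b) (q := k) hbc (hwp b)
        (fun t ht => by
          rcases le_total 0 k with h | h
          · nlinarith [hwp b, ht.1]
          · nlinarith [ht.2])
        (fun t ht => htan t ht.1.ne')
      rw [lt_div_iff₀ (mul_pos (hwp b) hT)] at this
      rw [lt_div_iff₀ g3]; linarith
    · push Not at hT
      exact lt_of_le_of_lt (mul_nonpos_of_nonneg_of_nonpos (hwp b).le hT) (by positivity)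
  have hA : w b * (w b + k * (a - b)) < (b - a) / (g b - g a) := by
    by_cases hT : 0 < w b + k * (a - b)
    · have e : ∀ t, w b + k * (a - b) + k * (t - a) = w b + k * (t - b) := fun t => by ring
      have := sub_lt_of_lt_rpow hg hp (p := w b + k * (a - b)) (q := k) hab hT
        (fun t ht => by
          rw [e]
          rcases le_total 0 k with h | h
          · nlinarith [ht.1]
          · nlinarith [hwp b, ht.2])
        (fun t ht => by rw [e]; exact htan t ht.2.ne)
      rw [e, sub_self, mul_zero, add_zero, lt_div_iff₀ (mul_pos hT (hwp b))] at this
      rw [lt_div_iff₀ g1]; linarith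
    · push Not at hT
      exact lt_of_le_of_lt (mul_nonpos_of_nonneg_of_nonpos (hwp b).le hT) (by positivity)
  -- The weights `b - a` and `c - b` make the unknown slope `k` cancel.
  have hsum : w b ^ 2 * (c - a) < (b - a) * (c - b) * (g c - g a) / ((g c - g b) * (g b - g a)) := by
    have h1 := mul_lt_mul_of_pos_left hC d1
    have h2 := mul_lt_mul_of_pos_left hA d3
    have e1 : (b - a) * (w b * (w b + k * (c - b))) + (c - b) * (w b * (w b + k * (a - b))) =
      w b ^ 2 * (c - a) := by ring
    have e2 : (b - a) * ((c - b) / (g c - g b)) + (c - b) * ((b - a) / (g b - g a)) =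
      (b - a) * (c - b) * (g c - g a) / ((g c - g b) * (g b - g a)) := by
      field_simp; ring
    linarith
  rw [deriv_eq_inv_sq_rpow hp b]
  change _ < (w b ^ 2)⁻¹ * _
  have hw2 : 0 < w b ^ 2 := pow_pos (hwp b) 2
  rw [lt_div_iff₀ (by positivity)] at hsum
  rw [div_mul_div_comm, inv_mul_eq_div, div_div, div_lt_div_iff₀ (by positivity) (by positivity)]
  linarith

end Schwarzian

/-! ### Derivatives of the fibre maps -/

section System

variable {a : ℝ} {F : UnitAddCircle → ℝ → ℝ} {iL iU jL jU : ℝ}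

theorem IsBakerDrivenSystem.jL_lt_jU (hF : IsBakerDrivenSystem a F iL iU jL jU) : jL < jU :=
  hF.jL_lt_iL.trans (hF.iL_lt_iU.trans hF.iU_lt_jU)

theorem IsBakerDrivenSystem.subset (hF : IsBakerDrivenSystem a F iL iU jL jU) :
    Set.Icc iL iU ⊆ Set.Icc jL jU :=
  Set.Icc_subset_Icc hF.jL_lt_iL.le hF.iU_lt_jU.le

theorem IsBakerDrivenSystem.differentiable (hF : IsBakerDrivenSystem a F iL iU jL jU)
    (x : UnitAddCircle) : Differentiable ℝ (F x) :=
  (hF.contDiff_fibre x).differentiable (by norm_num)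

theorem IsBakerDrivenSystem.strictMono (hF : IsBakerDrivenSystem a F iL iU jL jU)
    (x : UnitAddCircle) : StrictMono (F x) :=
  strictMono_of_deriv_pos (hF.deriv_pos x)

theorem IsBakerDrivenSystem.mapsTo_J (hF : IsBakerDrivenSystem a F iL iU jL jU)
    (x : UnitAddCircle) {y : ℝ} (hy : y ∈ Set.Icc jL jU) : F x y ∈ Set.Icc jL jU :=
  hF.subset (Set.Ioo_subset_Icc_self (hF.mapsTo x hy))

theorem IsBakerDrivenSystem.uniqueDiffOn (hF : IsBakerDrivenSystem a F iL iU jL jU) :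
    UniqueDiffOn ℝ ((Set.univ : Set ℝ) ×ˢ Set.Icc jL jU) :=
  uniqueDiffOn_univ.prod (uniqueDiffOn_Icc hF.jL_lt_jU)

/-- The total derivative of `(x, y) ↦ f_x(y)` on the strip `ℝ × J`. -/
theorem IsBakerDrivenSystem.hasFDerivWithinAt (hF : IsBakerDrivenSystem a F iL iU jL jU)
    (x : ℝ) {y : ℝ} (hy : y ∈ Set.Icc jL jU) :
    HasFDerivWithinAt (fun p : ℝ × ℝ => F (p.1 : UnitAddCircle) p.2)
      (fderivWithin ℝ (fun p : ℝ × ℝ => F (p.1 : UnitAddCircle) p.2)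
        (Set.univ ×ˢ Set.Icc jL jU) (x, y)) (Set.univ ×ˢ Set.Icc jL jU) (x, y) :=
  (hF.contDiffOn.differentiableOn (by norm_num) (x, y)
    ⟨Set.mem_univ _, hy⟩).hasFDerivWithinAt

theorem IsBakerDrivenSystem.hasDerivAt_base (hF : IsBakerDrivenSystem a F iL iU jL jU)
    (x : ℝ) {y : ℝ} (hy : y ∈ Set.Icc jL jU) :
    HasDerivAt (fun u : ℝ => F (u : UnitAddCircle) y)
      (fderivWithin ℝ (fun p : ℝ × ℝ => F (p.1 : UnitAddCircle) p.2)
        (Set.univ ×ˢ Set.Icc jL jU) (x, y) (1, 0)) x := by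
  have h := (hF.hasFDerivWithinAt x hy).comp_hasDerivAt x
    (f := fun u : ℝ => (u, y)) ((hasDerivAt_id x).prodMk (hasDerivAt_const x y))
    (Eventually.of_forall fun u => ⟨Set.mem_univ _, hy⟩)
  exact h

theorem IsBakerDrivenSystem.deriv_fibre_eq (hF : IsBakerDrivenSystem a F iL iU jL jU)
    (x : ℝ) {y : ℝ} (hy : y ∈ Set.Icc jL jU) :
    deriv (F (x : UnitAddCircle)) y = fderivWithin ℝ (fun p : ℝ × ℝ => F (p.1 : UnitAddCircle) p.2)
        (Set.univ ×ˢ Set.Icc jL jU) (x, y) (0, 1) := by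
  have h := (hF.hasFDerivWithinAt x hy).comp_hasDerivWithinAt y (s := Set.Icc jL jU)
    (f := fun v : ℝ => (x, v)) ((hasDerivWithinAt_const y _ x).prodMk (hasDerivWithinAt_id y _))
    (fun u hu => ⟨Set.mem_univ _, hu⟩)
  have h2 := (hF.differentiable (x : UnitAddCircle) y).hasDerivAt.hasDerivWithinAt
    (s := Set.Icc jL jU)
  exact (uniqueDiffOn_Icc hF.jL_lt_jU y hy).eq_deriv _ h2 h

/-- The chain rule along a curve in the strip `ℝ × J`. -/
theorem IsBakerDrivenSystem.hasDerivWithinAt_comp (hF : IsBakerDrivenSystem a F iL iU jL jU)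
    {D : Set ℝ} {l : ℝ → ℝ} {l' u : ℝ} (hl : Set.MapsTo l D (Set.Icc jL jU)) (hu : u ∈ D)
    (hd : HasDerivWithinAt l l' D u) :
    HasDerivWithinAt (fun v : ℝ => F (v : UnitAddCircle) (l v))
      (deriv (fun v : ℝ => F (v : UnitAddCircle) (l u)) u +
        deriv (F (u : UnitAddCircle)) (l u) * l') D u := by
  have h := (hF.hasFDerivWithinAt u (hl hu)).comp_hasDerivWithinAt u (s := D)
    (f := fun v : ℝ => (v, l v)) ((hasDerivWithinAt_id u _).prodMk hd)
    (fun v hv => ⟨Set.mem_univ _, hl hv⟩)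
  refine h.congr_deriv ?_
  rw [(hF.hasDerivAt_base u (hl hu)).deriv, hF.deriv_fibre_eq u (hl hu)]
  have : ((1, l') : ℝ × ℝ) = (1, 0) + l' • (0, 1) := by simp
  rw [this, map_add, map_smul, smul_eq_mul, mul_comm l']

theorem IsBakerDrivenSystem.contDiffOn_fderivWithin (hF : IsBakerDrivenSystem a F iL iU jL jU) :
    ContDiffOn ℝ 1 (fderivWithin ℝ (fun p : ℝ × ℝ => F (p.1 : UnitAddCircle) p.2)
        (Set.univ ×ˢ Set.Icc jL jU)) (Set.univ ×ˢ Set.Icc jL jU) :=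
  hF.contDiffOn.fderivWithin hF.uniqueDiffOn (by norm_num)

theorem IsBakerDrivenSystem.contDiffOn_deriv_fibre (hF : IsBakerDrivenSystem a F iL iU jL jU) :
    ContDiffOn ℝ 1 (fun p : ℝ × ℝ => deriv (F (p.1 : UnitAddCircle)) p.2)
      (Set.univ ×ˢ Set.Icc jL jU) :=
  (hF.contDiffOn_fderivWithin.clm_apply contDiffOn_const).congr
    fun p hp => hF.deriv_fibre_eq p.1 hp.2

theorem IsBakerDrivenSystem.contDiffOn_deriv_base (hF : IsBakerDrivenSystem a F iL iU jL jU) :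
    ContDiffOn ℝ 1 (fun p : ℝ × ℝ => deriv (fun u : ℝ => F (u : UnitAddCircle) p.2) p.1)
      (Set.univ ×ˢ Set.Icc jL jU) :=
  (hF.contDiffOn_fderivWithin.clm_apply contDiffOn_const).congr
    fun p hp => (hF.hasDerivAt_base p.1 hp.2).deriv

theorem IsBakerDrivenSystem.deriv_bounds (hF : IsBakerDrivenSystem a F iL iU jL jU) :
    ∃ m L : ℝ, 0 < m ∧ 0 < L ∧ ∀ x, ∀ y ∈ Set.Icc jL jU,
      m ≤ deriv (F x) y ∧ deriv (F x) y ≤ L := by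
  have hK : IsCompact (Set.Icc (0 : ℝ) 1 ×ˢ Set.Icc jL jU) := isCompact_Icc.prod isCompact_Icc
  have hne : (Set.Icc (0 : ℝ) 1 ×ˢ Set.Icc jL jU).Nonempty :=
    ⟨(0, jL), by simp, by simp [hF.jL_lt_jU.le]⟩
  have hc := hF.contDiffOn_deriv_fibre.continuousOn.mono
    (Set.prod_mono (Set.subset_univ (Set.Icc (0 : ℝ) 1)) subset_rfl)
  obtain ⟨p, hp, hmin⟩ := hK.exists_isMinOn hne hc
  obtain ⟨q, hq, hmax⟩ := hK.exists_isMaxOn hne hc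
  refine ⟨_, _, hF.deriv_pos (p.1 : UnitAddCircle) p.2, hF.deriv_pos (q.1 : UnitAddCircle) q.2,
    fun x y hy => ?_⟩
  rw [← coe_rep x]
  have hx : (rep x, y) ∈ Set.Icc (0 : ℝ) 1 ×ˢ Set.Icc jL jU := ⟨rep_mem_Icc x, hy⟩
  exact ⟨hmin hx, hmax hx⟩

theorem IsBakerDrivenSystem.deriv_fibre_lipschitz (hF : IsBakerDrivenSystem a F iL iU jL jU) :
    ∃ K : ℝ, 0 ≤ K ∧ ∀ x, ∀ y ∈ Set.Icc jL jU, ∀ y' ∈ Set.Icc jL jU,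
      |deriv (F x) y - deriv (F x) y'| ≤ K * |y - y'| := by
  have hK : IsCompact (Set.Icc (0 : ℝ) 1 ×ˢ Set.Icc jL jU) := isCompact_Icc.prod isCompact_Icc
  obtain ⟨K, hL⟩ := (hF.contDiffOn_deriv_fibre.mono (Set.prod_mono
    (Set.subset_univ (Set.Icc (0 : ℝ) 1)) subset_rfl)).exists_lipschitzOnWith
    (by norm_num) ((convex_Icc 0 1).prod (convex_Icc jL jU)) hK
  refine ⟨K, K.2, fun x y hy y' hy' => ?_⟩
  have := hL.dist_le_mul (rep x, y) ⟨rep_mem_Icc x, hy⟩ (rep x, y') ⟨rep_mem_Icc x, hy'⟩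
  simpa [coe_rep, Prod.dist_eq, Real.dist_eq] using this

theorem IsBakerDrivenSystem.deriv_base_lipschitz (hF : IsBakerDrivenSystem a F iL iU jL jU) :
    ∃ K : ℝ, 0 ≤ K ∧ ∀ x ∈ Set.Icc (0 : ℝ) 1, ∀ y ∈ Set.Icc jL jU, ∀ y' ∈ Set.Icc jL jU,
      |deriv (fun u : ℝ => F (u : UnitAddCircle) y) x -
        deriv (fun u : ℝ => F (u : UnitAddCircle) y') x| ≤ K * |y - y'| := by
  have hK : IsCompact (Set.Icc (0 : ℝ) 1 ×ˢ Set.Icc jL jU) := isCompact_Icc.prod isCompact_Icc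
  obtain ⟨K, hL⟩ := (hF.contDiffOn_deriv_base.mono (Set.prod_mono
    (Set.subset_univ (Set.Icc (0 : ℝ) 1)) subset_rfl)).exists_lipschitzOnWith
    (by norm_num) ((convex_Icc 0 1).prod (convex_Icc jL jU)) hK
  refine ⟨K, K.2, fun x hx y hy y' hy' => ?_⟩
  have := hL.dist_le_mul (x, y) ⟨hx, hy⟩ (x, y') ⟨hx, hy'⟩
  simpa [Prod.dist_eq, Real.dist_eq] using this

theorem IsBakerDrivenSystem.deriv_base_bound (hF : IsBakerDrivenSystem a F iL iU jL jU) :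
    ∃ C : ℝ, 0 ≤ C ∧ ∀ x ∈ Set.Icc (0 : ℝ) 1, ∀ y ∈ Set.Icc jL jU,
      |deriv (fun u : ℝ => F (u : UnitAddCircle) y) x| ≤ C := by
  have hK : IsCompact (Set.Icc (0 : ℝ) 1 ×ˢ Set.Icc jL jU) := isCompact_Icc.prod isCompact_Icc
  have hc := hF.contDiffOn_deriv_base.continuousOn.mono
    (Set.prod_mono (Set.subset_univ (Set.Icc (0 : ℝ) 1)) subset_rfl)
  obtain ⟨C, hC⟩ := hK.exists_bound_of_continuousOn hc
  refine ⟨max C 0, le_max_right _ _, fun x hx y hy => ?_⟩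
  exact (hC (x, y) ⟨hx, hy⟩).trans (le_max_left _ _)

/-- The mean value theorem for the fibre maps on `J`. -/
theorem IsBakerDrivenSystem.exists_deriv_eq (hF : IsBakerDrivenSystem a F iL iU jL jU)
    (x : UnitAddCircle) {y y' : ℝ} (h : y < y') :
    ∃ z ∈ Set.Ioo y y', F x y' - F x y = deriv (F x) z * (y' - y) := by
  obtain ⟨z, hz, he⟩ := exists_deriv_eq_slope (F x) h (hF.differentiable x).continuous.continuousOn
    (hF.differentiable x).differentiableOn
  refine ⟨z, hz, ?_⟩
  rw [he]
  field_simp [(sub_pos.2 h).ne']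

theorem IsBakerDrivenSystem.abs_sub_le_of_deriv_le (hF : IsBakerDrivenSystem a F iL iU jL jU)
    (x : UnitAddCircle) {y y' c : ℝ} (h : ∀ z ∈ Set.uIcc y y', deriv (F x) z ≤ c) :
    |F x y - F x y'| ≤ c * |y - y'| := by
  have := (convex_uIcc y y').norm_image_sub_le_of_norm_deriv_le (f := F x) (C := c)
    (fun z _ => hF.differentiable x z)
    (fun z hz => by rw [Real.norm_eq_abs, abs_of_pos (hF.deriv_pos x z)]; exact h z hz)
    (Set.right_mem_uIcc) (Set.left_mem_uIcc)
  simpa using this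

theorem IsBakerDrivenSystem.le_abs_sub_of_le_deriv (hF : IsBakerDrivenSystem a F iL iU jL jU)
    (x : UnitAddCircle) {y y' c : ℝ} (h : ∀ z ∈ Set.uIcc y y', c ≤ deriv (F x) z) :
    c * |y - y'| ≤ |F x y - F x y'| := by
  wlog hyy : y < y' generalizing y y'
  · rcases (not_lt.1 hyy).eq_or_lt with rfl | h'
    · simp
    · have := this (y := y') (y' := y) (by rwa [Set.uIcc_comm]) h'
      rwa [abs_sub_comm y, abs_sub_comm (F x y)]
  obtain ⟨z, hz, he⟩ := hF.exists_deriv_eq x hyy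
  rw [abs_sub_comm (F x y), he, abs_mul, abs_of_pos (hF.deriv_pos x z), abs_sub_comm y']
  gcongr
  exact h z (Set.Ioo_subset_Icc_self.trans Set.Icc_subset_uIcc hz)

theorem IsBakerDrivenSystem.measurable_deriv (hF : IsBakerDrivenSystem a F iL iU jL jU) :
    Measurable (fun p : UnitAddCircle × ℝ => deriv (F p.1) p.2) :=
  measurable_deriv_with_param (f := F) hF.continuous

/-- Partial hyperbolicity at a point of the unit interval. -/
theorem IsBakerDrivenSystem.exists_hyperbolic (hF : IsBakerDrivenSystem a F iL iU jL jU) :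
    ∃ c : ℝ, 1 < c ∧ ∀ ξ : ℝ, ∀ x : UnitAddCircle, ∀ y ∈ Set.Icc jL jU,
      c * sigmaRate a ξ ≤ deriv (F x) y := by
  obtain ⟨c, hc, h⟩ := hF.partially_hyperbolic
  refine ⟨c, hc, fun ξ x y hy => ?_⟩
  have hs := sigmaRate_pos hF.a_pos hF.a_lt_one ξ
  have hm := branch_mem_Ico hF.a_pos hF.a_lt_one ξ (rep_mem x)
  have := h ((sigmaRate a ξ * rep x + branchOffset a ξ : ℝ) : UnitAddCircle) y hy
  rw [tau_coe_branch hF.a_pos hF.a_lt_one ξ (rep_mem_Icc x), coe_rep] at this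
  have ht : tauSlope a ((sigmaRate a ξ * rep x + branchOffset a ξ : ℝ) : UnitAddCircle) =
      (sigmaRate a ξ)⁻¹ := by
    unfold tauSlope
    rw [rep_coe hm.1 hm.2]
    simp only [branch_lt_iff hF.a_pos hF.a_lt_one ξ (rep_mem x)]
    unfold sigmaRate
    split_ifs <;> rfl
  rw [ht, inv_mul_eq_div, le_div_iff₀ hs] at this
  exact this

/-! ### Reflection of the fibres -/

/-- The fibre maps conjugated by `y ↦ -y`. -/
def reflectFibre (F : UnitAddCircle → ℝ → ℝ) : UnitAddCircle → ℝ → ℝ := fun x y => -F x (-y)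

theorem reflect_reflect (F : UnitAddCircle → ℝ → ℝ) : reflectFibre (reflectFibre F) = F := by
  funext x y; simp [reflectFibre]

theorem skew_reflect_iterate_snd (n : ℕ) (θ : UnitAddCircle × UnitAddCircle) (y : ℝ) :
    ((skew a (reflectFibre F))^[n] (θ, y)).2 = -((skew a F)^[n] (θ, -y)).2 := by
  induction n with
  | zero => simp
  | succ n ih => simp only [skew_iterate_succ_snd, ih, reflectFibre, neg_neg]

theorem mem_globalAttractor_reflect (θ : UnitAddCircle × UnitAddCircle) (y : ℝ) :
    (θ, y) ∈ globalAttractor a (reflectFibre F) ↔ (θ, -y) ∈ globalAttractor a F := by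
  have key : ∀ (F : UnitAddCircle → ℝ → ℝ) (y : ℝ), (θ, y) ∈ globalAttractor a (reflectFibre F) →
      (θ, -y) ∈ globalAttractor a F := by
    intro F y h
    simp only [globalAttractor, Set.mem_iInter] at h ⊢
    intro n
    obtain ⟨⟨θ', y'⟩, hp⟩ := h n
    refine ⟨(θ', -y'), ?_⟩
    rw [skew_iterate_eq] at hp ⊢
    rw [skew_reflect_iterate_snd] at hp
    rw [Prod.mk.injEq] at hp ⊢
    exact ⟨hp.1, by rw [← hp.2, neg_neg]⟩
  refine ⟨key F y, fun h => ?_⟩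
  rw [← reflect_reflect F] at h
  simpa using key (reflectFibre F) (-y) h

/-- Reflection exchanges the two bounding graphs and preserves all standing hypotheses
(`IsBakerDrivenSystem.reflect`), so most results are proved for `φ⁺` only and then transferred. -/
theorem phiPlus_reflect (θ : UnitAddCircle × UnitAddCircle) :
    phiPlus a (reflectFibre F) θ = -phiMinus a F θ := by
  unfold phiPlus phiMinus
  have : {y | (θ, y) ∈ globalAttractor a (reflectFibre F)} = -{y | (θ, y) ∈ globalAttractor a F} := by
    ext y; simp [mem_globalAttractor_reflect]
  rw [this, Real.sInf_def, neg_neg]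

theorem phiMinus_reflect (θ : UnitAddCircle × UnitAddCircle) :
    phiMinus a (reflectFibre F) θ = -phiPlus a F θ := by
  have := phiPlus_reflect (a := a) (F := reflectFibre F) θ
  rw [reflect_reflect] at this
  rw [this, neg_neg]

theorem deriv_reflect (x : UnitAddCircle) (y : ℝ) :
    deriv (reflectFibre F x) y = deriv (F x) (-y) := by
  have : reflectFibre F x = fun y => -(fun z => F x (-z)) y := rfl
  rw [this, deriv.fun_neg, deriv_comp_neg, neg_neg]

theorem IsBakerDrivenSystem.reflect (hF : IsBakerDrivenSystem a F iL iU jL jU) :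
    IsBakerDrivenSystem a (reflectFibre F) (-iU) (-iL) (-jU) (-jL) where
  a_pos := hF.a_pos
  a_lt_one := hF.a_lt_one
  continuous := (hF.continuous.comp (by fun_prop :
    Continuous fun p : UnitAddCircle × ℝ => (p.1, -p.2))).neg
  bounded := by
    obtain ⟨M, hM⟩ := hF.bounded
    exact ⟨M, fun x y => by simpa [reflectFibre] using hM x (-y)⟩
  contDiff_fibre x := ((hF.contDiff_fibre x).comp contDiff_neg).neg
  deriv_pos x y := by rw [deriv_reflect]; exact hF.deriv_pos x _
  schwarzian_neg x y := by
    have h := hF.schwarzian_neg x (-y)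
    have e : ∀ n, iteratedDeriv n (reflectFibre F x) y =
        -((-1 : ℝ) ^ n • iteratedDeriv n (F x) (-y)) := fun n => by
      have : reflectFibre F x = fun y => -(fun z => F x (-z)) y := rfl
      rw [this, iteratedDeriv_fun_neg, iteratedDeriv_comp_neg]
    unfold schwarzian at h ⊢
    rw [e 3, e 2, deriv_reflect]
    convert h using 1
    norm_num
    ring
  jL_lt_iL := neg_lt_neg hF.iU_lt_jU
  iL_lt_iU := neg_lt_neg hF.iL_lt_iU
  iU_lt_jU := neg_lt_neg hF.jL_lt_iL
  mapsTo x y hy := by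
    have := hF.mapsTo x (show -y ∈ Set.Icc jL jU from ⟨by linarith [hy.2], by linarith [hy.1]⟩)
    exact ⟨neg_lt_neg this.2, neg_lt_neg this.1⟩
  partially_hyperbolic := by
    obtain ⟨c, hc, h⟩ := hF.partially_hyperbolic
    refine ⟨c, hc, fun x y hy => ?_⟩
    rw [deriv_reflect]
    exact h x (-y) ⟨by linarith [hy.2], by linarith [hy.1]⟩
  contDiffOn := by
    have : ContDiffOn ℝ 2 (fun p : ℝ × ℝ => (p.1, -p.2)) (Set.univ ×ˢ Set.Icc (-jU) (-jL)) := by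
      fun_prop
    exact (hF.contDiffOn.comp this fun p hp =>
      ⟨Set.mem_univ _, by linarith [hp.2.2], by linarith [hp.2.1]⟩).neg
  phiMinus_mem θ := by
    rw [phiMinus_reflect]
    have := hF.phiPlus_mem θ
    exact ⟨neg_le_neg this.2, neg_le_neg this.1⟩
  phiPlus_mem θ := by
    rw [phiPlus_reflect]
    have := hF.phiMinus_mem θ
    exact ⟨neg_le_neg this.2, neg_le_neg this.1⟩

end System

/-! ### The bounding graphs of the global attractor -/

/-- The composition `f_{τ x} ∘ ⋯ ∘ f_{τⁿ x}` of the fibre maps along the past of `(ξ, x)`. -/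
noncomputable def pullback (a : ℝ) (F : UnitAddCircle → ℝ → ℝ) : ℕ → UnitAddCircle → ℝ → ℝ
  | 0, _, y => y
  | n + 1, x, y => F (tau a x) (pullback a F n (tau a x) y)

section Attractor

variable {a : ℝ} {F : UnitAddCircle → ℝ → ℝ} {iL iU jL jU : ℝ}

theorem skew_iterate_snd_eq_pullback (h0 : 0 < a) (h1 : a < 1) (n : ℕ)
    (θ : UnitAddCircle × UnitAddCircle) (y : ℝ) :
    ((skew a F)^[n] (θ, y)).2 = pullback a F n ((baker a)^[n] θ).2 y := by
  induction n with
  | zero => rfl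
  | succ n ih =>
    rw [skew_iterate_succ_snd, ih, pullback, Function.iterate_succ_apply', tau_baker_snd h0 h1]

theorem pullback_add (n m : ℕ) (x : UnitAddCircle) (y : ℝ) :
    pullback a F (n + m) x y = pullback a F n x (pullback a F m ((tau a)^[n] x) y) := by
  induction n generalizing x with
  | zero => simp [pullback]
  | succ n ih =>
    rw [Nat.succ_add, pullback, ih, pullback, Function.iterate_succ_apply]

/-- The baker map is onto and the fibre maps along any `n`-step past of `θ` are determined by `θ.2`.
Hence the fibre of the attractor is an intersection of ranges that do not see `ξ`. -/
theorem mem_globalAttractor_iff (h0 : 0 < a) (h1 : a < 1) (θ : UnitAddCircle × UnitAddCircle)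
    (y : ℝ) : (θ, y) ∈ globalAttractor a F ↔ ∀ n, y ∈ Set.range (pullback a F n θ.2) := by
  simp only [globalAttractor, Set.mem_iInter]
  refine forall_congr' fun n => ⟨?_, ?_⟩
  · rintro ⟨⟨θ', y'⟩, h⟩
    rw [skew_iterate_eq, skew_iterate_snd_eq_pullback h0 h1, Prod.mk.injEq] at h
    exact ⟨y', by rw [← h.1]; exact h.2⟩
  · rintro ⟨y', h⟩
    obtain ⟨θ', hθ⟩ := (baker_surjective h0 h1).iterate n θ
    refine ⟨(θ', y'), ?_⟩
    rw [skew_iterate_eq, skew_iterate_snd_eq_pullback h0 h1, hθ, h]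

theorem IsBakerDrivenSystem.strictMono_pullback (hF : IsBakerDrivenSystem a F iL iU jL jU) (n : ℕ)
    (x : UnitAddCircle) : StrictMono (pullback a F n x) := by
  induction n generalizing x with
  | zero => exact strictMono_id
  | succ n ih => exact (hF.strictMono _).comp (ih _)

theorem IsBakerDrivenSystem.pullback_mem_J (hF : IsBakerDrivenSystem a F iL iU jL jU) (n : ℕ)
    (x : UnitAddCircle) {y : ℝ} (hy : y ∈ Set.Icc jL jU) : pullback a F n x y ∈ Set.Icc jL jU := by
  induction n generalizing x with
  | zero => exact hy
  | succ n ih => exact hF.mapsTo_J _ (ih _)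

theorem IsBakerDrivenSystem.skew_iterate_strictMono (hF : IsBakerDrivenSystem a F iL iU jL jU)
    (n : ℕ) (θ : UnitAddCircle × UnitAddCircle) :
    StrictMono fun y => ((skew a F)^[n] (θ, y)).2 := by
  simp only [skew_iterate_snd_eq_pullback hF.a_pos hF.a_lt_one]
  exact hF.strictMono_pullback n _

theorem IsBakerDrivenSystem.continuous_pullback (hF : IsBakerDrivenSystem a F iL iU jL jU) (n : ℕ) :
    Continuous fun p : UnitAddCircle × ℝ => pullback a F n p.1 p.2 := by
  induction n with
  | zero => exact continuous_snd
  | succ n ih =>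
    have ht := continuous_tau hF.a_pos hF.a_lt_one
    have h1 : Continuous fun p : UnitAddCircle × ℝ => (tau a p.1, p.2) :=
      (ht.comp continuous_fst).prodMk continuous_snd
    exact hF.continuous.comp ((ht.comp continuous_fst).prodMk (ih.comp h1))

theorem IsBakerDrivenSystem.jU_mem (hF : IsBakerDrivenSystem a F iL iU jL jU) :
    jU ∈ Set.Icc jL jU := ⟨hF.jL_lt_jU.le, le_rfl⟩

theorem IsBakerDrivenSystem.antitone_pullback (hF : IsBakerDrivenSystem a F iL iU jL jU)
    (x : UnitAddCircle) : Antitone fun n => pullback a F n x jU := by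
  refine antitone_nat_of_succ_le fun n => ?_
  have h := pullback_add (a := a) (F := F) n 1 x jU
  rw [h]
  exact (hF.strictMono_pullback n x).monotone (hF.mapsTo_J _ hF.jU_mem).2

theorem IsBakerDrivenSystem.exists_limit_pullback (hF : IsBakerDrivenSystem a F iL iU jL jU) :
    ∃ v : UnitAddCircle → ℝ, (∀ x, Tendsto (fun n => pullback a F n x jU) atTop (𝓝 (v x))) ∧
      (∀ x n, v x ≤ pullback a F n x jU) ∧
      ∀ x, v x = F (tau a x) (v (tau a x)) := by
  have hb : ∀ x, BddBelow (Set.range fun n => pullback a F n x jU) := fun x =>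
    ⟨jL, by rintro _ ⟨n, rfl⟩; exact (hF.pullback_mem_J n x hF.jU_mem).1⟩
  have ht := fun x => tendsto_atTop_ciInf (hF.antitone_pullback x) (hb x)
  refine ⟨_, ht, fun x n => ciInf_le (hb x) n, fun x => ?_⟩
  have h1 := (tendsto_add_atTop_iff_nat 1).2 (ht x)
  have h2 := ((hF.differentiable (tau a x)).continuous.tendsto _).comp (ht (tau a x))
  exact tendsto_nhds_unique h1 h2

/-- Since `J` is mapped into itself, the pullbacks of its upper end decrease. Their limit is an
invariant graph, hence lies in the attractor, and it dominates every point of the attractor. -/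
theorem IsBakerDrivenSystem.phiPlus_spec (hF : IsBakerDrivenSystem a F iL iU jL jU)
    (θ : UnitAddCircle × UnitAddCircle) :
    Tendsto (fun n => pullback a F n θ.2 jU) atTop (𝓝 (phiPlus a F θ)) ∧
    (∀ n, phiPlus a F θ ≤ pullback a F n θ.2 jU) ∧
    ∀ θ' : UnitAddCircle × UnitAddCircle, θ'.2 = tau a θ.2 →
      phiPlus a F θ = F θ'.2 (phiPlus a F θ') := by
  obtain ⟨v, hv1, hv2, hv3⟩ := hF.exists_limit_pullback
  have h0 := hF.a_pos
  have h1 := hF.a_lt_one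
  obtain ⟨M, hM⟩ := hF.bounded
  have hbdd : ∀ θ : UnitAddCircle × UnitAddCircle,
      BddAbove {y | (θ, y) ∈ globalAttractor a F} := fun θ => by
    refine ⟨M, fun y hy => ?_⟩
    obtain ⟨y', rfl⟩ := (mem_globalAttractor_iff h0 h1 θ y).1 hy 1
    exact (abs_le.1 (hM _ _)).2
  have hvn : ∀ n x, pullback a F n x (v ((tau a)^[n] x)) = v x := by
    intro n
    induction n with
    | zero => intro x; rfl
    | succ n ih => intro x; rw [pullback, Function.iterate_succ_apply, ih, ← hv3]
  have hmem : ∀ θ : UnitAddCircle × UnitAddCircle, (θ, v θ.2) ∈ globalAttractor a F := fun θ =>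
    (mem_globalAttractor_iff h0 h1 θ _).2 fun n => ⟨_, hvn n θ.2⟩
  have hle : ∀ (θ : UnitAddCircle × UnitAddCircle) y, (θ, y) ∈ globalAttractor a F → y ≤ v θ.2 := by
    intro θ y hy
    rw [mem_globalAttractor_iff h0 h1] at hy
    refine ge_of_tendsto' (hv1 θ.2) fun n => ?_
    obtain ⟨z, rfl⟩ := hy n
    refine (hF.strictMono_pullback n θ.2).monotone ?_
    -- The `n`-th preimage of a point of the attractor is again in the attractor, hence below `φ⁺ ≤
    -- iU < jU`. The first coordinate `0` is arbitrary, as it does not matter.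
    have hz : (((0, (tau a)^[n] θ.2) : UnitAddCircle × UnitAddCircle), z) ∈
        globalAttractor a F := by
      rw [mem_globalAttractor_iff h0 h1]
      intro m
      obtain ⟨w, hw⟩ := hy (n + m)
      rw [pullback_add] at hw
      exact ⟨w, (hF.strictMono_pullback n θ.2).injective hw⟩
    exact (le_csSup (hbdd _) hz).trans ((hF.phiPlus_mem _).2.trans hF.iU_lt_jU.le)
  have heq : ∀ θ, phiPlus a F θ = v θ.2 := fun θ =>
    (IsGreatest.csSup_eq ⟨hmem θ, fun y hy => hle θ y hy⟩)
  refine ⟨by rw [heq]; exact hv1 _, fun n => by rw [heq]; exact hv2 _ _, fun θ' h => ?_⟩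
  rw [heq, heq, h]; exact hv3 _

theorem IsBakerDrivenSystem.phiPlus_congr (hF : IsBakerDrivenSystem a F iL iU jL jU)
    {θ θ' : UnitAddCircle × UnitAddCircle} (h : θ.2 = θ'.2) : phiPlus a F θ = phiPlus a F θ' :=
  tendsto_nhds_unique (hF.phiPlus_spec θ).1 (by rw [h]; exact (hF.phiPlus_spec θ').1)

theorem IsBakerDrivenSystem.phiPlus_baker (hF : IsBakerDrivenSystem a F iL iU jL jU)
    (θ : UnitAddCircle × UnitAddCircle) :
    phiPlus a F (baker a θ) = F θ.2 (phiPlus a F θ) :=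
  (hF.phiPlus_spec _).2.2 θ (tau_baker_snd hF.a_pos hF.a_lt_one θ).symm

theorem IsBakerDrivenSystem.phiPlus_upperSemicontinuous
    (hF : IsBakerDrivenSystem a F iL iU jL jU) : UpperSemicontinuous (phiPlus a F) := by
  rw [upperSemicontinuous_iff_isOpen_preimage]
  intro c
  have : phiPlus a F ⁻¹' Set.Iio c = ⋃ n, {θ | pullback a F n θ.2 jU < c} := by
    ext θ
    simp only [Set.mem_preimage, Set.mem_Iio, Set.mem_iUnion, Set.mem_ofPred_eq]
    refine ⟨fun h => ?_, fun ⟨n, hn⟩ => ((hF.phiPlus_spec θ).2.1 n).trans_lt hn⟩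
    exact ((hF.phiPlus_spec θ).1.eventually (gt_mem_nhds h)).exists
  rw [this]
  refine isOpen_iUnion fun n => isOpen_lt ?_ continuous_const
  exact (hF.continuous_pullback n).comp (continuous_snd.prodMk continuous_const)

theorem IsBakerDrivenSystem.measurable_phiPlus (hF : IsBakerDrivenSystem a F iL iU jL jU) :
    Measurable (phiPlus a F) := hF.phiPlus_upperSemicontinuous.measurable

theorem phiMinus_eq_neg (a : ℝ) (F : UnitAddCircle → ℝ → ℝ) :
    phiMinus a F = fun θ => -phiPlus a (reflectFibre F) θ := by
  funext θ; rw [phiPlus_reflect, neg_neg]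

theorem IsBakerDrivenSystem.phiMinus_baker (hF : IsBakerDrivenSystem a F iL iU jL jU)
    (θ : UnitAddCircle × UnitAddCircle) :
    phiMinus a F (baker a θ) = F θ.2 (phiMinus a F θ) := by
  rw [phiMinus_eq_neg]; simp only [hF.reflect.phiPlus_baker, reflectFibre, neg_neg]

theorem IsBakerDrivenSystem.measurable_phiMinus (hF : IsBakerDrivenSystem a F iL iU jL jU) :
    Measurable (phiMinus a F) := by
  rw [phiMinus_eq_neg]; exact hF.reflect.measurable_phiPlus.neg

theorem IsBakerDrivenSystem.phiMinus_iterate (hF : IsBakerDrivenSystem a F iL iU jL jU)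
    (θ : UnitAddCircle × UnitAddCircle) (n : ℕ) :
    ((skew a F)^[n] (θ, phiMinus a F θ)).2 = phiMinus a F ((baker a)^[n] θ) := by
  induction n with
  | zero => rfl
  | succ n ih => rw [skew_iterate_succ_snd, ih, Function.iterate_succ_apply', hF.phiMinus_baker]

/-! ### The filled-in closures -/

theorem IsBakerDrivenSystem.mem_closure_graph (hF : IsBakerDrivenSystem a F iL iU jL jU)
    {θ : UnitAddCircle × UnitAddCircle} {y : ℝ}
    (h : (θ, y) ∈ closure (Set.range fun θ => (θ, phiPlus a F θ))) :
    iL ≤ y ∧ y ≤ phiPlus a F θ := by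
  have hc : IsClosed {p : (UnitAddCircle × UnitAddCircle) × ℝ |
      iL ≤ p.2 ∧ p.2 ≤ phiPlus a F p.1} := by
    refine (isClosed_le continuous_const continuous_snd).inter ?_
    have : {p : (UnitAddCircle × UnitAddCircle) × ℝ | p.2 ≤ phiPlus a F p.1} =
        ⋂ n, {p | p.2 ≤ pullback a F n p.1.2 jU} := by
      ext p
      simp only [Set.mem_ofPred_eq, Set.mem_iInter]
      exact ⟨fun h n => h.trans ((hF.phiPlus_spec p.1).2.1 n),
        fun h => ge_of_tendsto' (hF.phiPlus_spec p.1).1 h⟩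
    change IsClosed {p : (UnitAddCircle × UnitAddCircle) × ℝ | p.2 ≤ phiPlus a F p.1}
    rw [this]
    refine isClosed_iInter fun n => isClosed_le continuous_snd ?_
    exact (hF.continuous_pullback n).comp
      ((continuous_snd.comp continuous_fst).prodMk continuous_const)
  have := closure_minimal (s := Set.range fun θ => (θ, phiPlus a F θ)) (by
    rintro _ ⟨θ, rfl⟩; exact ⟨(hF.phiPlus_mem θ).1, le_rfl⟩) hc h
  exact this

theorem graph_mem_closure (φ : UnitAddCircle × UnitAddCircle → ℝ)
    (θ : UnitAddCircle × UnitAddCircle) :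
    (θ, φ θ) ∈ closure (Set.range fun θ => (θ, φ θ)) := subset_closure ⟨θ, rfl⟩

/-- Filling in adds only points above some point of the closure, so the infimum that defines `φ⁺⁻`
is already attained in the closure of the graph. -/
theorem IsBakerDrivenSystem.filledClosure_fibre (hF : IsBakerDrivenSystem a F iL iU jL jU)
    (θ : UnitAddCircle × UnitAddCircle) :
    (θ, phiPlusMinus a F θ) ∈ closure (Set.range fun θ => (θ, phiPlus a F θ)) ∧
    (∀ y, (θ, y) ∈ closure (Set.range fun θ => (θ, phiPlus a F θ)) → phiPlusMinus a F θ ≤ y) := by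
  set C := closure (Set.range fun θ => (θ, phiPlus a F θ)) with hC
  have hcl : IsClosed {y | (θ, y) ∈ C} :=
    isClosed_closure.preimage (Continuous.prodMk_right θ)
  have hbd : BddBelow {y | (θ, y) ∈ C} := ⟨iL, fun y hy => (hF.mem_closure_graph hy).1⟩
  have hne : {y | (θ, y) ∈ C}.Nonempty := ⟨_, graph_mem_closure _ θ⟩
  have hbd' : BddBelow {y | (θ, y) ∈ filledClosure (phiPlus a F)} :=
    ⟨iL, fun y ⟨y₁, _, h, _, h2, _⟩ => (hF.mem_closure_graph h).1.trans h2⟩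
  have hsub : ∀ y, (θ, y) ∈ C → (θ, y) ∈ filledClosure (phiPlus a F) := fun y h =>
    ⟨y, y, h, h, le_rfl, le_rfl⟩
  have heq : phiPlusMinus a F θ = sInf {y | (θ, y) ∈ C} := by
    refine le_antisymm ?_ ?_
    · exact csInf_le_csInf hbd' hne fun y h => hsub y h
    · refine le_csInf (hne.mono fun y h => hsub y h) ?_
      rintro y ⟨y₁, y₂, h1, -, h3, -⟩
      exact (csInf_le hbd h1).trans h3
  rw [heq]
  exact ⟨hcl.csInf_mem hne hbd, fun y hy => csInf_le hbd hy⟩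

theorem IsBakerDrivenSystem.phiPlusMinus_le (hF : IsBakerDrivenSystem a F iL iU jL jU)
    (θ : UnitAddCircle × UnitAddCircle) : phiPlusMinus a F θ ≤ phiPlus a F θ :=
  (hF.filledClosure_fibre θ).2 _ (graph_mem_closure _ θ)

theorem IsBakerDrivenSystem.phiPlusMinus_mem (hF : IsBakerDrivenSystem a F iL iU jL jU)
    (θ : UnitAddCircle × UnitAddCircle) : phiPlusMinus a F θ ∈ Set.Icc iL iU :=
  ⟨(hF.mem_closure_graph (hF.filledClosure_fibre θ).1).1,
    (hF.phiPlusMinus_le θ).trans (hF.phiPlus_mem θ).2⟩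

theorem IsBakerDrivenSystem.mem_filledClosure (hF : IsBakerDrivenSystem a F iL iU jL jU)
    (p : (UnitAddCircle × UnitAddCircle) × ℝ) :
    p ∈ filledClosure (phiPlus a F) ↔ phiPlusMinus a F p.1 ≤ p.2 ∧ p.2 ≤ phiPlus a F p.1 := by
  refine ⟨?_, fun h => ⟨_, _, (hF.filledClosure_fibre p.1).1, graph_mem_closure _ p.1, h.1, h.2⟩⟩
  rintro ⟨y₁, y₂, h1, h2, h3, h4⟩
  exact ⟨((hF.filledClosure_fibre p.1).2 _ h1).trans h3, h4.trans (hF.mem_closure_graph h2).2⟩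

/-- The complement is the projection, along the compact interval `I`, of a closed set, hence closed.
Openness in the product space is stronger than what semicontinuity is usually quoted for and is used
in this form. -/
theorem IsBakerDrivenSystem.isOpen_lt_phiPlusMinus (hF : IsBakerDrivenSystem a F iL iU jL jU) :
    IsOpen {p : (UnitAddCircle × UnitAddCircle) × ℝ | p.2 < phiPlusMinus a F p.1} := by
  rw [← isClosed_compl_iff]
  let Z : Set (((UnitAddCircle × UnitAddCircle) × ℝ) × Set.Icc iL iU) :=
    {q | (q.1.1, (q.2 : ℝ)) ∈ closure (Set.range fun θ => (θ, phiPlus a F θ)) ∧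
      (q.2 : ℝ) ≤ q.1.2}
  have hZ : IsClosed Z := by
    have h1 : Continuous fun q : ((UnitAddCircle × UnitAddCircle) × ℝ) × Set.Icc iL iU =>
        (q.1.1, (q.2 : ℝ)) := by fun_prop
    have h2 : Continuous fun q : ((UnitAddCircle × UnitAddCircle) × ℝ) × Set.Icc iL iU =>
        (q.2 : ℝ) := by fun_prop
    have h3 : Continuous fun q : ((UnitAddCircle × UnitAddCircle) × ℝ) × Set.Icc iL iU =>
        q.1.2 := by fun_prop
    exact (isClosed_closure.preimage h1).inter (isClosed_le h2 h3)
  have := isClosedMap_fst_of_compactSpace Z hZ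
  convert this using 1
  ext p
  simp only [Set.mem_compl_iff, Set.mem_ofPred_eq, not_lt, Set.mem_image, Z]
  refine ⟨fun h => ⟨(p, ⟨_, hF.phiPlusMinus_mem p.1⟩), ⟨(hF.filledClosure_fibre p.1).1, h⟩, rfl⟩, ?_⟩
  rintro ⟨⟨q, y⟩, ⟨h1, h2⟩, rfl⟩
  exact ((hF.filledClosure_fibre q.1).2 _ h1).trans h2

theorem IsBakerDrivenSystem.phiPlusMinus_lowerSemicontinuous
    (hF : IsBakerDrivenSystem a F iL iU jL jU) : LowerSemicontinuous (phiPlusMinus a F) := by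
  rw [lowerSemicontinuous_iff_isOpen_preimage]
  intro c
  exact hF.isOpen_lt_phiPlusMinus.preimage (Continuous.prodMk_left c)

theorem IsBakerDrivenSystem.measurable_phiPlusMinus (hF : IsBakerDrivenSystem a F iL iU jL jU) :
    Measurable (phiPlusMinus a F) := hF.phiPlusMinus_lowerSemicontinuous.measurable

theorem IsBakerDrivenSystem.isClosed_filledClosure (hF : IsBakerDrivenSystem a F iL iU jL jU) :
    IsClosed (filledClosure (phiPlus a F)) := by
  have : filledClosure (phiPlus a F) = {p | p.2 < phiPlusMinus a F p.1}ᶜ ∩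
      {p | phiPlus a F p.1 < p.2}ᶜ := by
    ext p; simp [hF.mem_filledClosure]
  rw [this]
  refine hF.isOpen_lt_phiPlusMinus.isClosed_compl.inter (IsOpen.isClosed_compl ?_)
  have : {p : (UnitAddCircle × UnitAddCircle) × ℝ | phiPlus a F p.1 < p.2} =
      ⋃ n, {p | pullback a F n p.1.2 jU < p.2} := by
    ext p
    simp only [Set.mem_iUnion, Set.mem_ofPred_eq]
    refine ⟨fun h => ?_, fun ⟨n, hn⟩ => ((hF.phiPlus_spec p.1).2.1 n).trans_lt hn⟩
    exact ((hF.phiPlus_spec p.1).1.eventually (gt_mem_nhds h)).exists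
  rw [this]
  refine isOpen_iUnion fun n => isOpen_lt ?_ continuous_snd
  exact (hF.continuous_pullback n).comp
    ((continuous_snd.comp continuous_fst).prodMk continuous_const)

/-- A local section of `τ` carries points of the graph of `φ⁺` near `θ'` to points of the same graph
near `θ`, and limit points along with them. The inequality is what makes the region above `φ⁺⁻`
forward invariant. -/
theorem IsBakerDrivenSystem.phiPlusMinus_le_pull (hF : IsBakerDrivenSystem a F iL iU jL jU)
    {θ θ' : UnitAddCircle × UnitAddCircle} (h : tau a θ.2 = θ'.2) :
    phiPlusMinus a F θ ≤ F θ'.2 (phiPlusMinus a F θ') := by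
  obtain ⟨s, hs1, hs2, hs3⟩ := tau_section hF.a_pos hF.a_lt_one θ.2
  refine (hF.filledClosure_fibre θ).2 _ ?_
  let g : (UnitAddCircle × UnitAddCircle) × ℝ → (UnitAddCircle × UnitAddCircle) × ℝ :=
    fun p => ((θ.1, s p.1.2), F p.1.2 p.2)
  have hg : ContinuousAt g (θ', phiPlusMinus a F θ') := by
    have h1 : ContinuousAt (fun p : (UnitAddCircle × UnitAddCircle) × ℝ => s p.1.2)
        (θ', phiPlusMinus a F θ') := by
      have : ContinuousAt s ((θ', phiPlusMinus a F θ') :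
        (UnitAddCircle × UnitAddCircle) × ℝ).1.2 := by simpa [← h] using hs2
      exact ContinuousAt.comp (f := fun p : (UnitAddCircle × UnitAddCircle) × ℝ => p.1.2) this
        (continuous_snd.comp continuous_fst).continuousAt
    have h2 : Continuous (fun p : (UnitAddCircle × UnitAddCircle) × ℝ => F p.1.2 p.2) :=
      hF.continuous.comp ((continuous_snd.comp continuous_fst).prodMk continuous_snd)
    exact (continuousAt_const.prodMk h1).prodMk h2.continuousAt
  have hm : Set.MapsTo g (Set.range fun θ => (θ, phiPlus a F θ))
      (Set.range fun θ => (θ, phiPlus a F θ)) := by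
    rintro _ ⟨η, rfl⟩
    refine ⟨(θ.1, s η.2), Prod.ext rfl ?_⟩
    exact (hF.phiPlus_spec (θ.1, s η.2)).2.2 η (hs3 _).symm
  have := hg.continuousWithinAt.mem_closure (hF.filledClosure_fibre θ').1 hm
  have e : g (θ', phiPlusMinus a F θ') = (θ, F θ'.2 (phiPlusMinus a F θ')) := by
    simp only [g]; rw [← h, hs1]
  rwa [e] at this

theorem IsBakerDrivenSystem.phiPlusMinus_congr (hF : IsBakerDrivenSystem a F iL iU jL jU)
    {θ θ' : UnitAddCircle × UnitAddCircle} (h : θ.2 = θ'.2) :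
    phiPlusMinus a F θ = phiPlusMinus a F θ' := by
  have key : ∀ {θ θ' : UnitAddCircle × UnitAddCircle}, θ.2 = θ'.2 →
      phiPlusMinus a F θ ≤ phiPlusMinus a F θ' := by
    intro θ θ' h
    refine (hF.filledClosure_fibre θ).2 _ ?_
    have hg : Continuous (fun p : (UnitAddCircle × UnitAddCircle) × ℝ => ((θ.1, p.1.2), p.2)) := by
      fun_prop
    have := map_mem_closure hg (hF.filledClosure_fibre θ').1
      (t := Set.range fun θ => (θ, phiPlus a F θ)) (by
        rintro _ ⟨η, rfl⟩
        exact ⟨(θ.1, η.2), Prod.ext rfl (hF.phiPlus_congr rfl)⟩)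
    dsimp only at this
    rwa [← h] at this
  exact le_antisymm (key h) (key h.symm)

/-- Close to a point where `φ⁺⁻ < c` there are points where `φ⁺ < c`. -/
theorem IsBakerDrivenSystem.exists_phiPlus_lt (hF : IsBakerDrivenSystem a F iL iU jL jU)
    {θ : UnitAddCircle × UnitAddCircle} {U : Set ((UnitAddCircle × UnitAddCircle) × ℝ)}
    (hU : U ∈ 𝓝 (θ, phiPlusMinus a F θ)) : ∃ θ', (θ', phiPlus a F θ') ∈ U := by
  obtain ⟨_, h1, ⟨θ', rfl⟩⟩ := mem_closure_iff_nhds.1 (hF.filledClosure_fibre θ).1 U hU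
  exact ⟨θ', h1⟩

theorem mem_filledClosure_reflect (p : (UnitAddCircle × UnitAddCircle) × ℝ) :
    p ∈ filledClosure (phiPlus a (reflectFibre F)) ↔ (p.1, -p.2) ∈ filledClosure (phiMinus a F) := by
  have hc : Continuous (fun p : (UnitAddCircle × UnitAddCircle) × ℝ => (p.1, -p.2)) := by fun_prop
  have key : ∀ θ y, (θ, y) ∈ closure (Set.range fun θ => (θ, phiPlus a (reflectFibre F) θ)) ↔
      (θ, -y) ∈ closure (Set.range fun θ => (θ, phiMinus a F θ)) := by
    intro θ y
    constructor
    · intro h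
      have := map_mem_closure hc h (t := Set.range fun θ => (θ, phiMinus a F θ)) (by
        rintro _ ⟨η, rfl⟩; exact ⟨η, by simp [phiPlus_reflect]⟩)
      exact this
    · intro h
      have := map_mem_closure hc h (t := Set.range fun θ => (θ, phiPlus a (reflectFibre F) θ)) (by
        rintro _ ⟨η, rfl⟩; exact ⟨η, by simp [phiPlus_reflect]⟩)
      simpa using this
  constructor
  · rintro ⟨y₁, y₂, h1, h2, h3, h4⟩
    exact ⟨-y₂, -y₁, (key _ _).1 h2, (key _ _).1 h1, neg_le_neg h4, neg_le_neg h3⟩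
  · rintro ⟨y₁, y₂, h1, h2, h3, h4⟩
    dsimp only at h3 h4
    exact ⟨-y₂, -y₁, (key _ _).2 (by rwa [neg_neg]), (key _ _).2 (by rwa [neg_neg]),
      by linarith, by linarith⟩

theorem phiPlusMinus_reflect (θ : UnitAddCircle × UnitAddCircle) :
    phiPlusMinus a (reflectFibre F) θ = -phiMinusPlus a F θ := by
  unfold phiPlusMinus phiMinusPlus
  have : {y | (θ, y) ∈ filledClosure (phiPlus a (reflectFibre F))} =
      -{y | (θ, y) ∈ filledClosure (phiMinus a F)} := by
    ext y; simp [mem_filledClosure_reflect]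
  rw [this, Real.sInf_def, neg_neg]

theorem IsBakerDrivenSystem.mem_filledClosure_phiMinus (hF : IsBakerDrivenSystem a F iL iU jL jU)
    (p : (UnitAddCircle × UnitAddCircle) × ℝ) :
    p ∈ filledClosure (phiMinus a F) ↔ phiMinus a F p.1 ≤ p.2 ∧ p.2 ≤ phiMinusPlus a F p.1 := by
  have h1 := mem_filledClosure_reflect (a := a) (F := F) (p.1, -p.2)
  rw [hF.reflect.mem_filledClosure] at h1
  simp only [neg_neg, phiPlusMinus_reflect, phiPlus_reflect, neg_le_neg_iff] at h1
  rw [← h1, and_comm]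

theorem IsBakerDrivenSystem.isClosed_filledClosure_phiMinus
    (hF : IsBakerDrivenSystem a F iL iU jL jU) : IsClosed (filledClosure (phiMinus a F)) := by
  have hc : Continuous (fun p : (UnitAddCircle × UnitAddCircle) × ℝ => (p.1, -p.2)) := by fun_prop
  have := hF.reflect.isClosed_filledClosure.preimage hc
  convert this using 1
  ext p
  simp [mem_filledClosure_reflect]

theorem IsBakerDrivenSystem.phiMinus_le_phiMinusPlus (hF : IsBakerDrivenSystem a F iL iU jL jU)
    (θ : UnitAddCircle × UnitAddCircle) : phiMinus a F θ ≤ phiMinusPlus a F θ := by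
  have := hF.reflect.phiPlusMinus_le θ
  rw [phiPlusMinus_reflect, phiPlus_reflect] at this
  linarith

theorem IsBakerDrivenSystem.measurable_phiMinusPlus (hF : IsBakerDrivenSystem a F iL iU jL jU) :
    Measurable (phiMinusPlus a F) := by
  have : phiMinusPlus a F = fun θ => -phiPlusMinus a (reflectFibre F) θ := by
    funext θ; rw [phiPlusMinus_reflect, neg_neg]
  rw [this]; exact hF.reflect.measurable_phiPlusMinus.neg

theorem IsBakerDrivenSystem.phiMinus_le_phiPlus (hF : IsBakerDrivenSystem a F iL iU jL jU)
    (θ : UnitAddCircle × UnitAddCircle) : phiMinus a F θ ≤ phiPlus a F θ := by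
  have h1 := (hF.phiPlus_spec θ).1
  have h2 := (hF.reflect.phiPlus_spec θ).1
  rw [phiPlus_reflect] at h2
  have h3 : ∀ n x y, pullback a (reflectFibre F) n x y = -pullback a F n x (-y) := by
    intro n
    induction n with
    | zero => intro x y; simp [pullback]
    | succ n ih => intro x y; simp [pullback, ih, reflectFibre]
  simp only [h3, neg_neg] at h2
  refine le_of_tendsto_of_tendsto' (by simpa using h2.neg) h1 fun n => ?_
  exact (hF.strictMono_pullback n _).monotone hF.jL_lt_jU.le

theorem IsBakerDrivenSystem.phiMinusPlus_lt (hF : IsBakerDrivenSystem a F iL iU jL jU)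
    (hA : filledClosure (phiPlus a F) ∩ filledClosure (phiMinus a F) = ∅)
    (θ : UnitAddCircle × UnitAddCircle) : phiMinusPlus a F θ < phiPlusMinus a F θ := by
  by_contra! h
  have h1 := hF.phiMinus_le_phiPlus θ
  have h2 := hF.phiPlusMinus_le θ
  have h3 := hF.phiMinus_le_phiMinusPlus θ
  have : (θ, max (phiPlusMinus a F θ) (phiMinus a F θ)) ∈
      filledClosure (phiPlus a F) ∩ filledClosure (phiMinus a F) := by
    rw [Set.mem_inter_iff, hF.mem_filledClosure, hF.mem_filledClosure_phiMinus]
    exact ⟨⟨le_max_left _ _, max_le h2 h1⟩, le_max_right _ _, max_le h h3⟩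
  rw [hA] at this
  exact this

/-- The positive function `φ⁺⁻ - φ⁻⁺` is lower semicontinuous on a compact space, so it has a
positive minimum. -/
theorem IsBakerDrivenSystem.exists_gap (hF : IsBakerDrivenSystem a F iL iU jL jU)
    (hA : filledClosure (phiPlus a F) ∩ filledClosure (phiMinus a F) = ∅) :
    ∃ ε : ℝ, 0 < ε ∧ ∀ θ, phiMinus a F θ + ε ≤ phiPlus a F θ := by
  have h1 := hF.phiPlusMinus_lowerSemicontinuous.add hF.reflect.phiPlusMinus_lowerSemicontinuous
  obtain ⟨θ₀, -, hmin⟩ := (h1.lowerSemicontinuousOn Set.univ).exists_isMinOn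
    Set.univ_nonempty isCompact_univ
  refine ⟨phiPlusMinus a F θ₀ - phiMinusPlus a F θ₀, sub_pos.2 (hF.phiMinusPlus_lt hA θ₀),
    fun θ => ?_⟩
  have h2 := hmin (Set.mem_univ θ)
  simp only [Set.mem_ofPred_eq, phiPlusMinus_reflect] at h2
  have := hF.phiPlusMinus_le θ
  have := hF.phiMinus_le_phiMinusPlus θ
  linarith

end Attractor

/-! ### Measure preserving transformations -/

section MeasurePreserving

variable {Ω : Type*} [MeasurableSpace Ω] {μ : Measure Ω} {T : Ω → Ω}

theorem MeasureTheory.MeasurePreserving.integral_comp_eq (hT : MeasurePreserving T μ μ) {g : Ω → ℝ}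
    (hg : Measurable g) : ∫ x, g (T x) ∂μ = ∫ x, g x ∂μ := by
  have := integral_map hT.measurable.aemeasurable (f := g)
    (by rw [hT.map_eq]; exact hg.aestronglyMeasurable)
  rw [hT.map_eq] at this
  exact this.symm

variable [IsProbabilityMeasure μ]

theorem integrable_of_abs_le {g : Ω → ℝ} (hg : Measurable g) {C : ℝ} (hC : ∀ᵐ x ∂μ, |g x| ≤ C) :
    Integrable g μ :=
  Integrable.of_bound hg.aestronglyMeasurable C hC

theorem integral_pos_of_ae_pos {g : Ω → ℝ} (hg : Integrable g μ) (hpos : ∀ᵐ x ∂μ, 0 < g x) :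
    0 < ∫ x, g x ∂μ := by
  rw [integral_pos_iff_support_of_nonneg_ae (hpos.mono fun x hx => hx.le) hg]
  have : μ (Function.support g) = 1 :=
    prob_compl_eq_zero_iff₀ (hg.aestronglyMeasurable.nullMeasurableSet_support) |>.1
      (by refine measure_mono_null ?_ (ae_iff.1 hpos); intro x hx; simp at hx ⊢; exact hx.le)
  simp [this]

theorem integral_lt_of_ae_lt {f g : Ω → ℝ} (hf : Integrable f μ) (hg : Integrable g μ)
    (h : ∀ᵐ x ∂μ, f x < g x) : ∫ x, f x ∂μ < ∫ x, g x ∂μ := by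
  have := integral_pos_of_ae_pos (hg.sub hf) (h.mono fun x hx => sub_pos.2 hx)
  rw [integral_sub' hg hf] at this
  linarith

/-- An integrable coboundary has vanishing integral. -/
theorem MeasureTheory.MeasurePreserving.integral_coboundary_eq_zero
    (hT : MeasurePreserving T μ μ) {h : Ω → ℝ} (hm : Measurable h)
    (hi : Integrable (fun x => h (T x) - h x) μ) : ∫ x, (h (T x) - h x) ∂μ = 0 := by
  -- The function `h` itself need not be integrable. Truncation is 1-Lipschitz, so the truncated
  -- coboundaries are dominated by the integrable `|h ∘ T - h|`, and each has integral zero.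
  let t : ℕ → ℝ → ℝ := fun N y => max (-(N : ℝ)) (min (N : ℝ) y)
  have ht : ∀ N, Measurable (t N) := fun N => by fun_prop
  have hb : ∀ N y, |t N y| ≤ N := fun N y => by
    rw [abs_le]
    have : (0 : ℝ) ≤ N := Nat.cast_nonneg N
    exact ⟨le_max_left _ _, max_le (by linarith) (min_le_left _ _)⟩
  have hlip : ∀ N y z, |t N y - t N z| ≤ |y - z| := fun N y z => by
    simp only [t]
    rw [max_comm, max_comm (-(N : ℝ)) (min _ z)]
    refine (abs_max_sub_max_le_abs _ _ _).trans ?_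
    exact (abs_min_sub_min_le_max (N : ℝ) y N z).trans (by simp)
  have hz : ∀ N, ∫ x, (t N (h (T x)) - t N (h x)) ∂μ = 0 := fun N => by
    have i1 : Integrable (fun x => t N (h (T x))) μ :=
      integrable_of_abs_le ((ht N).comp (hm.comp hT.measurable)) (ae_of_all _ fun x => hb N _)
    have i2 : Integrable (fun x => t N (h x)) μ :=
      integrable_of_abs_le ((ht N).comp hm) (ae_of_all _ fun x => hb N _)
    rw [integral_sub i1 i2, hT.integral_comp_eq (g := fun x => t N (h x)) ((ht N).comp hm), sub_self]
  have hlim : ∀ y, Tendsto (fun N => t N y) atTop (𝓝 y) := fun y => by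
    obtain ⟨N₀, hN₀⟩ := exists_nat_ge |y|
    refine tendsto_const_nhds.congr' ?_
    filter_upwards [eventually_ge_atTop N₀] with N hN
    have h1 : |y| ≤ N := hN₀.trans (Nat.cast_le.2 hN)
    rw [abs_le] at h1
    simp only [t]
    rw [min_eq_right h1.2, max_eq_right h1.1]
  have := tendsto_integral_of_dominated_convergence (μ := μ)
    (F := fun N x => t N (h (T x)) - t N (h x)) (f := fun x => h (T x) - h x)
    (fun x => |h (T x) - h x|)
    (fun N => (((ht N).comp (hm.comp hT.measurable)).sub ((ht N).comp hm)).aestronglyMeasurable)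
    hi.abs (fun N => ae_of_all _ fun x => hlip N _ _)
    (ae_of_all _ fun x => (hlim _).sub (hlim _))
  simp only [hz] at this
  exact tendsto_nhds_unique this tendsto_const_nhds |>.symm ▸ rfl

/-- The running maxima of the Birkhoff sums of `f`. -/
noncomputable def runningMax (T : Ω → Ω) (f : Ω → ℝ) : ℕ → Ω → ℝ
  | 0, _ => 0
  | n + 1, x => max 0 (f x + runningMax T f n (T x))

/-- A consequence of the maximal ergodic theorem: if `∫ f < 0` then all the Birkhoff sums of `f` are
non-positive on a set of positive measure. -/
theorem MeasureTheory.MeasurePreserving.frequently_birkhoffSum_nonpos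
    (hT : MeasurePreserving T μ μ) {f : Ω → ℝ} (hf : Measurable f) {C : ℝ} (hC : ∀ᵐ x ∂μ, |f x| ≤ C)
    (hneg : ∫ x, f x ∂μ < 0) :
    ∃ᶠ x in ae μ, ∀ n, ∑ k ∈ Finset.range n, f (T^[k] x) ≤ 0 := by
  intro hcon
  set M := runningMax T f with hM
  have hMm : ∀ n, Measurable (M n) := by
    intro n
    induction n with
    | zero => exact measurable_const
    | succ n ih => exact measurable_const.max (hf.add (ih.comp hT.measurable))
  have hM0 : ∀ n x, 0 ≤ M n x := fun n x => by
    cases n with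
    | zero => exact le_rfl
    | succ n => exact le_max_left _ _
  have hMmono : ∀ n x, M n x ≤ M (n + 1) x := by
    intro n
    induction n with
    | zero => intro x; exact hM0 1 x
    | succ n ih => intro x; exact max_le_max le_rfl (by linarith [ih (T x)])
  have hS : ∀ n x, ∑ k ∈ Finset.range n, f (T^[k] x) ≤ M n x := by
    intro n
    induction n with
    | zero => intro x; simp [hM, runningMax]
    | succ n ih =>
      intro x
      rw [Finset.sum_range_succ']
      simp only [Function.iterate_succ_apply, Function.iterate_zero, id]
      have := ih (T x)
      exact le_trans (by linarith) (le_max_right _ _)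
  have hMi : ∀ n, Integrable (M n) μ := by
    have hb : ∀ n, ∀ᵐ x ∂μ, |M n x| ≤ n * C := by
      intro n
      induction n with
      | zero => exact ae_of_all _ fun x => by simp [hM, runningMax]
      | succ n ih =>
        filter_upwards [hC, hT.quasiMeasurePreserving.ae ih] with x h1 h2
        rw [abs_of_nonneg (hM0 _ _)]
        have h3 := (abs_le.1 h1).2
        have h4 := (abs_le.1 h2).2
        have h5 := abs_nonneg (f x)
        have h6 := abs_nonneg (M n (T x))
        push_cast
        exact max_le (by nlinarith) (by linarith)
    exact fun n => integrable_of_abs_le (hMm n) (hb n)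
  -- On `{M n > 0}` one has `M n - M n ∘ T ≤ f`, so the integral of `f` over this set is
  -- non-negative. If almost every point had some positive Birkhoff sum, these sets would exhaust
  -- the space, contradicting `∫ f < 0`.
  let g : ℕ → Ω → ℝ := fun n => {x | 0 < M n x}.indicator f
  have hset : ∀ n, MeasurableSet {x | 0 < M n x} := fun n => measurableSet_lt measurable_const (hMm n)
  have hfi : Integrable f μ := integrable_of_abs_le hf hC
  have hg : ∀ n, 0 ≤ ∫ x, g n x ∂μ := fun n => by
    have h1 : ∀ x, M n x - M n (T x) ≤ g n x := fun x => by
      by_cases hx : 0 < M n x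
      · have : g n x = f x := Set.indicator_of_mem (s := {x | 0 < M n x}) hx f
        rw [this]
        cases n with
        | zero => simp [hM, runningMax] at hx
        | succ n =>
          have h2 : M (n + 1) x = f x + M n (T x) := by
            change max 0 (f x + M n (T x)) = _
            refine max_eq_right ?_
            by_contra! h
            exact hx.ne' (max_eq_left h.le)
          rw [h2]
          linarith [hMmono n (T x)]
      · have : g n x = 0 := Set.indicator_of_notMem (s := {x | 0 < M n x}) hx f
        rw [this]
        linarith [hM0 n (T x)]
    have h2 : Integrable (fun x => M n (T x)) μ := hT.integrable_comp_of_integrable (hMi n)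
    have h3 := integral_mono ((hMi n).sub h2) (hfi.indicator (hset n)) h1
    rw [integral_sub' (hMi n) h2] at h3
    have h4 : ∫ x, (fun x => M n (T x)) x ∂μ = ∫ x, M n x ∂μ := hT.integral_comp_eq (hMm n)
    rw [h4, sub_self] at h3
    exact h3
  have hlim : Tendsto (fun n => ∫ x, g n x ∂μ) atTop (𝓝 (∫ x, f x ∂μ)) := by
    refine tendsto_integral_of_dominated_convergence (fun x => |f x|)
      (fun n => (hf.indicator (hset n)).aestronglyMeasurable) hfi.abs
      (fun n => ae_of_all _ fun x => ?_) ?_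
    · exact norm_indicator_le_norm_self f x
    · filter_upwards [hcon] with x hx
      push Not at hx
      obtain ⟨n₀, hn₀⟩ := hx
      refine tendsto_const_nhds.congr' ?_
      filter_upwards [eventually_ge_atTop n₀] with n hn
      have h1 : M n₀ x ≤ M n x := monotone_nat_of_le_succ (fun n => hMmono n x) hn
      exact (Set.indicator_of_mem (s := {x | 0 < M n x})
        (lt_of_lt_of_le (lt_of_lt_of_le hn₀ (hS n₀ x)) h1) f).symm
  have := ge_of_tendsto' hlim hg
  linarith

/-- A positive function does not tend to zero along a sequence of times. -/
theorem MeasureTheory.MeasurePreserving.ae_not_tendsto_zero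
    (hT : MeasurePreserving T μ μ) {h : Ω → ℝ} (hm : Measurable h) (hpos : ∀ᵐ x ∂μ, 0 < h x)
    (n : ℕ → ℕ) : ∀ᵐ x ∂μ, ¬ Tendsto (fun k => h (T^[n k] x)) atTop (𝓝 0) := by
  -- Convergence puts the point into all late preimages of `{h < 1 / (j + 1)}`, and each single
  -- preimage has the measure of that set. As `j` grows this measure tends to zero, because `h > 0`.
  have hlim : ∀ j : ℕ, μ {x | Tendsto (fun k => h (T^[n k] x)) atTop (𝓝 0)} ≤
      μ {x | h x < 1 / ((j : ℝ) + 1)} := by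
    intro j
    have hS : MeasurableSet {x | h x < 1 / ((j : ℝ) + 1)} := measurableSet_lt hm measurable_const
    let B : ℕ → Set Ω := fun K => ⋂ k ≥ K, T^[n k] ⁻¹' {x | h x < 1 / ((j : ℝ) + 1)}
    have hB : Monotone B := fun K K' hK => Set.biInter_subset_biInter_left fun k hk => hK.trans hk
    calc _ ≤ μ (⋃ K, B K) := by
          refine measure_mono fun x hx => ?_
          obtain ⟨K, hK⟩ := eventually_atTop.1 ((show Tendsto _ _ _ from hx).eventually
            (gt_mem_nhds (show (0 : ℝ) < 1 / ((j : ℝ) + 1) by positivity)))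
          exact Set.mem_iUnion.2 ⟨K, Set.mem_iInter₂.2 fun k hk => hK k hk⟩
      _ = ⨆ K, μ (B K) := hB.measure_iUnion
      _ ≤ _ := iSup_le fun K => by
          rw [← (hT.iterate (n K)).measure_preimage hS.nullMeasurableSet]
          exact measure_mono (Set.iInter₂_subset K le_rfl)
  have hz : Tendsto (fun j : ℕ => μ {x | h x < 1 / ((j : ℝ) + 1)}) atTop
      (𝓝 (μ (⋂ j : ℕ, {x | h x < 1 / ((j : ℝ) + 1)}))) := by
    refine tendsto_measure_iInter_atTop
      (fun j => (measurableSet_lt hm measurable_const).nullMeasurableSet) ?_ ⟨0, measure_ne_top _ _⟩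
    intro i j hij x hx
    have hij' : (i : ℝ) ≤ j := Nat.cast_le.2 hij
    exact lt_of_lt_of_le (show h x < 1 / ((j : ℝ) + 1) from hx) (by gcongr)
  have h0 : μ (⋂ j : ℕ, {x | h x < 1 / ((j : ℝ) + 1)}) = 0 := by
    refine measure_mono_null (fun x hx => ?_) (ae_iff.1 hpos)
    simp only [Set.mem_iInter, Set.mem_ofPred_eq] at hx ⊢
    intro hx0
    obtain ⟨j, hj⟩ := exists_nat_one_div_lt hx0
    exact (hx j).not_gt hj
  rw [h0] at hz
  have := ge_of_tendsto' hz hlim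
  rw [ae_iff]
  simpa using this

end MeasurePreserving

/-! ### Invariant graphs and their exponents -/

section Exponents

variable {a : ℝ} {F : UnitAddCircle → ℝ → ℝ} {iL iU jL jU : ℝ}
  {ν : Measure (UnitAddCircle × UnitAddCircle)}

/-- A measurable invariant graph of the skew product with values in `[jL, jU]`. -/
structure IsInvariantGraph (a : ℝ) (F : UnitAddCircle → ℝ → ℝ) (jL jU : ℝ)
    (φ : UnitAddCircle × UnitAddCircle → ℝ) : Prop where
  measurable : Measurable φ
  mem : ∀ θ, φ θ ∈ Set.Icc jL jU
  baker : ∀ θ, φ (baker a θ) = F θ.2 (φ θ)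

theorem IsInvariantGraph.iterate {φ : UnitAddCircle × UnitAddCircle → ℝ}
    (h : IsInvariantGraph a F jL jU φ) (θ : UnitAddCircle × UnitAddCircle) (n : ℕ) :
    ((skew a F)^[n] (θ, φ θ)).2 = φ ((_root_.baker a)^[n] θ) := by
  induction n with
  | zero => rfl
  | succ n ih => rw [skew_iterate_succ_snd, ih, Function.iterate_succ_apply', h.baker]

theorem IsBakerDrivenSystem.isInvariantGraph_phiPlus (hF : IsBakerDrivenSystem a F iL iU jL jU) :
    IsInvariantGraph a F iL iU (phiPlus a F) :=
  ⟨hF.measurable_phiPlus, hF.phiPlus_mem, hF.phiPlus_baker⟩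

theorem IsBakerDrivenSystem.isInvariantGraph_phiMinus (hF : IsBakerDrivenSystem a F iL iU jL jU) :
    IsInvariantGraph a F iL iU (phiMinus a F) :=
  ⟨hF.measurable_phiMinus, hF.phiMinus_mem, hF.phiMinus_baker⟩

theorem IsInvariantGraph.mono {φ : UnitAddCircle × UnitAddCircle → ℝ}
    (h : IsInvariantGraph a F iL iU φ) (hF : IsBakerDrivenSystem a F iL iU jL jU) :
    IsInvariantGraph a F jL jU φ :=
  ⟨h.measurable, fun θ => hF.subset (h.mem θ), h.baker⟩

/-! ### The graph `φ*` -/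

theorem IsBakerDrivenSystem.phiMinus_mem_basin (hF : IsBakerDrivenSystem a F iL iU jL jU)
    (θ : UnitAddCircle × UnitAddCircle) :
    phiMinus a F θ ∈ {y : ℝ | phiMinus a F θ ≤ y ∧ y ≤ phiPlus a F θ ∧
      Tendsto (fun n : ℕ => |((skew a F)^[n] (θ, y)).2 - phiMinus a F ((baker a)^[n] θ)|)
      atTop (𝓝 0)} :=
  ⟨le_rfl, hF.phiMinus_le_phiPlus θ, by simp [hF.phiMinus_iterate]⟩

theorem bddAbove_basin (θ : UnitAddCircle × UnitAddCircle) :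
    BddAbove {y : ℝ | phiMinus a F θ ≤ y ∧ y ≤ phiPlus a F θ ∧
      Tendsto (fun n : ℕ => |((skew a F)^[n] (θ, y)).2 - phiMinus a F ((baker a)^[n] θ)|)
      atTop (𝓝 0)} := ⟨_, fun _ hy => hy.2.1⟩

theorem IsBakerDrivenSystem.phiMinus_le_phiStar (hF : IsBakerDrivenSystem a F iL iU jL jU)
    (θ : UnitAddCircle × UnitAddCircle) : phiMinus a F θ ≤ phiStar a F θ :=
  le_csSup (bddAbove_basin θ) (hF.phiMinus_mem_basin θ)

theorem IsBakerDrivenSystem.phiStar_le_phiPlus (hF : IsBakerDrivenSystem a F iL iU jL jU)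
    (θ : UnitAddCircle × UnitAddCircle) : phiStar a F θ ≤ phiPlus a F θ :=
  csSup_le ⟨_, hF.phiMinus_mem_basin θ⟩ fun _ hy => hy.2.1

theorem IsBakerDrivenSystem.phiStar_mem (hF : IsBakerDrivenSystem a F iL iU jL jU)
    (θ : UnitAddCircle × UnitAddCircle) : phiStar a F θ ∈ Set.Icc iL iU :=
  ⟨(hF.phiMinus_mem θ).1.trans (hF.phiMinus_le_phiStar θ),
    (hF.phiStar_le_phiPlus θ).trans (hF.phiPlus_mem θ).2⟩

theorem IsBakerDrivenSystem.tendsto_phiMinus_of_le (hF : IsBakerDrivenSystem a F iL iU jL jU)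
    {θ : UnitAddCircle × UnitAddCircle} {y y' : ℝ} (hy : phiMinus a F θ ≤ y) (hyy : y ≤ y')
    (h : Tendsto (fun n : ℕ => |((skew a F)^[n] (θ, y')).2 - phiMinus a F ((baker a)^[n] θ)|)
      atTop (𝓝 0)) :
    Tendsto (fun n : ℕ => |((skew a F)^[n] (θ, y)).2 - phiMinus a F ((baker a)^[n] θ)|)
      atTop (𝓝 0) := by
  refine squeeze_zero (fun n => abs_nonneg _) (fun n => ?_) h
  have h1 := (hF.skew_iterate_strictMono n θ).monotone hy
  have h2 := (hF.skew_iterate_strictMono n θ).monotone hyy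
  rw [hF.phiMinus_iterate] at h1
  rw [abs_of_nonneg (sub_nonneg.2 h1), abs_of_nonneg (sub_nonneg.2 (h1.trans h2))]
  linarith

theorem IsBakerDrivenSystem.tendsto_of_lt_phiStar (hF : IsBakerDrivenSystem a F iL iU jL jU)
    {θ : UnitAddCircle × UnitAddCircle} {y : ℝ} (hy : phiMinus a F θ ≤ y)
    (hy' : y < phiStar a F θ) :
    Tendsto (fun n : ℕ => |((skew a F)^[n] (θ, y)).2 - phiMinus a F ((baker a)^[n] θ)|)
      atTop (𝓝 0) := by
  obtain ⟨z, hz, hyz⟩ := exists_lt_of_lt_csSup ⟨_, hF.phiMinus_mem_basin θ⟩ hy'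
  exact hF.tendsto_phiMinus_of_le hy hyz.le hz.2.2

theorem IsBakerDrivenSystem.phiStar_baker (hF : IsBakerDrivenSystem a F iL iU jL jU)
    (θ : UnitAddCircle × UnitAddCircle) :
    phiStar a F (baker a θ) = F θ.2 (phiStar a F θ) := by
  unfold phiStar
  rw [(hF.strictMono θ.2).monotone.map_csSup_of_continuousAt
    (hF.differentiable θ.2).continuous.continuousAt ⟨_, hF.phiMinus_mem_basin θ⟩ (bddAbove_basin θ)]
  congr 1
  have hsk : ∀ y, skew a F (θ, y) = (baker a θ, F θ.2 y) := fun y => rfl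
  ext y
  simp only [Set.mem_ofPred_eq, Set.mem_image]
  constructor
  · rintro ⟨h1, h2, h3⟩
    rw [hF.phiMinus_baker] at h1
    rw [hF.phiPlus_baker] at h2
    obtain ⟨z, hz, rfl⟩ := intermediate_value_Icc (hF.phiMinus_le_phiPlus θ)
      (hF.differentiable θ.2).continuous.continuousOn ⟨h1, h2⟩
    refine ⟨z, ⟨hz.1, hz.2, ?_⟩, rfl⟩
    rw [← tendsto_add_atTop_iff_nat 1]
    simpa only [Function.iterate_succ_apply, hsk] using h3
  · rintro ⟨z, ⟨h1, h2, h3⟩, rfl⟩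
    rw [hF.phiMinus_baker, hF.phiPlus_baker]
    refine ⟨(hF.strictMono _).monotone h1, (hF.strictMono _).monotone h2, ?_⟩
    rw [← tendsto_add_atTop_iff_nat 1] at h3
    simpa only [Function.iterate_succ_apply, hsk] using h3

theorem measurable_skew (hF : IsBakerDrivenSystem a F iL iU jL jU) : Measurable (skew a F) :=
  (measurable_baker.comp measurable_fst).prodMk (hF.continuous.measurable.comp
    ((measurable_snd.comp measurable_fst).prodMk measurable_snd))

theorem IsBakerDrivenSystem.measurable_phiStar (hF : IsBakerDrivenSystem a F iL iU jL jU) :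
    Measurable (phiStar a F) := by
  refine measurable_of_Ioi fun c => ?_
  -- The basin of `φ⁻` in each fibre is an interval that starts at `φ⁻`, so rational heights suffice
  -- to detect its upper end.
  have : phiStar a F ⁻¹' Set.Ioi c = {θ | c < phiMinus a F θ} ∪
      ⋃ q : ℚ, {θ | c < q ∧ phiMinus a F θ ≤ q ∧ (q : ℝ) ≤ phiPlus a F θ ∧
        Tendsto (fun n : ℕ => |((skew a F)^[n] (θ, (q : ℝ))).2 - phiMinus a F ((baker a)^[n] θ)|)
          atTop (𝓝 0)} := by
    ext θ
    simp only [Set.mem_preimage, Set.mem_Ioi, Set.mem_union, Set.mem_iUnion, Set.mem_ofPred_eq]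
    constructor
    · intro h
      by_cases hc : c < phiMinus a F θ
      · exact Or.inl hc
      right
      obtain ⟨q, hq1, hq2⟩ := exists_rat_btwn h
      have h1 : phiMinus a F θ ≤ q := (not_lt.1 hc).trans hq1.le
      exact ⟨q, hq1, h1, hq2.le.trans (hF.phiStar_le_phiPlus θ), hF.tendsto_of_lt_phiStar h1 hq2⟩
    · rintro (h | ⟨q, h1, h2⟩)
      · exact h.trans_le (hF.phiMinus_le_phiStar θ)
      · exact h1.trans_le (le_csSup (bddAbove_basin θ) h2)
  rw [this]
  have hm := hF.measurable_phiMinus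
  refine (measurableSet_lt measurable_const hm).union (MeasurableSet.iUnion fun q => ?_)
  refine (MeasurableSet.const _).inter ((measurableSet_le hm measurable_const).inter
    ((measurableSet_le measurable_const hF.measurable_phiPlus).inter ?_))
  refine measurableSet_tendsto (𝓝 0) fun n => ?_
  have h1 : Measurable fun θ : UnitAddCircle × UnitAddCircle =>
      ((skew a F)^[n] (θ, (q : ℝ))).2 :=
    measurable_snd.comp (((measurable_skew hF).iterate n).comp
      (measurable_id.prodMk measurable_const))
  exact continuous_abs.measurable.comp (h1.sub (hm.comp (measurable_baker.iterate n)))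

theorem IsBakerDrivenSystem.isInvariantGraph_phiStar (hF : IsBakerDrivenSystem a F iL iU jL jU) :
    IsInvariantGraph a F iL iU (phiStar a F) :=
  ⟨hF.measurable_phiStar, hF.phiStar_mem, hF.phiStar_baker⟩

/-! ### Exponents of invariant graphs -/

theorem graphExponent_reflect (φ : UnitAddCircle × UnitAddCircle → ℝ) :
    graphExponent (reflectFibre F) ν φ = graphExponent F ν fun θ => -φ θ := by
  simp only [graphExponent, deriv_reflect]

variable [IsProbabilityMeasure ν]

theorem IsInvariantGraph.measurable_log_deriv {φ : UnitAddCircle × UnitAddCircle → ℝ}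
    (h : IsInvariantGraph a F jL jU φ) (hF : IsBakerDrivenSystem a F iL iU jL jU) :
    Measurable fun θ : UnitAddCircle × UnitAddCircle => Real.log (deriv (F θ.2) (φ θ)) :=
  Real.measurable_log.comp (hF.measurable_deriv.comp (measurable_snd.prodMk h.measurable))

theorem IsBakerDrivenSystem.abs_log_le (hF : IsBakerDrivenSystem a F iL iU jL jU) :
    ∃ C : ℝ, (∀ x, ∀ y ∈ Set.Icc jL jU, |Real.log (deriv (F x) y)| ≤ C) ∧
      ∀ x, ∀ y ∈ Set.Icc jL jU, ∀ y' ∈ Set.Icc jL jU, y ≠ y' →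
        |Real.log ((F x y' - F x y) / (y' - y))| ≤ C := by
  obtain ⟨m, L, hm, hL, hb⟩ := hF.deriv_bounds
  have key : ∀ d, m ≤ d → d ≤ L → |Real.log d| ≤ max |Real.log m| |Real.log L| := fun d h1 h2 => by
    have h3 := Real.log_le_log hm h1
    have h4 := Real.log_le_log (hm.trans_le h1) h2
    exact abs_le_max_abs_abs h3 h4
  refine ⟨_, fun x y hy => key _ (hb x y hy).1 (hb x y hy).2, fun x y hy y' hy' hne => ?_⟩
  wlog hlt : y < y' generalizing y y'
  · have := this y' hy' y hy hne.symm (lt_of_le_of_ne (not_lt.1 hlt) hne.symm)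
    rwa [← neg_sub (F x y) (F x y'), ← neg_sub y y', neg_div_neg_eq]
  obtain ⟨z, hz, he⟩ := hF.exists_deriv_eq x hlt
  have hz' : z ∈ Set.Icc jL jU := ⟨hy.1.trans hz.1.le, hz.2.le.trans hy'.2⟩
  rw [he, mul_div_cancel_right₀ _ (sub_pos.2 hlt).ne']
  exact key _ (hb x z hz').1 (hb x z hz').2

theorem IsInvariantGraph.integrable_log_deriv {φ : UnitAddCircle × UnitAddCircle → ℝ}
    (h : IsInvariantGraph a F jL jU φ) (hF : IsBakerDrivenSystem a F iL iU jL jU) :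
    Integrable (fun θ : UnitAddCircle × UnitAddCircle => Real.log (deriv (F θ.2) (φ θ))) ν := by
  obtain ⟨C, hC, -⟩ := hF.abs_log_le
  exact integrable_of_abs_le (h.measurable_log_deriv hF) (ae_of_all _ fun θ => hC _ _ (h.mem θ))

/-- The logarithmic secant slope between two ordered invariant graphs has vanishing mean. -/
theorem IsInvariantGraph.integral_log_secant {φ ψ : UnitAddCircle × UnitAddCircle → ℝ}
    (hφ : IsInvariantGraph a F jL jU φ) (hψ : IsInvariantGraph a F jL jU ψ)
    (hF : IsBakerDrivenSystem a F iL iU jL jU) (hT : MeasurePreserving (_root_.baker a) ν ν)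
    (hlt : ∀ᵐ θ ∂ν, φ θ < ψ θ) :
    Integrable (fun θ => Real.log ((F θ.2 (ψ θ) - F θ.2 (φ θ)) / (ψ θ - φ θ))) ν ∧
      ∫ θ, Real.log ((F θ.2 (ψ θ) - F θ.2 (φ θ)) / (ψ θ - φ θ)) ∂ν = 0 := by
  obtain ⟨C, -, hC⟩ := hF.abs_log_le
  -- The secant slope is the quotient of the gaps `ψ - φ` at consecutive times, so its logarithm is
  -- the coboundary of the logarithm of the gap.
  let h : UnitAddCircle × UnitAddCircle → ℝ := fun θ => Real.log (ψ θ - φ θ)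
  have hm : Measurable h := Real.measurable_log.comp (hψ.measurable.sub hφ.measurable)
  have he : (fun θ => Real.log ((F θ.2 (ψ θ) - F θ.2 (φ θ)) / (ψ θ - φ θ))) =ᵐ[ν]
      fun θ => h (_root_.baker a θ) - h θ := by
    filter_upwards [hlt] with θ hθ
    have h1 : F θ.2 (ψ θ) - F θ.2 (φ θ) ≠ 0 := (sub_pos.2 (hF.strictMono θ.2 hθ)).ne'
    rw [Real.log_div h1 (sub_pos.2 hθ).ne']
    simp only [h, hψ.baker, hφ.baker]
  have hi : Integrable (fun θ => h (_root_.baker a θ) - h θ) ν := by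
    refine integrable_of_abs_le ((hm.comp hT.measurable).sub hm) (C := C) ?_
    filter_upwards [he, hlt] with θ hθ hθ2
    rw [← hθ]
    exact hC _ _ (hφ.mem θ) _ (hψ.mem θ) hθ2.ne
  exact ⟨hi.congr he.symm, by rw [integral_congr_ae he]; exact hT.integral_coboundary_eq_zero hm hi⟩

/-- Exponents of three ordered invariant graphs. -/
theorem IsBakerDrivenSystem.exponents_of_three (hF : IsBakerDrivenSystem a F iL iU jL jU)
    (hT : MeasurePreserving (baker a) ν ν) {φ₁ φ₂ φ₃ : UnitAddCircle × UnitAddCircle → ℝ}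
    (h₁ : IsInvariantGraph a F jL jU φ₁) (h₂ : IsInvariantGraph a F jL jU φ₂)
    (h₃ : IsInvariantGraph a F jL jU φ₃) (h12 : ∀ᵐ θ ∂ν, φ₁ θ < φ₂ θ)
    (h23 : ∀ᵐ θ ∂ν, φ₂ θ < φ₃ θ) :
    graphExponent F ν φ₁ < 0 ∧ 0 < graphExponent F ν φ₂ ∧ graphExponent F ν φ₃ < 0 := by
  have h13 : ∀ᵐ θ ∂ν, φ₁ θ < φ₃ θ := by
    filter_upwards [h12, h23] with θ h h' using h.trans h'
  obtain ⟨i12, e12⟩ := h₁.integral_log_secant h₂ hF hT h12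
  obtain ⟨i23, e23⟩ := h₂.integral_log_secant h₃ hF hT h23
  obtain ⟨i13, e13⟩ := h₁.integral_log_secant h₃ hF hT h13
  have hpos : ∀ {x : UnitAddCircle} {y z : ℝ}, y < z → 0 < (F x z - F x y) / (z - y) :=
    fun {x y z} h => div_pos (sub_pos.2 (hF.strictMono x h)) (sub_pos.2 h)
  refine ⟨?_, ?_, ?_⟩
  -- All three logarithmic secant slopes have mean zero, so integrating the logarithm of
  -- `deriv_left_lt` leaves only the exponent. The other two graphs use `lt_deriv_middle` and
  -- `deriv_right_lt`.
  · have := integral_lt_of_ae_lt (h₁.integrable_log_deriv hF) ((i12.add i13).sub i23) (by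
      filter_upwards [h12, h23] with θ h h'
      have := deriv_left_lt (hF.contDiff_fibre θ.2) (hF.deriv_pos θ.2) (hF.schwarzian_neg θ.2) h h'
      have := Real.log_lt_log (mul_pos (hF.deriv_pos θ.2 _) (hpos h')) this
      rw [Real.log_mul (hF.deriv_pos θ.2 _).ne' (hpos h').ne',
        Real.log_mul (hpos h).ne' (hpos (h.trans h')).ne'] at this
      simp only [Pi.sub_apply, Pi.add_apply]
      linarith)
    rw [integral_sub' (i12.add i13) i23, integral_add' i12 i13, e12, e23, e13] at this
    simpa [graphExponent] using this
  · have := integral_lt_of_ae_lt ((i12.add i23).sub i13) (h₂.integrable_log_deriv hF) (by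
      filter_upwards [h12, h23] with θ h h'
      have := lt_deriv_middle (hF.contDiff_fibre θ.2) (hF.deriv_pos θ.2) (hF.schwarzian_neg θ.2) h h'
      have := Real.log_lt_log (mul_pos (hpos h) (hpos h')) this
      rw [Real.log_mul (hF.deriv_pos θ.2 _).ne' (hpos (h.trans h')).ne',
        Real.log_mul (hpos h).ne' (hpos h').ne'] at this
      simp only [Pi.sub_apply, Pi.add_apply]
      linarith)
    rw [integral_sub' (i12.add i23) i13, integral_add' i12 i23, e12, e23, e13] at this
    simpa [graphExponent] using this
  · have := integral_lt_of_ae_lt (h₃.integrable_log_deriv hF) ((i23.add i13).sub i12) (by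
      filter_upwards [h12, h23] with θ h h'
      have := deriv_right_lt (hF.contDiff_fibre θ.2) (hF.deriv_pos θ.2) (hF.schwarzian_neg θ.2) h h'
      have := Real.log_lt_log (mul_pos (hF.deriv_pos θ.2 _) (hpos h)) this
      rw [Real.log_mul (hF.deriv_pos θ.2 _).ne' (hpos h).ne',
        Real.log_mul (hpos h').ne' (hpos (h.trans h')).ne'] at this
      simp only [Pi.sub_apply, Pi.add_apply]
      linarith)
    rw [integral_sub' (i23.add i13) i12, integral_add' i23 i13, e12, e23, e13] at this
    simpa [graphExponent] using this

/-- Integrate the logarithm of `deriv_mul_deriv_lt`; the right-hand side is twice a logarithmic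
secant slope of mean zero. -/
theorem IsBakerDrivenSystem.exponents_of_two (hF : IsBakerDrivenSystem a F iL iU jL jU)
    (hT : MeasurePreserving (baker a) ν ν) {φ₁ φ₂ : UnitAddCircle × UnitAddCircle → ℝ}
    (h₁ : IsInvariantGraph a F jL jU φ₁) (h₂ : IsInvariantGraph a F jL jU φ₂)
    (h12 : ∀ᵐ θ ∂ν, φ₁ θ < φ₂ θ) : graphExponent F ν φ₁ + graphExponent F ν φ₂ < 0 := by
  obtain ⟨i12, e12⟩ := h₁.integral_log_secant h₂ hF hT h12
  have := integral_lt_of_ae_lt ((h₁.integrable_log_deriv hF).add (h₂.integrable_log_deriv hF))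
    (i12.const_mul 2) (by
      filter_upwards [h12] with θ h
      have := deriv_mul_deriv_lt (hF.contDiff_fibre θ.2) (hF.deriv_pos θ.2) (hF.schwarzian_neg θ.2) h
      have := Real.log_lt_log (mul_pos (hF.deriv_pos θ.2 _) (hF.deriv_pos θ.2 _)) this
      rw [Real.log_mul (hF.deriv_pos θ.2 _).ne' (hF.deriv_pos θ.2 _).ne', Real.log_pow] at this
      simpa using this)
  rw [integral_add' (h₁.integrable_log_deriv hF) (h₂.integrable_log_deriv hF),
    integral_const_mul, e12, mul_zero] at this
  exact this

/-- A graph with negative exponent attracts a neighbourhood of uniform size on a set of positive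
measure. -/
theorem IsBakerDrivenSystem.exists_attracted (hF : IsBakerDrivenSystem a F iL iU jL jU)
    (hT : MeasurePreserving (baker a) ν ν) {φ : UnitAddCircle × UnitAddCircle → ℝ}
    (hφ : IsInvariantGraph a F iL iU φ) (hneg : graphExponent F ν φ < 0) :
    ∃ δ : ℝ, 0 < δ ∧ ∃ᶠ θ in ae ν, ∀ y, |y - φ θ| ≤ δ →
      Tendsto (fun n => |((skew a F)^[n] (θ, y)).2 - φ ((baker a)^[n] θ)|) atTop (𝓝 0) := by
  obtain ⟨C, hC, -⟩ := hF.abs_log_le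
  obtain ⟨m, L, hm, hL, hb⟩ := hF.deriv_bounds
  obtain ⟨K, hK0, hK⟩ := hF.deriv_fibre_lipschitz
  have hφJ := hφ.mono hF
  -- The exponent is `-3η`. Then `f` has mean `-η`, so its Birkhoff sums stay non-positive on a set
  -- of positive measure; of the margin `2η`, one `η` pays for distortion and the other remains as
  -- contraction rate.
  obtain ⟨η, hη⟩ : ∃ η, η = -graphExponent F ν φ / 3 := ⟨_, rfl⟩
  have hη0 : 0 < η := by rw [hη]; linarith
  let f : UnitAddCircle × UnitAddCircle → ℝ := fun θ => Real.log (deriv (F θ.2) (φ θ)) + 2 * η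
  have hf : Measurable f := (hφJ.measurable_log_deriv hF).add_const _
  have hfi : ∫ θ, f θ ∂ν < 0 := by
    simp only [f]
    rw [integral_add (hφJ.integrable_log_deriv hF) (integrable_const _)]
    simp only [integral_const, probReal_univ, one_smul]
    have : ∫ θ, Real.log (deriv (F θ.2) (φ θ)) ∂ν = graphExponent F ν φ := rfl
    rw [this]; linarith
  have hfb : ∀ᵐ θ ∂ν, |f θ| ≤ C + 2 * η := ae_of_all _ fun θ => by
    refine (abs_add_le _ _).trans ?_
    rw [abs_of_pos (show 0 < 2 * η by linarith)]
    linarith [hC θ.2 _ (hφJ.mem θ)]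
  have hfreq := hT.frequently_birkhoffSum_nonpos hf hfb hfi
  -- Within distance `δ` of `I` points remain in `J`, and `K * δ ≤ m * η` limits the distortion of
  -- the derivative to the factor `1 + η ≤ exp η`.
  obtain ⟨δ, hδ0, hδ1, hδ2, hδ3⟩ : ∃ δ : ℝ, 0 < δ ∧ δ ≤ iL - jL ∧ δ ≤ jU - iU ∧ K * δ ≤ m * η := by
    refine ⟨min (min (iL - jL) (jU - iU)) (m * η / (K + 1)), ?_, ?_, ?_, ?_⟩
    · refine lt_min (lt_min (sub_pos.2 hF.jL_lt_iL) (sub_pos.2 hF.iU_lt_jU)) (by positivity)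
    · exact (min_le_left _ _).trans (min_le_left _ _)
    · exact (min_le_left _ _).trans (min_le_right _ _)
    · calc K * _ ≤ K * (m * η / (K + 1)) := by gcongr; exact min_le_right _ _
        _ = m * η * (K / (K + 1)) := by ring
        _ ≤ m * η * 1 := by gcongr; rw [div_le_one (by positivity)]; linarith
        _ = m * η := mul_one _
  refine ⟨δ, hδ0, hfreq.mono fun θ hθ y hy => ?_⟩
  have key : ∀ n, |((skew a F)^[n] (θ, y)).2 - φ ((baker a)^[n] θ)| ≤
      δ * Real.exp (∑ k ∈ Finset.range n, f ((baker a)^[k] θ) - n * η) := by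
    intro n
    induction n with
    | zero => simpa using hy
    | succ n ih =>
      set θn := (baker a)^[n] θ with hθn
      set yn := ((skew a F)^[n] (θ, y)).2 with hyn
      have hle : |yn - φ θn| ≤ δ := by
        refine ih.trans (mul_le_of_le_one_right hδ0.le ?_)
        rw [Real.exp_le_one_iff]
        have : 0 ≤ (n : ℝ) * η := by positivity
        linarith [hθ n]
      have hmem : ∀ z, |z - φ θn| ≤ δ → z ∈ Set.Icc jL jU := fun z hz => by
        have h1 := abs_le.1 hz
        have h2 := hφ.mem θn
        exact ⟨by linarith [h2.1], by linarith [h2.2]⟩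
      have hder : ∀ z ∈ Set.uIcc yn (φ θn), deriv (F θn.2) z ≤ Real.exp (f θn - η) := by
        intro z hz
        have hz1 : |z - φ θn| ≤ δ := by
          have := Set.abs_sub_right_of_mem_uIcc hz
          rw [abs_sub_comm, abs_sub_comm (φ θn)] at this
          exact this.trans hle
        have h1 := hK θn.2 z (hmem z hz1) (φ θn) (hφJ.mem θn)
        have h2 := (hb θn.2 _ (hφJ.mem θn)).1
        have h3 := (abs_le.1 h1).2
        have h4 : K * |z - φ θn| ≤ m * η := (mul_le_mul_of_nonneg_left hz1 hK0).trans hδ3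
        have hd := hF.deriv_pos θn.2 (φ θn)
        have h5 : m * η ≤ deriv (F θn.2) (φ θn) * η := by gcongr
        have h6 : f θn - η = Real.log (deriv (F θn.2) (φ θn)) + η := by simp only [f]; ring
        rw [h6, Real.exp_add, Real.exp_log hd]
        calc deriv (F θn.2) z ≤ deriv (F θn.2) (φ θn) * (η + 1) := by linarith
          _ ≤ _ := by gcongr; exact Real.add_one_le_exp η
      rw [skew_iterate_succ_snd, Function.iterate_succ_apply', ← hθn, ← hyn, hφ.baker]
      refine (hF.abs_sub_le_of_deriv_le θn.2 hder).trans ?_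
      calc _ ≤ Real.exp (f θn - η) * _ := mul_le_mul_of_nonneg_left ih (Real.exp_pos _).le
        _ = _ := by
          rw [mul_left_comm, ← Real.exp_add, Finset.sum_range_succ, ← hθn]
          push_cast
          ring_nf
  have hlim : Tendsto (fun n : ℕ => δ * Real.exp (-η) ^ n) atTop (𝓝 0) := by
    simpa using (tendsto_pow_atTop_nhds_zero_of_lt_one (Real.exp_pos _).le
      (Real.exp_lt_one_iff.2 (neg_lt_zero.2 hη0))).const_mul δ
  refine squeeze_zero (fun n => abs_nonneg _) (fun n => (key n).trans ?_) hlim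
  rw [← Real.exp_nat_mul]
  gcongr
  linarith [hθ n]

/-- The exponent of the upper bounding graph is not positive. -/
theorem IsBakerDrivenSystem.graphExponent_phiPlus_nonpos
    (hF : IsBakerDrivenSystem a F iL iU jL jU) (hT : MeasurePreserving (baker a) ν ν) :
    graphExponent F ν (phiPlus a F) ≤ 0 := by
  obtain ⟨C, hC, hC'⟩ := hF.abs_log_le
  obtain ⟨m, L, hm, hL, hb⟩ := hF.deriv_bounds
  let u : ℕ → UnitAddCircle × UnitAddCircle → ℝ := fun n θ => pullback a F n θ.2 jU
  -- The gap between the pullback of `jU` and its limit `φ⁺`. It is positive because `f` maps `jU`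
  -- strictly below itself.
  let U : ℕ → UnitAddCircle × UnitAddCircle → ℝ := fun n θ => u n θ - phiPlus a F θ
  have huJ : ∀ n θ, u n θ ∈ Set.Icc jL jU := fun n θ => hF.pullback_mem_J n _ hF.jU_mem
  have hpJ : ∀ θ, phiPlus a F θ ∈ Set.Icc jL jU := fun θ => hF.subset (hF.phiPlus_mem θ)
  have hUpos : ∀ n θ, 0 < U n θ := fun n θ => by
    have h1 := (hF.phiPlus_spec θ).2.1 (n + 1)
    rw [pullback_add n 1] at h1
    have h2 := hF.strictMono_pullback n θ.2
      ((hF.mapsTo (tau a ((tau a)^[n] θ.2)) hF.jU_mem).2.trans hF.iU_lt_jU)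
    exact sub_pos.2 (h1.trans_lt h2)
  have hstep : ∀ n θ, u (n + 1) (baker a θ) = F θ.2 (u n θ) := fun n θ => by
    simp only [u, pullback, tau_baker_snd hF.a_pos hF.a_lt_one]
  have hUlow : ∀ n θ, m ^ n * (jU - iU) ≤ U n θ := by
    intro n
    induction n with
    | zero => intro θ; simp only [U, u, pullback, pow_zero, one_mul]; linarith [(hF.phiPlus_mem θ).2]
    | succ n ih =>
      intro θ'
      obtain ⟨θ, rfl⟩ := baker_surjective hF.a_pos hF.a_lt_one θ'
      have h1 := hF.le_abs_sub_of_le_deriv θ.2 (y := u n θ) (y' := phiPlus a F θ) (c := m)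
        (fun z hz => (hb _ z (Set.uIcc_subset_Icc (huJ n θ) (hpJ θ) hz)).1)
      have h2 := hUpos (n + 1) (baker a θ)
      simp only [U, hstep, hF.phiPlus_baker] at h2 ⊢
      rw [abs_of_pos h2, abs_of_pos (hUpos n θ)] at h1
      refine le_trans ?_ h1
      rw [pow_succ', mul_assoc]
      exact mul_le_mul_of_nonneg_left (ih θ) hm.le
  have hUm : ∀ n, Measurable (U n) := fun n =>
    (((hF.continuous_pullback n).comp (continuous_snd.prodMk continuous_const)).measurable).sub
      hF.measurable_phiPlus
  have hlogm : ∀ n, Measurable fun θ => Real.log (U n θ) := fun n =>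
    Real.measurable_log.comp (hUm n)
  have hlogi : ∀ n, Integrable (fun θ => Real.log (U n θ)) ν := fun n => by
    refine integrable_of_abs_le (hlogm n) (C := max |Real.log (m ^ n * (jU - iU))|
      |Real.log (jU - jL)|) (ae_of_all _ fun θ => ?_)
    have h0 : 0 < m ^ n * (jU - iU) := mul_pos (pow_pos hm n) (sub_pos.2 hF.iU_lt_jU)
    refine abs_le_max_abs_abs (Real.log_le_log h0 (hUlow n θ)) (Real.log_le_log (hUpos n θ) ?_)
    simp only [U]; linarith [(huJ n θ).2, (hpJ θ).1]
  -- One step multiplies the gap by a secant slope at `φ⁺`, which tends to the derivative. By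
  -- invariance the integral equals that of `log U (n + 1) - log U n`, which is non-positive since
  -- the gaps decrease in `n`.
  have hlim : Tendsto (fun n => ∫ θ, (Real.log (U (n + 1) (baker a θ)) - Real.log (U n θ)) ∂ν) atTop
      (𝓝 (graphExponent F ν (phiPlus a F))) := by
    have hq : ∀ n θ, Real.log (U (n + 1) (baker a θ)) - Real.log (U n θ) =
        Real.log ((F θ.2 (u n θ) - F θ.2 (phiPlus a F θ)) / (u n θ - phiPlus a F θ)) := by
      intro n θ
      rw [← Real.log_div (hUpos _ _).ne' (hUpos _ _).ne']
      simp only [U, hstep, hF.phiPlus_baker]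
    refine tendsto_integral_of_dominated_convergence (fun _ => C)
      (fun n => (((hlogm _).comp hT.measurable).sub (hlogm n)).aestronglyMeasurable)
      (integrable_const _) (fun n => ae_of_all _ fun θ => ?_) (ae_of_all _ fun θ => ?_)
    · rw [hq]
      exact hC' _ _ (hpJ θ) _ (huJ n θ) (sub_pos.1 (hUpos n θ)).ne
    · simp only [hq]
      have h1 := (hasDerivAt_iff_tendsto_slope.1 (hF.differentiable θ.2 (phiPlus a F θ)).hasDerivAt)
      have h2 : Tendsto (fun n => u n θ) atTop (𝓝[≠] (phiPlus a F θ)) :=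
        tendsto_nhdsWithin_iff.2 ⟨(hF.phiPlus_spec θ).1,
          Eventually.of_forall fun n => (sub_pos.1 (hUpos n θ)).ne'⟩
      have h3 := (h1.comp h2).log (hF.deriv_pos _ _).ne'
      refine h3.congr fun n => ?_
      simp only [Function.comp_apply, slope_def_field]
  refine le_of_tendsto' hlim fun n => ?_
  have h1 : Integrable (fun θ => Real.log (U (n + 1) (baker a θ))) ν :=
    hT.integrable_comp_of_integrable (hlogi (n + 1))
  have e : ∫ θ, Real.log (U (n + 1) (baker a θ)) ∂ν = ∫ θ, Real.log (U (n + 1) θ) ∂ν :=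
    hT.integral_comp_eq (hlogm (n + 1))
  rw [integral_sub h1 (hlogi n), e, sub_nonpos]
  refine integral_mono (hlogi _) (hlogi _) fun θ => Real.log_le_log (hUpos _ _) ?_
  exact sub_le_sub_right (hF.antitone_pullback θ.2 (Nat.le_succ n)) _

theorem IsBakerDrivenSystem.graphExponent_phiMinus_nonpos
    (hF : IsBakerDrivenSystem a F iL iU jL jU) (hT : MeasurePreserving (baker a) ν ν) :
    graphExponent F ν (phiMinus a F) ≤ 0 := by
  have := hF.reflect.graphExponent_phiPlus_nonpos hT
  rwa [graphExponent_reflect, ← phiMinus_eq_neg] at this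

end Exponents

/-! ### Coincidence or separation of the three invariant graphs -/

section Trichotomy

variable {a : ℝ} {F : UnitAddCircle → ℝ → ℝ} {iL iU jL jU : ℝ}
  {ν : Measure (UnitAddCircle × UnitAddCircle)}

/-- The fibre maps are injective, so the set where the two graphs coincide is invariant and
ergodicity applies. -/
theorem IsBakerDrivenSystem.ae_eq_or_ae_lt (hF : IsBakerDrivenSystem a F iL iU jL jU)
    (hν : Ergodic (baker a) ν) {φ ψ : UnitAddCircle × UnitAddCircle → ℝ}
    (hφ : IsInvariantGraph a F jL jU φ) (hψ : IsInvariantGraph a F jL jU ψ)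
    (hle : ∀ θ, φ θ ≤ ψ θ) : (∀ᵐ θ ∂ν, φ θ = ψ θ) ∨ ∀ᵐ θ ∂ν, φ θ < ψ θ := by
  have hs : MeasurableSet {θ | φ θ = ψ θ} := measurableSet_eq_fun hφ.measurable hψ.measurable
  have hi : baker a ⁻¹' {θ | φ θ = ψ θ} = {θ | φ θ = ψ θ} := by
    ext θ
    simp only [Set.mem_preimage, Set.mem_ofPred_eq, hφ.baker, hψ.baker]
    exact (hF.strictMono θ.2).injective.eq_iff
  rcases hν.toPreErgodic.measure_self_or_compl_eq_zero hs hi with h | h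
  · right
    rw [ae_iff]
    refine measure_mono_null (fun θ hθ => ?_) h
    simp only [Set.mem_ofPred_eq, not_lt] at hθ ⊢
    exact le_antisymm (hle θ) hθ
  · left
    exact h

variable [IsProbabilityMeasure ν]

/-- A negative exponent would put points strictly above `φ⁻` into its basin on a set of positive
measure, by `exists_attracted`, and so separate `φ*` from `φ⁻`. -/
theorem IsBakerDrivenSystem.graphExponent_phiMinus_nonneg
    (hF : IsBakerDrivenSystem a F iL iU jL jU) (hT : MeasurePreserving (baker a) ν ν)
    (hlt : ∀ θ, phiMinus a F θ < phiPlus a F θ)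
    (h : ∀ᵐ θ ∂ν, phiStar a F θ = phiMinus a F θ) : 0 ≤ graphExponent F ν (phiMinus a F) := by
  by_contra! hneg
  obtain ⟨δ, hδ, hfreq⟩ := hF.exists_attracted hT hF.isInvariantGraph_phiMinus hneg
  obtain ⟨θ, hθ, he⟩ := (hfreq.and_eventually h).exists
  let y := min (phiMinus a F θ + δ) (phiPlus a F θ)
  have hy1 : phiMinus a F θ < y := lt_min (by linarith) (hlt θ)
  have hy2 : y ≤ phiMinus a F θ + δ := min_le_left _ _
  have h1 := hθ y (by rw [abs_le]; constructor <;> linarith)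
  have := le_csSup (bddAbove_basin (a := a) (F := F) θ) ⟨hy1.le, min_le_right _ _, h1⟩
  exact absurd he (hy1.trans_le this).ne'

/-- The trichotomy for the three invariant graphs, and the description of the points above `φ*`. -/
theorem IsBakerDrivenSystem.trichotomy (hF : IsBakerDrivenSystem a F iL iU jL jU)
    (hA : filledClosure (phiPlus a F) ∩ filledClosure (phiMinus a F) = ∅)
    (hν : Ergodic (baker a) ν) :
    (∀ᵐ θ ∂ν, ∀ y, phiStar a F θ < y → y ≤ phiPlus a F θ →
      Tendsto (fun n : ℕ => |((skew a F)^[n] (θ, y)).2 - phiPlus a F ((baker a)^[n] θ)|)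
        atTop (𝓝 0)) ∧
    (((∀ᵐ θ ∂ν, phiMinus a F θ < phiStar a F θ ∧ phiStar a F θ < phiPlus a F θ) ∧
        graphExponent F ν (phiMinus a F) < 0 ∧ graphExponent F ν (phiPlus a F) < 0 ∧
        0 < graphExponent F ν (phiStar a F)) ∨
      ((∀ᵐ θ ∂ν, phiStar a F θ = phiPlus a F θ) ∧ graphExponent F ν (phiMinus a F) < 0 ∧
        graphExponent F ν (phiPlus a F) = 0) ∨
      ((∀ᵐ θ ∂ν, phiStar a F θ = phiMinus a F θ) ∧ graphExponent F ν (phiPlus a F) < 0 ∧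
        graphExponent F ν (phiMinus a F) = 0)) := by
  have hT := hν.toMeasurePreserving
  obtain ⟨ε, hε, hgap⟩ := hF.exists_gap hA
  have hlt : ∀ θ, phiMinus a F θ < phiPlus a F θ := fun θ => by linarith [hgap θ]
  have hR := hF.reflect
  -- The counterpart of `φ*` for the other graph: the lower edge of the basin of `φ⁺`, obtained by
  -- reflection.
  let S : UnitAddCircle × UnitAddCircle → ℝ := fun θ => -phiStar a (reflectFibre F) θ
  have hM := hF.isInvariantGraph_phiMinus.mono hF
  have hP := hF.isInvariantGraph_phiPlus.mono hF
  have hSt := hF.isInvariantGraph_phiStar.mono hF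
  have hS : IsInvariantGraph a F jL jU S := by
    refine ⟨hR.measurable_phiStar.neg, fun θ => ?_, fun θ => ?_⟩
    · have h := hR.phiStar_mem θ
      exact hF.subset ⟨by linarith [h.2], by linarith [h.1]⟩
    · simp only [S, hR.phiStar_baker]; simp [reflectFibre]
  have hSlo : ∀ θ, phiMinus a F θ ≤ S θ := fun θ => by
    have := hR.phiStar_le_phiPlus θ
    rw [phiPlus_reflect] at this
    simp only [S]; linarith
  have hShi : ∀ θ, S θ ≤ phiPlus a F θ := fun θ => by
    have := hR.phiMinus_le_phiStar θ
    rw [phiMinus_reflect] at this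
    simp only [S]; linarith
  have hbasin : ∀ θ y, S θ < y → y ≤ phiPlus a F θ →
      Tendsto (fun n : ℕ => |((skew a F)^[n] (θ, y)).2 - phiPlus a F ((baker a)^[n] θ)|)
        atTop (𝓝 0) := by
    intro θ y h1 h2
    have := hR.tendsto_of_lt_phiStar (θ := θ) (y := -y) (by rw [phiMinus_reflect]; linarith)
      (by simp only [S] at h1; linarith)
    refine this.congr fun n => ?_
    rw [skew_reflect_iterate_snd, phiMinus_reflect, neg_neg, ← abs_neg]
    congr 1; ring
  -- A point between `S` and `φ*` would be asymptotic to both bounding graphs, which keep a uniform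
  -- distance `ε`.
  have hle : ∀ θ, phiStar a F θ ≤ S θ := by
    intro θ
    by_contra! h
    obtain ⟨y, hy1, hy2⟩ := exists_between h
    have h1 := hF.tendsto_of_lt_phiStar ((hSlo θ).trans hy1.le) hy2
    have h2 := (hbasin θ y hy1 (hy2.le.trans (hF.phiStar_le_phiPlus θ))).add h1
    rw [add_zero] at h2
    obtain ⟨n, hn⟩ := (h2.eventually (gt_mem_nhds hε)).exists
    have h3 := hgap ((baker a)^[n] θ)
    have h4 := neg_abs_le (((skew a F)^[n] (θ, y)).2 - phiPlus a F ((baker a)^[n] θ))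
    have h5 := le_abs_self (((skew a F)^[n] (θ, y)).2 - phiMinus a F ((baker a)^[n] θ))
    linarith
  have hsum := hF.exponents_of_two hT hM hP (ae_of_all _ hlt)
  have hminus : (∀ᵐ θ ∂ν, phiStar a F θ = phiMinus a F θ) → 0 ≤ graphExponent F ν (phiMinus a F) :=
    hF.graphExponent_phiMinus_nonneg hT hlt
  have hSplus : (∀ᵐ θ ∂ν, S θ = phiPlus a F θ) → 0 ≤ graphExponent F ν (phiPlus a F) := by
    intro h
    have := hR.graphExponent_phiMinus_nonneg hT (ν := ν) (fun θ => by
      rw [phiMinus_reflect, phiPlus_reflect]; exact neg_lt_neg (hlt θ)) (h.mono fun θ hθ => by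
        rw [phiMinus_reflect, ← hθ, neg_neg])
    rw [graphExponent_reflect] at this
    simpa only [phiMinus_reflect, neg_neg] using this
  have d1 := hF.ae_eq_or_ae_lt hν hM hSt hF.phiMinus_le_phiStar
  have d2 := hF.ae_eq_or_ae_lt hν hS hP hShi
  -- If `φ* < S`, every pattern of coincidences with the outer graphs is contradictory. A
  -- coincidence forces a non-negative exponent on an outer graph, against `exponents_of_two` or
  -- `exponents_of_three`. With no coincidence, `φ*` has positive exponent as the middle of `φ⁻, φ*,
  -- S` and negative exponent as the lowest of `φ*, S, φ⁺`.
  have heq : ∀ᵐ θ ∂ν, phiStar a F θ = S θ := by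
    rcases hF.ae_eq_or_ae_lt hν hSt hS hle with h | h
    · exact h
    exfalso
    rcases d1 with e1 | e1 <;> rcases d2 with e2 | e2
    · have := hminus (e1.mono fun θ hθ => hθ.symm)
      have := hSplus e2
      linarith
    · have h1 := hminus (e1.mono fun θ hθ => hθ.symm)
      have := (hF.exponents_of_three hT hM hS hP (by
        filter_upwards [e1, h] with θ h1 h2; rwa [h1]) e2).1
      linarith
    · have h1 := hSplus e2
      have := (hF.exponents_of_three hT hM hSt hP e1 (by
        filter_upwards [e2, h] with θ h1 h2; rwa [← h1])).2.2
      linarith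
    · have h1 := (hF.exponents_of_three hT hM hSt hS e1 h).2.1
      have h2 := (hF.exponents_of_three hT hSt hS hP h e2).1
      linarith
  refine ⟨?_, ?_⟩
  · filter_upwards [heq] with θ hθ y hy
    rw [hθ] at hy
    exact hbasin θ y hy
  · rcases d1 with e1 | e1
    · right; right
      have e1' := e1.mono fun θ hθ => hθ.symm
      have h1 := hminus e1'
      exact ⟨e1', by linarith, le_antisymm (hF.graphExponent_phiMinus_nonpos hT) h1⟩
    · rcases d2 with e2 | e2
      · right; left
        have h1 := hSplus e2
        refine ⟨?_, by linarith, le_antisymm (hF.graphExponent_phiPlus_nonpos hT) h1⟩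
        filter_upwards [heq, e2] with θ h2 h3 using h2.trans h3
      · left
        have e3 : ∀ᵐ θ ∂ν, phiStar a F θ < phiPlus a F θ := by
          filter_upwards [heq, e2] with θ h2 h3; rwa [h2]
        obtain ⟨h1, h2, h3⟩ := hF.exponents_of_three hT hM hSt hP e1 e3
        exact ⟨e1.and e3, h1, h3, h2⟩

/-! ### Invariant lifts -/

end Trichotomy

section Lifts

variable {a : ℝ} {F : UnitAddCircle → ℝ → ℝ} {iL iU jL jU : ℝ}
  {ν : Measure (UnitAddCircle × UnitAddCircle)}

theorem IsBakerDrivenSystem.le_phiPlus_of_mem (hF : IsBakerDrivenSystem a F iL iU jL jU)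
    {θ : UnitAddCircle × UnitAddCircle} {y : ℝ} (h : (θ, y) ∈ globalAttractor a F) :
    y ≤ phiPlus a F θ := by
  obtain ⟨M, hM⟩ := hF.bounded
  refine le_csSup ⟨M, fun z hz => ?_⟩ h
  obtain ⟨z', rfl⟩ := (mem_globalAttractor_iff hF.a_pos hF.a_lt_one θ z).1 hz 1
  exact (abs_le.1 (hM _ _)).2

theorem IsBakerDrivenSystem.phiMinus_le_of_mem (hF : IsBakerDrivenSystem a F iL iU jL jU)
    {θ : UnitAddCircle × UnitAddCircle} {y : ℝ} (h : (θ, y) ∈ globalAttractor a F) :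
    phiMinus a F θ ≤ y := by
  have := hF.reflect.le_phiPlus_of_mem (θ := θ) (y := -y)
    ((mem_globalAttractor_reflect θ _).2 (by rwa [neg_neg]))
  rw [phiPlus_reflect] at this
  linarith

/-- After `n + 1` steps every orbit lies in the measurable strip `S n` between the pullbacks of `-M`
and `M`. The complement of the strip has empty preimage, hence no mass for an invariant measure. -/
theorem IsBakerDrivenSystem.ae_mem_globalAttractor (hF : IsBakerDrivenSystem a F iL iU jL jU)
    {μ : Measure ((UnitAddCircle × UnitAddCircle) × ℝ)} (hμ : MeasurePreserving (skew a F) μ μ) :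
    ∀ᵐ p ∂μ, p ∈ globalAttractor a F := by
  obtain ⟨M, hM⟩ := hF.bounded
  have h0 := hF.a_pos
  have h1 := hF.a_lt_one
  let S : ℕ → Set ((UnitAddCircle × UnitAddCircle) × ℝ) := fun n =>
    {p | pullback a F n p.1.2 (-M) ≤ p.2 ∧ p.2 ≤ pullback a F n p.1.2 M}
  have hSm : ∀ n, MeasurableSet (S n) := fun n => by
    have hc : ∀ c : ℝ, Measurable fun p : (UnitAddCircle × UnitAddCircle) × ℝ =>
        pullback a F n p.1.2 c := fun c => ((hF.continuous_pullback n).comp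
      ((continuous_snd.comp continuous_fst).prodMk continuous_const)).measurable
    exact (measurableSet_le (hc _) measurable_snd).inter (measurableSet_le measurable_snd (hc _))
  have hS : ∀ n, ∀ᵐ p ∂μ, p ∈ S n := by
    intro n
    have hpre : (skew a F)^[n + 1] ⁻¹' (S n)ᶜ = ∅ := by
      rw [Set.preimage_compl, Set.compl_empty_iff, Set.eq_univ_iff_forall]
      rintro ⟨θ, y⟩
      have e : ((skew a F)^[n + 1] (θ, y)).2 = pullback a F n ((baker a)^[n + 1] θ).2
          (F (tau a ((tau a)^[n] ((baker a)^[n + 1] θ).2)) y) := by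
        rw [skew_iterate_snd_eq_pullback h0 h1, pullback_add]; rfl
      have hb := abs_le.1 (hM (tau a ((tau a)^[n] ((baker a)^[n + 1] θ).2)) y)
      refine ⟨?_, ?_⟩
      · rw [e, skew_iterate_fst]; exact (hF.strictMono_pullback n _).monotone hb.1
      · rw [e, skew_iterate_fst]; exact (hF.strictMono_pullback n _).monotone hb.2
    rw [ae_iff]
    have := (hμ.iterate (n + 1)).measure_preimage (hSm n).compl.nullMeasurableSet
    rw [hpre, measure_empty] at this
    exact this.symm
  filter_upwards [ae_all_iff.2 hS] with p hp
  refine (mem_globalAttractor_iff h0 h1 p.1 p.2).2 fun n => ?_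
  have hMM : -M ≤ M := by
    have := (abs_nonneg _).trans (hM 0 0); linarith
  obtain ⟨z, -, hz⟩ := intermediate_value_Icc hMM
    ((hF.continuous_pullback n).comp (Continuous.prodMk_right p.1.2)).continuousOn (hp n)
  exact ⟨z, hz⟩

/-- Poincaré recurrence: almost every point with `h > 1 / (k + 1)` returns to this set infinitely
often. -/
theorem ae_not_of_tendsto_zero {Ω : Type*} [MeasurableSpace Ω] {μ : Measure Ω} [IsFiniteMeasure μ]
    {T : Ω → Ω} (hT : MeasurePreserving T μ μ) {h : Ω → ℝ} (hm : Measurable h) :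
    ∀ᵐ p ∂μ, Tendsto (fun n => h (T^[n] p)) atTop (𝓝 0) → h p ≤ 0 := by
  have key : ∀ k : ℕ, ∀ᵐ p ∂μ, p ∈ {p | 1 / ((k : ℝ) + 1) < h p} →
      ∃ᶠ n in atTop, T^[n] p ∈ {p | 1 / ((k : ℝ) + 1) < h p} := fun k =>
    hT.conservative.ae_mem_imp_frequently_image_mem
      (measurableSet_lt measurable_const hm).nullMeasurableSet
  filter_upwards [ae_all_iff.2 key] with p hp hlim
  by_contra! hpos
  obtain ⟨k, hk⟩ := exists_nat_one_div_lt hpos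
  refine hp k hk ?_
  filter_upwards [hlim.eventually (gt_mem_nhds (show (0 : ℝ) < 1 / ((k : ℝ) + 1) by positivity))]
    with n hn h'
  exact absurd hn (not_lt.2 (le_of_lt h'))

/-- Invariant measures over `ν` are carried by the three graphs `φ⁻`, `φ*`, `φ⁺`. -/
theorem IsBakerDrivenSystem.ae_mem_graphs (hF : IsBakerDrivenSystem a F iL iU jL jU)
    [IsFiniteMeasure ν] {μ : Measure ((UnitAddCircle × UnitAddCircle) × ℝ)}
    (hup : ∀ᵐ θ ∂ν, ∀ y, phiStar a F θ < y → y ≤ phiPlus a F θ →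
      Tendsto (fun n : ℕ => |((skew a F)^[n] (θ, y)).2 - phiPlus a F ((baker a)^[n] θ)|)
        atTop (𝓝 0)) (hμ : IsInvariantLift a F ν μ) :
    ∀ᵐ p ∂μ, p.2 = phiMinus a F p.1 ∨ p.2 = phiStar a F p.1 ∨ p.2 = phiPlus a F p.1 := by
  have : IsFiniteMeasure μ := by
    constructor
    have h1 : μ Set.univ = ν Set.univ := by
      rw [← hμ.2, Measure.map_apply measurable_fst MeasurableSet.univ, Set.preimage_univ]
    rw [h1]; exact measure_lt_top _ _
  have hup' : ∀ᵐ p ∂μ, ∀ y, phiStar a F p.1 < y → y ≤ phiPlus a F p.1 →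
      Tendsto (fun n : ℕ => |((skew a F)^[n] (p.1, y)).2 - phiPlus a F ((baker a)^[n] p.1)|)
        atTop (𝓝 0) := by
    rw [← hμ.2] at hup
    exact ae_of_ae_map measurable_fst.aemeasurable hup
  have h1 := ae_not_of_tendsto_zero hμ.1 (h := fun p => |p.2 - phiMinus a F p.1|)
    (continuous_abs.measurable.comp (measurable_snd.sub (hF.measurable_phiMinus.comp measurable_fst)))
  have h2 := ae_not_of_tendsto_zero hμ.1 (h := fun p => |p.2 - phiPlus a F p.1|)
    (continuous_abs.measurable.comp (measurable_snd.sub (hF.measurable_phiPlus.comp measurable_fst)))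
  simp only [skew_iterate_fst] at h1 h2
  filter_upwards [hF.ae_mem_globalAttractor hμ.1, hup', h1, h2] with p hp hup h1 h2
  have hlo := hF.phiMinus_le_of_mem hp
  have hhi := hF.le_phiPlus_of_mem hp
  rcases lt_trichotomy p.2 (phiStar a F p.1) with h | h | h
  · left
    have := h1 (hF.tendsto_of_lt_phiStar hlo h)
    exact sub_eq_zero.1 (abs_eq_zero.1 (le_antisymm this (abs_nonneg _)))
  · exact Or.inr (Or.inl h)
  · right; right
    have := h2 (hup p.2 h hhi)
    exact sub_eq_zero.1 (abs_eq_zero.1 (le_antisymm this (abs_nonneg _)))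

theorem eq_graphMeasure {φ : UnitAddCircle × UnitAddCircle → ℝ} (hφ : Measurable φ)
    {μ : Measure ((UnitAddCircle × UnitAddCircle) × ℝ)} (hμ : μ.map Prod.fst = ν)
    (h : ∀ᵐ p ∂μ, p.2 = φ p.1) : μ = graphMeasure ν φ := by
  have hg : Measurable fun θ : UnitAddCircle × UnitAddCircle => (θ, φ θ) := measurable_id.prodMk hφ
  rw [graphMeasure, ← hμ, Measure.map_map hg measurable_fst]
  conv_lhs => rw [← Measure.map_id (μ := μ)]
  refine Measure.map_congr ?_
  filter_upwards [h] with p hp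
  exact Prod.ext rfl hp

theorem IsInvariantGraph.isInvariantLift {φ : UnitAddCircle × UnitAddCircle → ℝ}
    (hφ : IsInvariantGraph a F jL jU φ) (hF : IsBakerDrivenSystem a F iL iU jL jU)
    (hT : MeasurePreserving (_root_.baker a) ν ν) : IsInvariantLift a F ν (graphMeasure ν φ) := by
  have hg : Measurable fun θ : UnitAddCircle × UnitAddCircle => (θ, φ θ) :=
    measurable_id.prodMk hφ.measurable
  have hsk := measurable_skew hF
  refine ⟨⟨hsk, ?_⟩, ?_⟩
  · unfold graphMeasure
    rw [Measure.map_map hsk hg]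
    have : skew a F ∘ (fun θ => (θ, φ θ)) = (fun θ => (θ, φ θ)) ∘ _root_.baker a := by
      funext θ
      simp only [Function.comp_apply, skew, hφ.baker]
    rw [this, ← Measure.map_map hg hT.measurable, hT.map_eq]
  · unfold graphMeasure
    rw [Measure.map_map measurable_fst hg]
    exact Measure.map_id

theorem ae_graphMeasure_iff {φ : UnitAddCircle × UnitAddCircle → ℝ} (hφ : Measurable φ)
    {S : Set ((UnitAddCircle × UnitAddCircle) × ℝ)} (hS : MeasurableSet S) :
    graphMeasure ν φ Sᶜ = 0 ↔ ∀ᵐ θ ∂ν, (θ, φ θ) ∈ S := by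
  have hg : Measurable fun θ : UnitAddCircle × UnitAddCircle => (θ, φ θ) := measurable_id.prodMk hφ
  rw [graphMeasure, Measure.map_apply hg hS.compl]
  rfl

end Lifts

/-! ### The strong stable direction field -/

section DirectionField

variable {a : ℝ} {F : UnitAddCircle → ℝ → ℝ} {iL iU jL jU : ℝ}

theorem skewI_eq (ξ x y : ℝ) : skewI a F (ξ, x, y) = ((ξ - branchOffset a ξ) / sigmaRate a ξ,
    sigmaRate a ξ * x + branchOffset a ξ, F (x : UnitAddCircle) y) := by
  unfold skewI sigmaRate branchOffset
  split_ifs <;> simp [add_comm]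

/-- The domain `ℝ × [0, 1] × J` of the strong stable direction field. -/
def fibreDomain (jL jU : ℝ) : Set (ℝ × ℝ × ℝ) :=
  {p | p.2.1 ∈ Set.Icc (0 : ℝ) 1 ∧ p.2.2 ∈ Set.Icc jL jU}

theorem IsBakerDrivenSystem.skewI_mem (hF : IsBakerDrivenSystem a F iL iU jL jU)
    {p : ℝ × ℝ × ℝ} (hp : p ∈ fibreDomain jL jU) : skewI a F p ∈ fibreDomain jL jU := by
  obtain ⟨ξ, x, y⟩ := p
  rw [skewI_eq]
  exact ⟨branch_mem_Icc hF.a_pos hF.a_lt_one ξ hp.1, hF.mapsTo_J _ hp.2⟩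

theorem IsBakerDrivenSystem.skewI_iterate_mem (hF : IsBakerDrivenSystem a F iL iU jL jU)
    {p : ℝ × ℝ × ℝ} (hp : p ∈ fibreDomain jL jU) (n : ℕ) :
    (skewI a F)^[n] p ∈ fibreDomain jL jU := by
  induction n with
  | zero => exact hp
  | succ n ih => rw [Function.iterate_succ_apply']; exact hF.skewI_mem ih

theorem IsBakerDrivenSystem.gammaRatio_pos (hF : IsBakerDrivenSystem a F iL iU jL jU)
    (p : ℝ × ℝ × ℝ) : 0 < gammaRatio a F p :=
  div_pos (sigmaRate_pos hF.a_pos hF.a_lt_one _) (hF.deriv_pos _ _)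

/-- Partial hyperbolicity says that the contraction along `x` beats any contraction in the fibre by
a uniform factor. This makes the series for `X3` geometric. -/
theorem IsBakerDrivenSystem.exists_gammaRatio_le (hF : IsBakerDrivenSystem a F iL iU jL jU) :
    ∃ r : ℝ, 0 < r ∧ r < 1 ∧ ∀ p ∈ fibreDomain jL jU, gammaRatio a F p ≤ r := by
  obtain ⟨c, hc, h⟩ := hF.exists_hyperbolic
  refine ⟨c⁻¹, by positivity, inv_lt_one_of_one_lt₀ hc, fun p hp => ?_⟩
  unfold gammaRatio
  rw [div_le_iff₀ (hF.deriv_pos _ _), ← div_eq_inv_mul, le_div_iff₀ (by linarith)]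
  have := h p.1 (p.2.1 : UnitAddCircle) p.2.2 hp.2
  linarith

theorem IsBakerDrivenSystem.exists_slopeTerm_le (hF : IsBakerDrivenSystem a F iL iU jL jU) :
    ∃ C : ℝ, 0 ≤ C ∧ ∀ p ∈ fibreDomain jL jU, |slopeTerm F p| ≤ C := by
  obtain ⟨m, L, hm, hL, hb⟩ := hF.deriv_bounds
  obtain ⟨C, hC0, hC⟩ := hF.deriv_base_bound
  refine ⟨C / m, by positivity, fun p hp => ?_⟩
  unfold slopeTerm
  rw [abs_div, abs_of_pos (hF.deriv_pos _ _)]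
  exact div_le_div₀ hC0 (hC _ hp.1 _ hp.2) hm (hb _ _ hp.2).1

/-- The terms of the series that defines `X₃`. -/
noncomputable def slopeSeries (a : ℝ) (F : UnitAddCircle → ℝ → ℝ) (p : ℝ × ℝ × ℝ) (k : ℕ) : ℝ :=
  (∏ j ∈ Finset.range k, gammaRatio a F ((skewI a F)^[j] p)) * slopeTerm F ((skewI a F)^[k] p)

theorem X3_eq (ξ x y : ℝ) : X3 a F ξ x y = -∑' k, slopeSeries a F (ξ, x, y) k := rfl

theorem slopeSeries_succ (p : ℝ × ℝ × ℝ) (k : ℕ) :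
    slopeSeries a F p (k + 1) = gammaRatio a F p * slopeSeries a F (skewI a F p) k := by
  unfold slopeSeries
  rw [Finset.prod_range_succ']
  simp only [Function.iterate_succ_apply, Function.iterate_zero, id]
  ring

theorem IsBakerDrivenSystem.summable_slopeSeries (hF : IsBakerDrivenSystem a F iL iU jL jU) :
    ∃ C : ℝ, 0 ≤ C ∧ ∀ p ∈ fibreDomain jL jU, Summable (slopeSeries a F p) ∧
      |∑' k, slopeSeries a F p k| ≤ C := by
  obtain ⟨r, hr0, hr1, hr⟩ := hF.exists_gammaRatio_le
  obtain ⟨C, hC0, hC⟩ := hF.exists_slopeTerm_le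
  have hg : Summable fun k : ℕ => r ^ k * C := (summable_geometric_of_lt_one hr0.le hr1).mul_right C
  refine ⟨∑' k : ℕ, r ^ k * C, tsum_nonneg fun k => by positivity, fun p hp => ?_⟩
  have hb : ∀ k, ‖slopeSeries a F p k‖ ≤ r ^ k * C := fun k => by
    rw [slopeSeries, Real.norm_eq_abs, abs_mul]
    refine mul_le_mul ?_ (hC _ (hF.skewI_iterate_mem hp k)) (abs_nonneg _) (by positivity)
    rw [Finset.abs_prod]
    calc _ ≤ ∏ j ∈ Finset.range k, r := Finset.prod_le_prod (fun _ _ => abs_nonneg _) fun j _ => by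
          rw [abs_of_pos (hF.gammaRatio_pos _)]; exact hr _ (hF.skewI_iterate_mem hp j)
      _ = r ^ k := by simp
  have hs : Summable fun k => ‖slopeSeries a F p k‖ :=
    Summable.of_nonneg_of_le (fun _ => norm_nonneg _) hb hg
  exact ⟨hs.of_norm, (norm_tsum_le_tsum_norm hs).trans (hs.tsum_le_tsum hb hg)⟩

/-- Invariance of the strong stable direction field. -/
theorem IsBakerDrivenSystem.X3_invariance (hF : IsBakerDrivenSystem a F iL iU jL jU) (ξ : ℝ)
    {x y : ℝ} (hx : x ∈ Set.Icc (0 : ℝ) 1) (hy : y ∈ Set.Icc jL jU) :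
    X3 a F ξ x y = -slopeTerm F (ξ, x, y) + gammaRatio a F (ξ, x, y) *
      X3 a F ((ξ - branchOffset a ξ) / sigmaRate a ξ) (sigmaRate a ξ * x + branchOffset a ξ)
        (F (x : UnitAddCircle) y) := by
  obtain ⟨C, -, hC⟩ := hF.summable_slopeSeries
  have hp : (ξ, x, y) ∈ fibreDomain jL jU := ⟨hx, hy⟩
  rw [X3_eq, X3_eq, ← skewI_eq, (hC _ hp).1.tsum_eq_zero_add]
  simp only [slopeSeries_succ, tsum_mul_left]
  simp [slopeSeries]
  ring

/-- Successive approximations of `X₃`. -/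
noncomputable def slopeApprox (a : ℝ) (F : UnitAddCircle → ℝ → ℝ) : ℕ → ℝ → ℝ → ℝ → ℝ
  | 0, _, _, _ => 0
  | n + 1, ξ, x, y => -slopeTerm F (ξ, x, y) + gammaRatio a F (ξ, x, y) *
      slopeApprox a F n ((ξ - branchOffset a ξ) / sigmaRate a ξ)
        (sigmaRate a ξ * x + branchOffset a ξ) (F (x : UnitAddCircle) y)

/-- `X3` is a fixed point of the recursion that defines `slopeApprox`, and each step multiplies the
error by a factor at most `r`. The initial error is `X3` itself, since the zeroth approximation
vanishes. -/
theorem IsBakerDrivenSystem.exists_slopeApprox_sub_le (hF : IsBakerDrivenSystem a F iL iU jL jU) :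
    ∃ C r : ℝ, 0 ≤ C ∧ 0 < r ∧ r < 1 ∧ (∀ ξ, ∀ x ∈ Set.Icc (0 : ℝ) 1, ∀ y ∈ Set.Icc jL jU,
      |X3 a F ξ x y| ≤ C) ∧ ∀ n ξ, ∀ x ∈ Set.Icc (0 : ℝ) 1, ∀ y ∈ Set.Icc jL jU,
        |X3 a F ξ x y - slopeApprox a F n ξ x y| ≤ C * r ^ n := by
  obtain ⟨C, hC0, hC⟩ := hF.summable_slopeSeries
  obtain ⟨r, hr0, hr1, hr⟩ := hF.exists_gammaRatio_le
  have hX : ∀ ξ, ∀ x ∈ Set.Icc (0 : ℝ) 1, ∀ y ∈ Set.Icc jL jU, |X3 a F ξ x y| ≤ C :=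
    fun ξ x hx y hy => by rw [X3_eq, abs_neg]; exact (hC (ξ, x, y) ⟨hx, hy⟩).2
  refine ⟨C, r, hC0, hr0, hr1, hX, fun n => ?_⟩
  induction n with
  | zero => intro ξ x hx y hy; simpa [slopeApprox] using hX ξ x hx y hy
  | succ n ih =>
    intro ξ x hx y hy
    rw [hF.X3_invariance ξ hx hy, slopeApprox, add_sub_add_left_eq_sub, ← mul_sub, abs_mul,
      abs_of_pos (hF.gammaRatio_pos _)]
    have h1 := ih ((ξ - branchOffset a ξ) / sigmaRate a ξ) _
      (branch_mem_Icc hF.a_pos hF.a_lt_one ξ hx) _ (hF.mapsTo_J (x : UnitAddCircle) hy)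
    calc _ ≤ r * (C * r ^ n) := mul_le_mul (hr _ ⟨hx, hy⟩) h1 (abs_nonneg _) hr0.le
      _ = _ := by ring

theorem IsBakerDrivenSystem.continuousOn_X3 (hF : IsBakerDrivenSystem a F iL iU jL jU) (ξ : ℝ) :
    ContinuousOn (fun q : ℝ × ℝ => X3 a F ξ q.1 q.2) (Set.Icc (0 : ℝ) 1 ×ˢ Set.Icc jL jU) := by
  obtain ⟨C, r, hC0, hr0, hr1, -, hC⟩ := hF.exists_slopeApprox_sub_le
  have hsub : Set.Icc (0 : ℝ) 1 ×ˢ Set.Icc jL jU ⊆ Set.univ ×ˢ Set.Icc jL jU :=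
    Set.prod_mono (Set.subset_univ _) subset_rfl
  have hD := hF.contDiffOn_deriv_fibre.continuousOn.mono hsub
  have hB := hF.contDiffOn_deriv_base.continuousOn.mono hsub
  have hne : ∀ q ∈ Set.Icc (0 : ℝ) 1 ×ˢ Set.Icc jL jU,
      deriv (F (q.1 : UnitAddCircle)) q.2 ≠ 0 := fun q _ => (hF.deriv_pos _ _).ne'
  have hA : ∀ n ξ, ContinuousOn (fun q : ℝ × ℝ => slopeApprox a F n ξ q.1 q.2)
      (Set.Icc (0 : ℝ) 1 ×ˢ Set.Icc jL jU) := by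
    intro n
    induction n with
    | zero => intro ξ; exact continuousOn_const
    | succ n ih =>
      intro ξ
      have h1 : ContinuousOn (fun q : ℝ × ℝ => slopeTerm F (ξ, q.1, q.2))
          (Set.Icc (0 : ℝ) 1 ×ˢ Set.Icc jL jU) := hB.div hD hne
      have h2 : ContinuousOn (fun q : ℝ × ℝ => gammaRatio a F (ξ, q.1, q.2))
          (Set.Icc (0 : ℝ) 1 ×ˢ Set.Icc jL jU) :=
        (continuousOn_const (c := sigmaRate a ξ)).div hD hne
      refine h1.neg.add (h2.mul ?_)
      have hm : ContinuousOn (fun q : ℝ × ℝ => (sigmaRate a ξ * q.1 + branchOffset a ξ,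
          F (q.1 : UnitAddCircle) q.2)) (Set.Icc (0 : ℝ) 1 ×ˢ Set.Icc jL jU) := by
        refine ContinuousOn.prodMk (by fun_prop) ?_
        exact (hF.continuous.comp ((continuous_coe_circle.comp continuous_fst).prodMk
          continuous_snd)).continuousOn
      exact (ih _).comp hm fun q hq =>
        ⟨branch_mem_Icc hF.a_pos hF.a_lt_one ξ hq.1, hF.mapsTo_J _ hq.2⟩
  refine TendstoUniformlyOn.continuousOn (F := fun n (q : ℝ × ℝ) => slopeApprox a F n ξ q.1 q.2)
    (p := atTop) ?_ (Frequently.of_forall fun n => hA n ξ)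
  rw [Metric.tendstoUniformlyOn_iff]
  intro ε hε
  have hlim : Tendsto (fun n => C * r ^ n) atTop (𝓝 0) := by
    simpa using (tendsto_pow_atTop_nhds_zero_of_lt_one hr0.le hr1).const_mul C
  filter_upwards [hlim.eventually (gt_mem_nhds hε)] with n hn q hq
  exact (hC n ξ q.1 hq.1 q.2 hq.2).trans_lt hn

/-- In the recursion a Lipschitz constant in `y` is multiplied by `Γ` times the local expansion of
`f_x`. For nearby points this product is close to `Γ f_x' = σ ≤ s < 1`, so a Lipschitz constant
survives all steps. For distant points boundedness of the approximations suffices. -/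
theorem IsBakerDrivenSystem.exists_lipschitz_X3 (hF : IsBakerDrivenSystem a F iL iU jL jU) :
    ∃ Λ : ℝ, 0 ≤ Λ ∧ ∀ ξ, ∀ x ∈ Set.Icc (0 : ℝ) 1, ∀ y ∈ Set.Icc jL jU, ∀ y' ∈ Set.Icc jL jU,
      |X3 a F ξ x y - X3 a F ξ x y'| ≤ Λ * |y - y'| := by
  obtain ⟨C, r, hC0, hr0, hr1, hX, hC⟩ := hF.exists_slopeApprox_sub_le
  obtain ⟨m, L, hm, hL, hb⟩ := hF.deriv_bounds
  obtain ⟨K, hK0, hK⟩ := hF.deriv_fibre_lipschitz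
  obtain ⟨K', hK0', hK'⟩ := hF.deriv_base_lipschitz
  obtain ⟨B, hB0, hB⟩ := hF.deriv_base_bound
  set s := max a (1 - a) with hs
  have hs0 : 0 < s := max_rate_pos hF.a_pos
  have hs1 : s < 1 := max_rate_lt_one hF.a_pos hF.a_lt_one
  obtain ⟨ρ, hsρ, hρ1⟩ := exists_between hs1
  -- At distance at most `ε` the derivative varies at most by the factor `1 + K * ε / m`, which
  -- keeps the multiplier below `ρ`.
  obtain ⟨ε, hε0, hε⟩ : ∃ ε : ℝ, 0 < ε ∧ s * (1 + K * ε / m) ≤ ρ := by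
    refine ⟨(ρ - s) * m / (s * (K + 1)), by
      have := sub_pos.2 hsρ; positivity, ?_⟩
    have e : s * (1 + K * ((ρ - s) * m / (s * (K + 1))) / m) = s + (ρ - s) * (K / (K + 1)) := by
      field_simp
    rw [e]
    have : K / (K + 1) ≤ 1 := by rw [div_le_one (by positivity)]; linarith
    nlinarith
  -- `C₁` collects the Lipschitz constant of `slopeTerm` and that of `gammaRatio` times the bound `2
  -- * C` on the approximations. `Λ` then satisfies `C₁ + ρ * Λ ≤ Λ`, which closes the induction,
  -- and `4 * C ≤ Λ * ε`, which covers distances above `ε`.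
  obtain ⟨C₁, hC₁⟩ : ∃ C₁, C₁ = K' / m + B * K / m ^ 2 + s * K / m ^ 2 * (2 * C) := ⟨_, rfl⟩
  have hC₁0 : 0 ≤ C₁ := by rw [hC₁]; positivity
  obtain ⟨Λ, hΛ⟩ : ∃ Λ, Λ = max (C₁ / (1 - ρ)) (4 * C / ε) := ⟨_, rfl⟩
  have hρ0 : 0 < 1 - ρ := by linarith
  have hΛ0 : 0 ≤ Λ := by rw [hΛ]; exact le_max_of_le_left (by positivity)
  have hΛ1 : C₁ + ρ * Λ ≤ Λ := by
    have : C₁ / (1 - ρ) ≤ Λ := by rw [hΛ]; exact le_max_left _ _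
    rw [div_le_iff₀ hρ0] at this
    linarith
  have hΛ2 : 4 * C ≤ Λ * ε := by
    have : 4 * C / ε ≤ Λ := by rw [hΛ]; exact le_max_right _ _
    rwa [div_le_iff₀ hε0] at this
  have hbd : ∀ n ξ, ∀ x ∈ Set.Icc (0 : ℝ) 1, ∀ y ∈ Set.Icc jL jU,
      |slopeApprox a F n ξ x y| ≤ 2 * C := fun n ξ x hx y hy => by
    have h1 := hC n ξ x hx y hy
    have h2 := hX ξ x hx y hy
    have h3 : C * r ^ n ≤ C := mul_le_of_le_one_right hC0 (pow_le_one₀ hr0.le hr1.le)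
    rw [abs_le] at *
    constructor <;> linarith
  have hA : ∀ n ξ, ∀ x ∈ Set.Icc (0 : ℝ) 1, ∀ y ∈ Set.Icc jL jU, ∀ y' ∈ Set.Icc jL jU,
      |slopeApprox a F n ξ x y - slopeApprox a F n ξ x y'| ≤ Λ * |y - y'| := by
    intro n
    induction n with
    | zero => intro ξ x _ y _ y' _; simp only [slopeApprox, sub_self, abs_zero]; positivity
    | succ n ih =>
      intro ξ x hx y hy y' hy'
      rcases le_or_gt |y - y'| ε with hd | hd
      · have hx' := branch_mem_Icc hF.a_pos hF.a_lt_one ξ hx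
        have hFy := hF.mapsTo_J (x : UnitAddCircle) hy
        have hFy' := hF.mapsTo_J (x : UnitAddCircle) hy'
        have hσ0 := sigmaRate_pos hF.a_pos hF.a_lt_one ξ
        have hσ1 : sigmaRate a ξ ≤ s := sigmaRate_le ξ
        have hdy := hF.deriv_pos (x : UnitAddCircle) y
        have hdy' := hF.deriv_pos (x : UnitAddCircle) y'
        have hmy := (hb (x : UnitAddCircle) y hy).1
        have hmy' := (hb (x : UnitAddCircle) y' hy').1
        have hKy := hK (x : UnitAddCircle) y hy y' hy'
        have h1 : |slopeTerm F (ξ, x, y) - slopeTerm F (ξ, x, y')| ≤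
            (K' / m + B * K / m ^ 2) * |y - y'| := by
          have e : slopeTerm F (ξ, x, y) - slopeTerm F (ξ, x, y') =
              (deriv (fun u : ℝ => F (u : UnitAddCircle) y) x -
                deriv (fun u : ℝ => F (u : UnitAddCircle) y') x) / deriv (F (x : UnitAddCircle)) y +
              deriv (fun u : ℝ => F (u : UnitAddCircle) y') x *
                (deriv (F (x : UnitAddCircle)) y' - deriv (F (x : UnitAddCircle)) y) /
                (deriv (F (x : UnitAddCircle)) y * deriv (F (x : UnitAddCircle)) y') := by
            simp only [slopeTerm]
            field_simp
            ring
          rw [e, add_mul]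
          refine (abs_add_le _ _).trans (add_le_add ?_ ?_)
          · rw [abs_div, abs_of_pos hdy, div_mul_eq_mul_div]
            exact div_le_div₀ (by positivity) (hK' x hx y hy y' hy') hm hmy
          · rw [abs_div, abs_mul, abs_of_pos (mul_pos hdy hdy'), div_mul_eq_mul_div, mul_assoc]
            refine div_le_div₀ (by positivity) ?_ (by positivity) (by rw [sq]; gcongr)
            exact mul_le_mul (hB x hx y' hy') (by rwa [abs_sub_comm]) (abs_nonneg _) hB0
        have h2 : |gammaRatio a F (ξ, x, y) - gammaRatio a F (ξ, x, y')| ≤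
            s * K / m ^ 2 * |y - y'| := by
          have e : gammaRatio a F (ξ, x, y) - gammaRatio a F (ξ, x, y') = sigmaRate a ξ *
              (deriv (F (x : UnitAddCircle)) y' - deriv (F (x : UnitAddCircle)) y) /
                (deriv (F (x : UnitAddCircle)) y * deriv (F (x : UnitAddCircle)) y') := by
            simp only [gammaRatio]
            field_simp
          rw [e, abs_div, abs_mul, abs_of_pos (mul_pos hdy hdy'), abs_of_pos hσ0,
            div_mul_eq_mul_div, mul_assoc]
          refine div_le_div₀ (by positivity) ?_ (by positivity) (by rw [sq]; gcongr)
          exact mul_le_mul hσ1 (by rwa [abs_sub_comm]) (abs_nonneg _) hs0.le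
        have h3 : gammaRatio a F (ξ, x, y) * |F (x : UnitAddCircle) y - F (x : UnitAddCircle) y'| ≤
            ρ * |y - y'| := by
          have h4 : ∀ z ∈ Set.uIcc y y', deriv (F (x : UnitAddCircle)) z ≤
              deriv (F (x : UnitAddCircle)) y * (1 + K * ε / m) := by
            intro z hz
            have hzJ : z ∈ Set.Icc jL jU := Set.uIcc_subset_Icc hy hy' hz
            have h5 := (abs_le.1 (hK (x : UnitAddCircle) z hzJ y hy)).2
            have h6 : |z - y| ≤ ε := by
              have := Set.abs_sub_left_of_mem_uIcc hz
              rw [abs_sub_comm y' y] at this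
              exact this.trans hd
            have h7 : K * |z - y| ≤ K * ε := by gcongr
            have h8 : K * ε ≤ deriv (F (x : UnitAddCircle)) y * (K * ε / m) := by
              rw [mul_div_assoc', le_div_iff₀ hm, mul_comm]; gcongr
            linarith
          have h5 := hF.abs_sub_le_of_deriv_le (x : UnitAddCircle) h4
          calc _ ≤ gammaRatio a F (ξ, x, y) *
                (deriv (F (x : UnitAddCircle)) y * (1 + K * ε / m) * |y - y'|) :=
                mul_le_mul_of_nonneg_left h5 (hF.gammaRatio_pos _).le
            _ = sigmaRate a ξ * (1 + K * ε / m) * |y - y'| := by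
                simp only [gammaRatio]; field_simp
            _ ≤ s * (1 + K * ε / m) * |y - y'| := by gcongr
            _ ≤ _ := by gcongr
        simp only [slopeApprox]
        set ξ' := (ξ - branchOffset a ξ) / sigmaRate a ξ
        set x' := sigmaRate a ξ * x + branchOffset a ξ
        have h4 := ih ξ' x' hx' _ hFy _ hFy'
        have h5 := hbd n ξ' x' hx' _ hFy'
        have e : -slopeTerm F (ξ, x, y) + gammaRatio a F (ξ, x, y) *
              slopeApprox a F n ξ' x' (F (x : UnitAddCircle) y) -
            (-slopeTerm F (ξ, x, y') + gammaRatio a F (ξ, x, y') *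
              slopeApprox a F n ξ' x' (F (x : UnitAddCircle) y')) =
            -(slopeTerm F (ξ, x, y) - slopeTerm F (ξ, x, y')) +
            (gammaRatio a F (ξ, x, y) * (slopeApprox a F n ξ' x' (F (x : UnitAddCircle) y) -
              slopeApprox a F n ξ' x' (F (x : UnitAddCircle) y')) +
            (gammaRatio a F (ξ, x, y) - gammaRatio a F (ξ, x, y')) *
              slopeApprox a F n ξ' x' (F (x : UnitAddCircle) y')) := by ring
        rw [e]
        have h6 : |gammaRatio a F (ξ, x, y) * (slopeApprox a F n ξ' x' (F (x : UnitAddCircle) y) -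
              slopeApprox a F n ξ' x' (F (x : UnitAddCircle) y'))| ≤ ρ * Λ * |y - y'| := by
          rw [abs_mul, abs_of_pos (hF.gammaRatio_pos _)]
          calc _ ≤ gammaRatio a F (ξ, x, y) *
                (Λ * |F (x : UnitAddCircle) y - F (x : UnitAddCircle) y'|) :=
                mul_le_mul_of_nonneg_left h4 (hF.gammaRatio_pos _).le
            _ = Λ * (gammaRatio a F (ξ, x, y) *
                |F (x : UnitAddCircle) y - F (x : UnitAddCircle) y'|) := by ring
            _ ≤ Λ * (ρ * |y - y'|) := mul_le_mul_of_nonneg_left h3 hΛ0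
            _ = _ := by ring
        have h7 : |(gammaRatio a F (ξ, x, y) - gammaRatio a F (ξ, x, y')) *
              slopeApprox a F n ξ' x' (F (x : UnitAddCircle) y')| ≤
            s * K / m ^ 2 * |y - y'| * (2 * C) := by
          rw [abs_mul]
          exact mul_le_mul h2 h5 (abs_nonneg _) (by positivity)
        refine (abs_add_le _ _).trans ?_
        rw [abs_neg]
        refine (add_le_add h1 ((abs_add_le _ _).trans (add_le_add h6 h7))).trans ?_
        have h8 : (C₁ + ρ * Λ) * |y - y'| ≤ Λ * |y - y'| := by gcongr
        rw [hC₁] at h8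
        refine le_trans (le_of_eq ?_) h8
        ring
      · have h1 := hbd (n + 1) ξ x hx y hy
        have h2 := hbd (n + 1) ξ x hx y' hy'
        have h3 : Λ * ε ≤ Λ * |y - y'| := by gcongr
        refine (abs_sub _ _).trans ?_
        linarith
  refine ⟨Λ, hΛ0, fun ξ x hx y hy y' hy' => ?_⟩
  have hlim : ∀ z ∈ Set.Icc jL jU, Tendsto (fun n => slopeApprox a F n ξ x z) atTop
      (𝓝 (X3 a F ξ x z)) := by
    intro z hz
    have hl : Tendsto (fun n => C * r ^ n) atTop (𝓝 0) := by
      simpa using (tendsto_pow_atTop_nhds_zero_of_lt_one hr0.le hr1).const_mul C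
    rw [tendsto_iff_dist_tendsto_zero]
    refine squeeze_zero (fun _ => dist_nonneg) (fun n => ?_) hl
    rw [dist_comm]; exact hC n ξ x hx z hz
  exact le_of_tendsto' (((hlim y hy).sub (hlim y' hy')).abs) fun n => hA n ξ x hx y hy y' hy'

end DirectionField

/-! ### Leaves of the strong stable direction field -/

section Leaves

variable {a : ℝ} {F : UnitAddCircle → ℝ → ℝ} {iL iU jL jU : ℝ}

/-- The strong stable direction field, extended to all `y` by projection to `J = [jL, jU]`. -/
noncomputable def fibreField (a : ℝ) (F : UnitAddCircle → ℝ → ℝ) (jL jU ξ t y : ℝ) : ℝ :=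
  X3 a F ξ t (max jL (min jU y))

/-- `l` is a solution of the extended direction field on `D`. -/
def IsLeafOn (a : ℝ) (F : UnitAddCircle → ℝ → ℝ) (jL jU ξ : ℝ) (D : Set ℝ) (l : ℝ → ℝ) : Prop :=
  ∀ t ∈ D, HasDerivWithinAt l (fibreField a F jL jU ξ t (l t)) D t

theorem fibreField_eq {ξ t y : ℝ} (hy : y ∈ Set.Icc jL jU) :
    fibreField a F jL jU ξ t y = X3 a F ξ t y := by
  rw [fibreField, min_eq_right hy.2, max_eq_right hy.1]

theorem clamp_mem (h : jL ≤ jU) (y : ℝ) : max jL (min jU y) ∈ Set.Icc jL jU :=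
  ⟨le_max_left _ _, max_le h (min_le_left _ _)⟩

theorem abs_clamp_sub_le (y y' : ℝ) :
    |max jL (min jU y) - max jL (min jU y')| ≤ |y - y'| := by
  grind

theorem IsBakerDrivenSystem.exists_fibreField_bound (hF : IsBakerDrivenSystem a F iL iU jL jU) :
    ∃ C : NNReal, ∀ ξ, ∀ t ∈ Set.Icc (0 : ℝ) 1, ∀ y, ‖fibreField a F jL jU ξ t y‖ ≤ C := by
  obtain ⟨C, r, hC0, -, -, hX, -⟩ := hF.exists_slopeApprox_sub_le
  exact ⟨⟨C, hC0⟩, fun ξ t ht y => hX ξ t ht _ (clamp_mem hF.jL_lt_jU.le y)⟩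

theorem IsBakerDrivenSystem.exists_fibreField_lipschitz
    (hF : IsBakerDrivenSystem a F iL iU jL jU) :
    ∃ K : NNReal, ∀ ξ, ∀ t ∈ Set.Icc (0 : ℝ) 1,
      LipschitzWith K (fibreField a F jL jU ξ t) := by
  obtain ⟨Λ, hΛ0, hΛ⟩ := hF.exists_lipschitz_X3
  refine ⟨⟨Λ, hΛ0⟩, fun ξ t ht => LipschitzWith.of_dist_le_mul fun y y' => ?_⟩
  refine (hΛ ξ t ht _ (clamp_mem hF.jL_lt_jU.le y) _ (clamp_mem hF.jL_lt_jU.le y')).trans ?_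
  exact mul_le_mul_of_nonneg_left (abs_clamp_sub_le y y') hΛ0

theorem IsBakerDrivenSystem.exists_leaf (hF : IsBakerDrivenSystem a F iL iU jL jU) (ξ : ℝ)
    {x : ℝ} (hx : x ∈ Set.Icc (0 : ℝ) 1) (y : ℝ) :
    ∃ l, IsLeafOn a F jL jU ξ (Set.Icc 0 1) l ∧ l x = y := by
  obtain ⟨C, hC⟩ := hF.exists_fibreField_bound
  obtain ⟨K, hK⟩ := hF.exists_fibreField_lipschitz
  -- The clamped field is bounded by `C` for all `y`, so a ball of radius `C` confines the solution
  -- for time at most `1` and it exists on all of `[0, 1]`.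
  have hP : IsPicardLindelof (fibreField a F jL jU ξ) (⟨x, hx⟩ : Set.Icc (0 : ℝ) 1) y C 0 C K := by
    refine ⟨fun t ht => (hK ξ t ht).lipschitzOnWith, fun z _ => ?_, fun t ht z _ => hC ξ t ht z, ?_⟩
    · exact (hF.continuousOn_X3 ξ).comp (f := fun t : ℝ => (t, max jL (min jU z))) (by fun_prop)
        fun t ht => ⟨ht, clamp_mem hF.jL_lt_jU.le z⟩
    · simp only [NNReal.coe_zero, sub_zero]
      exact mul_le_of_le_one_right C.2 (max_le (by linarith [hx.1]) hx.2)
  obtain ⟨l, hl, h⟩ := hP.exists_eq_forall_mem_Icc_hasDerivWithinAt₀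
  exact ⟨l, h, hl⟩

theorem IsLeafOn.continuousOn {ξ : ℝ} {D : Set ℝ} {l : ℝ → ℝ} (h : IsLeafOn a F jL jU ξ D l) :
    ContinuousOn l D := fun t ht => (h t ht).continuousWithinAt

theorem IsLeafOn.mono {ξ : ℝ} {D D' : Set ℝ} {l : ℝ → ℝ} (h : IsLeafOn a F jL jU ξ D l)
    (hD : D' ⊆ D) : IsLeafOn a F jL jU ξ D' l := fun t ht => (h t (hD ht)).mono hD

theorem IsBakerDrivenSystem.leaf_eqOn (hF : IsBakerDrivenSystem a F iL iU jL jU) {ξ : ℝ}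
    {D : Set ℝ} (hD : D ⊆ Set.Icc 0 1) (hc : D.OrdConnected) {l l' : ℝ → ℝ}
    (hl : IsLeafOn a F jL jU ξ D l) (hl' : IsLeafOn a F jL jU ξ D l') {x : ℝ} (hx : x ∈ D)
    (h : l x = l' x) : Set.EqOn l l' D := by
  obtain ⟨K, hK⟩ := hF.exists_fibreField_lipschitz
  intro u hu
  rcases le_total x u with hxu | hux
  · have hs : Set.Icc x u ⊆ D := hc.out hx hu
    have hm := hl.mono hs
    have hm' := hl'.mono hs
    have hn : ∀ t ∈ Set.Ico x u, Set.Icc x u ∈ 𝓝[Set.Ici t] t := fun t ht =>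
      mem_of_superset (Icc_mem_nhdsGE ht.2) (Set.Icc_subset_Icc_left ht.1)
    exact ODE_solution_unique_of_mem_Icc_right (v := fibreField a F jL jU ξ)
      (s := fun _ => Set.univ) (K := K)
      (fun t ht => (hK ξ t (hD (hs (Set.Ico_subset_Icc_self ht)))).lipschitzOnWith)
      hm.continuousOn
      (fun t ht => (hm t (Set.Ico_subset_Icc_self ht)).mono_of_mem_nhdsWithin (hn t ht))
      (fun _ _ => trivial) hm'.continuousOn
      (fun t ht => (hm' t (Set.Ico_subset_Icc_self ht)).mono_of_mem_nhdsWithin (hn t ht))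
      (fun _ _ => trivial) h (Set.right_mem_Icc.2 hxu)
  · have hs : Set.Icc u x ⊆ D := hc.out hu hx
    have hm := hl.mono hs
    have hm' := hl'.mono hs
    have hn : ∀ t ∈ Set.Ioc u x, Set.Icc u x ∈ 𝓝[Set.Iic t] t := fun t ht =>
      mem_of_superset (Icc_mem_nhdsLE ht.1) (Set.Icc_subset_Icc_right ht.2)
    exact ODE_solution_unique_of_mem_Icc_left (v := fibreField a F jL jU ξ)
      (s := fun _ => Set.univ) (K := K)
      (fun t ht => (hK ξ t (hD (hs (Set.Ioc_subset_Icc_self ht)))).lipschitzOnWith)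
      hm.continuousOn
      (fun t ht => (hm t (Set.Ioc_subset_Icc_self ht)).mono_of_mem_nhdsWithin (hn t ht))
      (fun _ _ => trivial) hm'.continuousOn
      (fun t ht => (hm' t (Set.Ioc_subset_Icc_self ht)).mono_of_mem_nhdsWithin (hn t ht))
      (fun _ _ => trivial) h (Set.left_mem_Icc.2 hux)

/-- Leaves do not cross. -/
theorem IsBakerDrivenSystem.leaf_lt (hF : IsBakerDrivenSystem a F iL iU jL jU) {ξ : ℝ}
    {l l' : ℝ → ℝ} (hl : IsLeafOn a F jL jU ξ (Set.Icc 0 1) l)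
    (hl' : IsLeafOn a F jL jU ξ (Set.Icc 0 1) l') {x u : ℝ} (hx : x ∈ Set.Icc (0 : ℝ) 1)
    (hu : u ∈ Set.Icc (0 : ℝ) 1) (h : l x < l' x) : l u < l' u := by
  by_contra hlt
  have hs : Set.uIcc x u ⊆ Set.Icc 0 1 := Set.uIcc_subset_Icc hx hu
  have hc : ContinuousOn (fun t => l t - l' t) (Set.uIcc x u) :=
    (hl.continuousOn.sub hl'.continuousOn).mono hs
  obtain ⟨t, ht, h0⟩ := intermediate_value_uIcc hc (show (0 : ℝ) ∈ _ from
    Set.Icc_subset_uIcc ⟨by linarith, by linarith [not_lt.1 hlt]⟩)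
  have := hF.leaf_eqOn subset_rfl Set.ordConnected_Icc hl hl' (hs ht) (sub_eq_zero.1 h0) hx
  linarith

theorem IsBakerDrivenSystem.exists_leaf_lipschitz (hF : IsBakerDrivenSystem a F iL iU jL jU) :
    ∃ C : ℝ, 0 < C ∧ ∀ ξ (D : Set ℝ) (l : ℝ → ℝ), D ⊆ Set.Icc 0 1 → D.OrdConnected →
      IsLeafOn a F jL jU ξ D l → ∀ u ∈ D, ∀ u' ∈ D, |l u - l u'| ≤ C * |u - u'| := by
  obtain ⟨C, hC⟩ := hF.exists_fibreField_bound
  refine ⟨C + 1, by positivity, fun ξ D l hD hc hl u hu u' hu' => ?_⟩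
  have := hc.convex.norm_image_sub_le_of_norm_hasDerivWithin_le hl
    (fun t ht => hC ξ t (hD ht) _) hu' hu
  refine this.trans ?_
  rw [Real.norm_eq_abs]
  gcongr
  linarith

/-- The skew product maps leaves in `J` to leaves. -/
theorem IsBakerDrivenSystem.leaf_map (hF : IsBakerDrivenSystem a F iL iU jL jU) {ξ : ℝ}
    {D : Set ℝ} (hD : D ⊆ Set.Icc 0 1) {l : ℝ → ℝ} (hJ : Set.MapsTo l D (Set.Icc jL jU))
    (hl : IsLeafOn a F jL jU ξ D l) :
    IsLeafOn a F jL jU ((ξ - branchOffset a ξ) / sigmaRate a ξ)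
      ((fun u => sigmaRate a ξ * u + branchOffset a ξ) '' D)
      (fun v => F (((v - branchOffset a ξ) / sigmaRate a ξ : ℝ) : UnitAddCircle)
        (l ((v - branchOffset a ξ) / sigmaRate a ξ))) := by
  rintro v ⟨u, hu, rfl⟩
  have hσ := sigmaRate_pos hF.a_pos hF.a_lt_one ξ
  have hinv : ∀ w : ℝ, (sigmaRate a ξ * w + branchOffset a ξ - branchOffset a ξ) /
      sigmaRate a ξ = w := fun w => by field_simp; ring
  have hlu := hl u hu
  rw [fibreField_eq (hJ hu)] at hlu
  have h1 := hF.hasDerivWithinAt_comp hJ hu hlu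
  have h2 : HasDerivWithinAt (fun v => (v - branchOffset a ξ) / sigmaRate a ξ)
      (1 / sigmaRate a ξ) ((fun u => sigmaRate a ξ * u + branchOffset a ξ) '' D)
      (sigmaRate a ξ * u + branchOffset a ξ) :=
    (((hasDerivAt_id _).sub_const _).div_const _).hasDerivWithinAt
  have hm : Set.MapsTo (fun v => (v - branchOffset a ξ) / sigmaRate a ξ)
      ((fun u => sigmaRate a ξ * u + branchOffset a ξ) '' D) D := by
    rintro _ ⟨w, hw, rfl⟩
    simpa only [hinv] using hw
  have h3 := HasDerivWithinAt.comp (h₂ := fun v : ℝ => F (v : UnitAddCircle) (l v))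
    (sigmaRate a ξ * u + branchOffset a ξ) (by rw [hinv u]; exact h1) h2 hm
  refine h3.congr_deriv ?_
  simp only [hinv]
  -- Solved for the value at the image point, the invariance relation of `X3` is exactly the chain
  -- rule slope.
  rw [fibreField_eq (hF.mapsTo_J _ (hJ hu)), hF.X3_invariance ξ (hD hu) (hJ hu)]
  have := (hF.deriv_pos (u : UnitAddCircle) (l u)).ne'
  simp only [slopeTerm, gammaRatio]
  field_simp
  ring

/-- Orbits that start on the same leaf are exponentially asymptotic. -/
theorem IsBakerDrivenSystem.exists_leaf_contraction (hF : IsBakerDrivenSystem a F iL iU jL jU) :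
    ∃ C : ℝ, 0 < C ∧ ∀ (n : ℕ) ξ (D : Set ℝ) (l : ℝ → ℝ), D ⊆ Set.Icc 0 1 → D.OrdConnected →
      Set.MapsTo l D (Set.Icc jL jU) → IsLeafOn a F jL jU ξ D l → ∀ u ∈ D, ∀ u' ∈ D,
        |((skewI a F)^[n] (ξ, u, l u)).2.2 - ((skewI a F)^[n] (ξ, u', l u')).2.2| ≤
          C * max a (1 - a) ^ n * |u - u'| := by
  obtain ⟨C, hC0, hC⟩ := hF.exists_leaf_lipschitz
  have hs0 : 0 < max a (1 - a) := max_rate_pos hF.a_pos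
  refine ⟨C, hC0, fun n => ?_⟩
  induction n with
  | zero =>
    intro ξ D l hD hc _ hl u hu u' hu'
    simpa using hC ξ D l hD hc hl u hu u' hu'
  | succ n ih =>
    intro ξ D l hD hc hJ hl u hu u' hu'
    have hσ := sigmaRate_pos hF.a_pos hF.a_lt_one ξ
    have hinv : ∀ w : ℝ, (sigmaRate a ξ * w + branchOffset a ξ - branchOffset a ξ) /
        sigmaRate a ξ = w := fun w => by field_simp; ring
    have hc' : ((fun u => sigmaRate a ξ * u + branchOffset a ξ) '' D).OrdConnected := by
      have h := ((hc.convex.linear_image (LinearMap.mulLeft ℝ (sigmaRate a ξ))).translate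
        (branchOffset a ξ)).ordConnected
      rw [Set.image_image] at h
      simpa [add_comm] using h
    -- The image leaf lives over an interval shortened by `σ(ξ)`; after `n` steps the uniform
    -- Lipschitz bound for leaves turns the shortened interval into a small vertical distance.
    have h1 := ih _ _ _ (by
        rintro _ ⟨w, hw, rfl⟩
        exact branch_mem_Icc hF.a_pos hF.a_lt_one ξ (hD hw))
      hc' (by
        rintro _ ⟨w, hw, rfl⟩
        simp only [hinv]
        exact hF.mapsTo_J _ (hJ hw)) (hF.leaf_map hD hJ hl) _ ⟨u, hu, rfl⟩ _ ⟨u', hu', rfl⟩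
    simp only [hinv, ← skewI_eq] at h1
    rw [Function.iterate_succ_apply, Function.iterate_succ_apply]
    refine h1.trans ?_
    rw [add_sub_add_right_eq_sub, ← mul_sub, abs_mul, abs_of_pos hσ, pow_succ]
    have := mul_le_mul_of_nonneg_right (sigmaRate_le (a := a) ξ) (abs_nonneg (u - u'))
    calc _ ≤ C * max a (1 - a) ^ n * (max a (1 - a) * |u - u'|) := by gcongr
      _ = _ := by ring

theorem skewI_iterate_rep (h0 : 0 < a) (h1 : a < 1) (F : UnitAddCircle → ℝ → ℝ) (n : ℕ)
    (θ : UnitAddCircle × UnitAddCircle) (y : ℝ) :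
    (skewI a F)^[n] (rep θ.1, rep θ.2, y) =
      (rep ((baker a)^[n] θ).1, rep ((baker a)^[n] θ).2, ((skew a F)^[n] (θ, y)).2) := by
  induction n with
  | zero => rfl
  | succ n ih =>
    rw [Function.iterate_succ_apply', ih, skewI_eq, skew_iterate_succ_snd,
      Function.iterate_succ_apply', baker_fst, rep_tau h0 h1, rep_baker_snd h0 h1, coe_rep]

/-- A leaf that stays in `J` is a strong stable fibre. -/
theorem IsBakerDrivenSystem.isStrongStableFibre_leaf (hF : IsBakerDrivenSystem a F iL iU jL jU)
    {ξ : UnitAddCircle} {l : ℝ → ℝ} (hl : IsLeafOn a F jL jU (rep ξ) (Set.Icc 0 1) l)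
    (hJ : Set.MapsTo l (Set.Icc 0 1) (Set.Icc jL jU)) :
    IsStrongStableFibre a F jL jU ξ ((fun u : ℝ => (u, l u)) '' Set.Icc 0 1) := by
  have h0 : (0 : ℝ) ∈ Set.Icc (0 : ℝ) 1 := by simp
  refine ⟨0, h0, l 0, hJ h0, Set.Icc 0 1, l,
    ⟨subset_rfl, Set.ordConnected_Icc, h0, rfl, hJ, fun u hu => ?_⟩, ?_, rfl⟩
  · have := hl u hu
    rwa [fibreField_eq (hJ hu)] at this
  · rintro D' l' ⟨hD, hc, hx, hy, hJ', hl'⟩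
    refine ⟨hD, hF.leaf_eqOn hD hc (fun t ht => ?_) (hl.mono hD) hx hy⟩
    rw [fibreField_eq (hJ' ht)]
    exact hl' t ht

/-- A strong stable fibre that meets a leaf in `J` coincides with it. -/
theorem IsBakerDrivenSystem.strongStableFibre_eq_leaf (hF : IsBakerDrivenSystem a F iL iU jL jU)
    {ξ : UnitAddCircle} {l : ℝ → ℝ} (hl : IsLeafOn a F jL jU (rep ξ) (Set.Icc 0 1) l)
    (hJ : Set.MapsTo l (Set.Icc 0 1) (Set.Icc jL jU)) {γ : Set (ℝ × ℝ)}
    (hγ : IsStrongStableFibre a F jL jU ξ γ) {u : ℝ} (hu : (u, l u) ∈ γ) :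
    γ = (fun u : ℝ => (u, l u)) '' Set.Icc 0 1 := by
  obtain ⟨x, hx, y, hy, D, m, ⟨hD, hc, hxD, hmx, hmJ, hm⟩, hmax, rfl⟩ := hγ
  obtain ⟨v, hv, he⟩ := hu
  obtain ⟨rfl, hvl⟩ := Prod.mk.inj he
  have hml : Set.EqOn m l D := by
    refine hF.leaf_eqOn hD hc (fun t ht => ?_) (hl.mono hD) hv hvl
    rw [fibreField_eq (hmJ ht)]
    exact hm t ht
  have hsol : IsFibreSolution a F jL jU (rep ξ) x y (Set.Icc 0 1) l := by
    refine ⟨subset_rfl, Set.ordConnected_Icc, hx, by rw [← hml hxD, hmx], hJ, fun u hu => ?_⟩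
    have := hl u hu
    rwa [fibreField_eq (hJ hu)] at this
  have hDe : D = Set.Icc 0 1 := hD.antisymm (hmax _ _ hsol).1
  subst hDe
  exact Set.image_congr fun u hu => by rw [hml hu]

end Leaves

/-! ### Full support of the conditional measures of a Gibbs measure -/

section FullSupport

variable {a : ℝ} {ν : Measure (UnitAddCircle × UnitAddCircle)}

/-- The itinerary of length `n` of a point of the circle under `τ`. -/
noncomputable def itinerary (a : ℝ) (n : ℕ) (x : UnitAddCircle) (k : Fin n) : Prop :=
  rep ((tau a)^[k] x) < a

theorem sameItinerary_iff {n : ℕ} {x x' : UnitAddCircle} :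
    SameItinerary a n x x' ↔ itinerary a n x = itinerary a n x' :=
  ⟨fun h => funext fun k => propext (h k k.2), fun h k hk => iff_of_eq (congrFun h ⟨k, hk⟩)⟩

theorem measurable_itinerary (n : ℕ) : Measurable (itinerary a n) := by
  refine measurable_pi_lambda _ fun k => ?_
  refine measurable_to_prop ?_
  have := measurableSet_lt (measurable_rep.comp (measurable_tau (a := a).iterate k))
    (measurable_const (a := a))
  convert this using 1
  ext x
  simp [itinerary]

theorem SameItinerary.mono {n m : ℕ} (h : n ≤ m) {x x' : UnitAddCircle}
    (hx : SameItinerary a m x x') : SameItinerary a n x x' := fun k hk => hx k (hk.trans_le h)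

/-- After `m` steps the first `m` symbols of `ξ` have become the itinerary of the second coordinate,
in reversed order: its symbol `k` is the former symbol `m - k - 1`. -/
theorem SameItinerary.baker_iterate (h0 : 0 < a) (h1 : a < 1) {n m : ℕ}
    {θ θ' : UnitAddCircle × UnitAddCircle} (h : SameItinerary a (n + m) θ.1 θ'.1) :
    SameItinerary a n ((baker a)^[m] θ).1 ((baker a)^[m] θ').1 ∧
      SameItinerary a m ((baker a)^[m] θ).2 ((baker a)^[m] θ').2 := by
  constructor
  · intro k hk
    rw [baker_iterate_fst, baker_iterate_fst, ← Function.iterate_add_apply,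
      ← Function.iterate_add_apply]
    exact h _ (by omega)
  · intro k hk
    have key : ∀ θ : UnitAddCircle × UnitAddCircle,
        rep ((tau a)^[k] ((baker a)^[m] θ).2) < a ↔ rep ((tau a)^[m - k - 1] θ.1) < a := by
      intro θ
      have e : (baker a)^[m] θ = (baker a)^[k] ((baker a)^[m - k] θ) := by
        rw [← Function.iterate_add_apply]; congr 2; omega
      have e' : (baker a)^[m - k] θ = baker a ((baker a)^[m - k - 1] θ) := by
        conv_lhs => rw [show m - k = (m - k - 1) + 1 by omega]
        rw [Function.iterate_succ_apply']
      rw [e, tau_iterate_baker_snd h0 h1, e', baker_side h0 h1, baker_iterate_fst]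
    rw [key, key]
    exact h _ (by omega)

/-- The rectangle contains the image under the `m`-th iterate of an `(n + m)`-cylinder. The Gibbs
bounds compare the latter with the `n`-cylinder at a cost that depends on `m` only. -/
theorem IsGibbs.exists_cylinder_le (hG : IsGibbs a ν) [IsFiniteMeasure ν]
    (h0 : 0 < a) (h1 : a < 1) (m : ℕ) (x₀ : UnitAddCircle) :
    ∃ c : ℝ, 0 < c ∧ ∀ n ξ, c * ν.real {θ | SameItinerary a n ξ θ.1} ≤
      ν.real {θ | SameItinerary a n ξ θ.1 ∧ SameItinerary a m x₀ θ.2} := by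
  obtain ⟨hT, ψ, ⟨C, ρ, hρ0, hρ1, hψ⟩, P, K, hK, hG⟩ := hG
  obtain ⟨B, hB⟩ : ∃ B, ∀ θ, -B ≤ ψ θ := by
    refine ⟨C - ψ (0, 0), fun θ => ?_⟩
    have := (abs_le.1 (hψ 0 θ (0, 0) (fun k hk => absurd hk (by omega))
      (fun k hk => absurd hk (by omega)))).1
    simp only [pow_zero, mul_one] at this
    linarith
  -- One `K⁻¹` comes from the lower bound for the `(n + m)`-cylinder, the other from the upper bound
  -- for the `n`-cylinder; the exponential bounds the `m` additional terms.
  refine ⟨K⁻¹ * K⁻¹ * Real.exp (-(m * B) - m * P), by positivity, fun n ξ => ?_⟩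
  obtain ⟨θ₁, hθ₁⟩ := (baker_surjective h0 h1).iterate m (ξ, x₀)
  have hsub : {θ' | SameItinerary a (n + m) θ₁.1 θ'.1} ⊆ (baker a)^[m] ⁻¹'
      {θ | SameItinerary a n ξ θ.1 ∧ SameItinerary a m x₀ θ.2} := by
    intro θ' hθ'
    have := SameItinerary.baker_iterate h0 h1 hθ'
    rwa [hθ₁] at this
  have hms : MeasurableSet {θ : UnitAddCircle × UnitAddCircle |
      SameItinerary a n ξ θ.1 ∧ SameItinerary a m x₀ θ.2} := by
    simp only [sameItinerary_iff]
    exact (measurableSet_eq_fun measurable_const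
      ((measurable_itinerary n).comp measurable_fst)).inter (measurableSet_eq_fun measurable_const
      ((measurable_itinerary m).comp measurable_snd))
  have hle : ν.real {θ' | SameItinerary a (n + m) θ₁.1 θ'.1} ≤
      ν.real {θ | SameItinerary a n ξ θ.1 ∧ SameItinerary a m x₀ θ.2} := by
    rw [← (hT.iterate m).measureReal_preimage hms.nullMeasurableSet]
    exact measureReal_mono hsub
  refine le_trans ?_ ((hG (n + m) θ₁).1.trans hle)
  have h2 := (hG n (ξ, x₀)).2
  rw [add_comm n m, Finset.sum_range_add]
  have h3 : -(m * B) ≤ ∑ k ∈ Finset.range m, ψ ((baker a)^[k] θ₁) := by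
    have := Finset.card_nsmul_le_sum (Finset.range m) (fun k => ψ ((baker a)^[k] θ₁)) (-B)
      fun k _ => hB _
    simpa using this
  have h4 : ∑ k ∈ Finset.range n, ψ ((baker a)^[m + k] θ₁) =
      ∑ k ∈ Finset.range n, ψ ((baker a)^[k] (ξ, x₀)) :=
    Finset.sum_congr rfl fun k _ => by rw [add_comm, Function.iterate_add_apply, hθ₁]
  rw [h4]
  calc _ ≤ K⁻¹ * K⁻¹ * Real.exp (-(m * B) - m * P) * (K * Real.exp
        ((∑ k ∈ Finset.range n, ψ ((baker a)^[k] (ξ, x₀))) - n * P)) := by gcongr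
    _ = K⁻¹ * Real.exp (-(m * B) - m * P +
        ((∑ k ∈ Finset.range n, ψ ((baker a)^[k] (ξ, x₀))) - n * P)) := by
      rw [Real.exp_add]; field_simp
    _ ≤ _ := by
      gcongr
      push_cast
      linarith

/-- A measure that dominates another one on cylinders dominates it on open sets. -/
theorem measure_le_of_cylinder_le (h0 : 0 < a) (h1 : a < 1) {μ ρ : Measure UnitAddCircle}
    (h : ∀ n ξ, μ {ξ' | SameItinerary a n ξ ξ'} ≤ ρ {ξ' | SameItinerary a n ξ ξ'})
    {U : Set UnitAddCircle} (hU : IsOpen U) : μ U ≤ ρ U := by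
  classical
  -- The set `V n` is a finite union of `n`-cylinders, and these sets increase to `U` because the
  -- diameters of cylinders shrink to zero.
  let V : ℕ → Set UnitAddCircle := fun n => {ξ | {ξ' | SameItinerary a n ξ ξ'} ⊆ U}
  have hVU : ∀ n, V n ⊆ U := fun n ξ hξ => hξ (fun _ _ => Iff.rfl)
  have hmono : Monotone V := fun n m hnm ξ hξ ξ' hξ' => hξ (SameItinerary.mono hnm hξ')
  have hun : ⋃ n, V n = U := by
    refine Set.Subset.antisymm (Set.iUnion_subset hVU) fun ξ hξ => ?_
    obtain ⟨ε, hε, hb⟩ := Metric.isOpen_iff.1 hU ξ hξ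
    obtain ⟨n, hn⟩ := exists_pow_lt_of_lt_one hε (max_rate_lt_one h0 h1)
    refine Set.mem_iUnion.2 ⟨n, fun ξ' hξ' => hb ?_⟩
    rw [Metric.mem_ball, dist_comm, ← coe_rep ξ, ← coe_rep ξ']
    exact ((dist_coe_le _ _).trans (SameItinerary.abs_sub_le h0 h1 hξ')).trans_lt hn
  have hms : ∀ n (b : Fin n → Prop), MeasurableSet (itinerary a n ⁻¹' {b}) := fun n b =>
    measurableSet_eq_fun (measurable_itinerary n) measurable_const
  have hV : ∀ n, μ (V n) ≤ ρ (V n) := by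
    intro n
    let s : Finset (Fin n → Prop) := Finset.univ.filter fun b => ∃ ξ ∈ V n, itinerary a n ξ = b
    have hs : V n = itinerary a n ⁻¹' s := by
      ext ξ
      simp only [s, Finset.coe_filter, Finset.mem_univ, true_and, Set.mem_preimage,
        Set.mem_ofPred_eq]
      refine ⟨fun hξ => ⟨ξ, hξ, rfl⟩, ?_⟩
      rintro ⟨ξ', hξ', he⟩ ξ'' h''
      refine hξ' ?_
      rw [Set.mem_ofPred_eq, sameItinerary_iff] at h'' ⊢
      rw [he, h'']
    rw [hs, ← sum_measure_preimage_singleton s fun b _ => hms n b,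
      ← sum_measure_preimage_singleton s fun b _ => hms n b]
    refine Finset.sum_le_sum fun b hb => ?_
    obtain ⟨ξ, -, rfl⟩ := (Finset.mem_filter.1 hb).2
    have e : itinerary a n ⁻¹' {itinerary a n ξ} = {ξ' | SameItinerary a n ξ ξ'} := by
      ext ξ'
      rw [Set.mem_ofPred_eq, sameItinerary_iff]
      exact eq_comm
    rw [e]
    exact h n ξ
  rw [← hun, hmono.measure_iUnion, hmono.measure_iUnion]
  exact iSup_mono hV

/-- For rational `s < t` the interval contains an `m`-cylinder around its midpoint. Hence `B ↦ ν (B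
× W)` dominates a positive multiple of the first marginal on cylinders, then on open sets, and by
outer regularity on the set of those `ξ` whose conditional measure does not charge the interval. On
that set the left side vanishes. -/
theorem IsGibbs.ae_pos (hG : IsGibbs a ν) [IsFiniteMeasure ν] (h0 : 0 < a) (h1 : a < 1)
    {κ : ProbabilityTheory.Kernel UnitAddCircle UnitAddCircle} [ProbabilityTheory.IsSFiniteKernel κ]
    (hκ : (ν.map Prod.fst).compProd κ = ν) :
    ∀ᵐ ξ ∂(ν.map Prod.fst), ∀ s t : ℝ, 0 ≤ s → s < t → t ≤ 1 →
      0 < κ ξ {x | s < rep x ∧ rep x < t} := by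
  have hms : ∀ s t : ℝ, MeasurableSet {x : UnitAddCircle | s < rep x ∧ rep x < t} := fun s t =>
    (measurableSet_lt measurable_const measurable_rep).inter
      (measurableSet_lt measurable_rep measurable_const)
  have key : ∀ s t : ℚ, (0 : ℝ) ≤ s → s < t → (t : ℝ) ≤ 1 → ∀ᵐ ξ ∂(ν.map Prod.fst),
      0 < κ ξ {x | (s : ℝ) < rep x ∧ rep x < t} := by
    intro s t hs hst ht
    have hst' : (s : ℝ) < t := by exact_mod_cast hst
    set W : Set UnitAddCircle := {x | (s : ℝ) < rep x ∧ rep x < t} with hW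
    obtain ⟨m, hm⟩ := exists_pow_lt_of_lt_one (half_pos (sub_pos.2 hst')) (max_rate_lt_one h0 h1)
    obtain ⟨c, hc, hcyl⟩ := hG.exists_cylinder_le h0 h1 m ((((s : ℝ) + t) / 2 : ℝ) : UnitAddCircle)
    have hsubW : ∀ x, SameItinerary a m ((((s : ℝ) + t) / 2 : ℝ) : UnitAddCircle) x → x ∈ W := by
      intro x hx
      have := hx.abs_sub_le h0 h1
      rw [rep_coe (by linarith) (by linarith)] at this
      have h := abs_le.1 this
      exact ⟨by linarith [h.2], by linarith [h.1]⟩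
    let ρ : Measure UnitAddCircle := (ν.restrict (Prod.snd ⁻¹' W)).map Prod.fst
    have hρ : ∀ B, MeasurableSet B → ρ B = ν (B ×ˢ W) := by
      intro B hB
      rw [Measure.map_apply measurable_fst hB, Measure.restrict_apply (measurable_fst hB),
        Set.prod_eq]
    have hcy : ∀ n ξ, MeasurableSet {ξ' | SameItinerary a n ξ ξ'} := by
      intro n ξ
      simp only [sameItinerary_iff]
      exact measurableSet_eq_fun measurable_const (measurable_itinerary n)
    have hopen : ∀ U, IsOpen U → (ENNReal.ofReal c • ν.map Prod.fst) U ≤ ρ U := by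
      intro U hU
      refine measure_le_of_cylinder_le h0 h1 (fun n ξ => ?_) hU
      rw [hρ _ (hcy n ξ), Measure.smul_apply, Measure.map_apply measurable_fst (hcy n ξ),
        smul_eq_mul]
      have h3 := hcyl n ξ
      have h4 : ν.real {θ | SameItinerary a n ξ θ.1 ∧
          SameItinerary a m ((((s : ℝ) + t) / 2 : ℝ) : UnitAddCircle) θ.2} ≤
          ν.real ({ξ' | SameItinerary a n ξ ξ'} ×ˢ W) :=
        measureReal_mono fun θ hθ => ⟨hθ.1, hsubW _ hθ.2⟩
      have h5 := ENNReal.ofReal_le_ofReal (h3.trans h4)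
      rw [ENNReal.ofReal_mul hc.le, ofReal_measureReal, ofReal_measureReal] at h5
      exact h5
    rw [ae_iff]
    set B := {ξ | ¬ 0 < κ ξ W} with hB
    have hBm : MeasurableSet B :=
      (measurableSet_lt measurable_const (κ.measurable_coe (hms s t))).compl
    have h3 : ρ B = 0 := by
      rw [hρ B hBm, ← hκ, Measure.compProd_apply_prod hBm (hms s t)]
      rw [setLIntegral_eq_zero_iff hBm (κ.measurable_coe (hms s t))]
      refine ae_of_all _ fun ξ hξ => ?_
      simpa [hB] using hξ
    have h4 : (ENNReal.ofReal c • ν.map Prod.fst) B ≤ 0 := by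
      refine le_of_forall_gt fun ε hε => ?_
      rw [← h3] at hε
      obtain ⟨U, hBU, hU, hlt⟩ := B.exists_isOpen_lt_of_lt ε hε
      exact ((measure_mono hBU).trans (hopen U hU)).trans_lt hlt
    simpa [hc.not_ge, hc] using h4
  have hall : ∀ᵐ ξ ∂(ν.map Prod.fst), ∀ s t : ℚ, (0 : ℝ) ≤ s → s < t → (t : ℝ) ≤ 1 →
      0 < κ ξ {x | (s : ℝ) < rep x ∧ rep x < t} := by
    simp only [ae_all_iff]
    exact key
  filter_upwards [hall] with ξ hξ s t hs hst ht
  obtain ⟨q, hq1, hq2⟩ := exists_rat_btwn hst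
  obtain ⟨r, hr1, hr2⟩ := exists_rat_btwn hq2
  refine (hξ q r (by linarith) (by exact_mod_cast hr1) (by linarith)).trans_le
    (measure_mono fun x hx => ⟨hq1.trans hx.1, hx.2.trans hr2⟩)

end FullSupport

/-! ### Coupling of conditional measures -/

section Coupling

variable {a : ℝ} {F : UnitAddCircle → ℝ → ℝ} {iL iU jL jU : ℝ}
  {ν : Measure (UnitAddCircle × UnitAddCircle)}
  {κ : ProbabilityTheory.Kernel UnitAddCircle UnitAddCircle}

/-- Pairs of points over the same base point, coupled independently given the base point. -/
noncomputable def fibreCoupling (ν : Measure (UnitAddCircle × UnitAddCircle))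
    (κ : ProbabilityTheory.Kernel UnitAddCircle UnitAddCircle) :
    Measure ((UnitAddCircle × UnitAddCircle) × UnitAddCircle) :=
  ν.compProd (κ.comap Prod.fst measurable_fst)

theorem measurePreserving_fibreCoupling_fst [IsProbabilityMeasure ν]
    [ProbabilityTheory.IsMarkovKernel κ] :
    MeasurePreserving Prod.fst (fibreCoupling ν κ) ν :=
  ⟨measurable_fst, Measure.fst_compProd _ _⟩

theorem measurePreserving_fibreCoupling_snd [IsProbabilityMeasure ν]
    [ProbabilityTheory.IsMarkovKernel κ] (hκ : (ν.map Prod.fst).compProd κ = ν) :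
    MeasurePreserving (fun q : (UnitAddCircle × UnitAddCircle) × UnitAddCircle => (q.1.1, q.2))
      (fibreCoupling ν κ) ν := by
  have hm : Measurable fun q : (UnitAddCircle × UnitAddCircle) × UnitAddCircle => (q.1.1, q.2) := by
    fun_prop
  refine ⟨hm, Measure.ext fun S hS => ?_⟩
  rw [Measure.map_apply hm hS, fibreCoupling, Measure.compProd_apply (hm hS)]
  conv_rhs => rw [← hκ, Measure.compProd_apply hS,
    lintegral_map (ProbabilityTheory.Kernel.measurable_kernel_prodMk_left hS) measurable_fst]
  rfl

/-- For continuous `g` the differences vanish uniformly, since points over the same `ξ` approach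
each other. A bounded measurable `g` is close to a continuous function in `L¹(ν)`, and both
coordinates of the coupling have law `ν` at all times, so the approximation error does not grow.
Convergence in `L¹` gives an almost surely convergent subsequence. -/
theorem exists_seq_tendsto_coupling [IsProbabilityMeasure ν]
    [ProbabilityTheory.IsMarkovKernel κ] (hκ : (ν.map Prod.fst).compProd κ = ν)
    (h0 : 0 < a) (h1 : a < 1) (hT : MeasurePreserving (baker a) ν ν)
    {g : UnitAddCircle × UnitAddCircle → ℝ} (hg : Measurable g) {M : ℝ} (hM : ∀ θ, |g θ| ≤ M) :
    ∃ ns : ℕ → ℕ, StrictMono ns ∧ ∀ᵐ q ∂(fibreCoupling ν κ),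
      Tendsto (fun k => g ((baker a)^[ns k] q.1) - g ((baker a)^[ns k] (q.1.1, q.2)))
        atTop (𝓝 0) := by
  set Q := fibreCoupling ν κ with hQ
  have hp1 : MeasurePreserving Prod.fst Q ν := measurePreserving_fibreCoupling_fst
  have hp2 : MeasurePreserving (fun q : (UnitAddCircle × UnitAddCircle) × UnitAddCircle =>
      (q.1.1, q.2)) Q ν := measurePreserving_fibreCoupling_snd hκ
  have : IsProbabilityMeasure Q := by
    rw [hQ, fibreCoupling]; infer_instance
  have m1 : ∀ n, MeasurePreserving (fun q => (baker a)^[n] q.1) Q ν := fun n =>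
    (hT.iterate n).comp hp1
  have m2 : ∀ n, MeasurePreserving (fun q => (baker a)^[n] (q.1.1, q.2)) Q ν := fun n =>
    (hT.iterate n).comp hp2
  have hmeas : ∀ n, Measurable fun q : (UnitAddCircle × UnitAddCircle) × UnitAddCircle =>
      g ((baker a)^[n] q.1) - g ((baker a)^[n] (q.1.1, q.2)) := fun n =>
    (hg.comp (m1 n).measurable).sub (hg.comp (m2 n).measurable)
  have hgL : MemLp g 1 ν := MemLp.of_bound hg.aestronglyMeasurable M (ae_of_all _ hM)
  refine TendstoInMeasure.exists_seq_tendsto_ae (g := fun _ => (0 : ℝ))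
    (tendstoInMeasure_of_tendsto_eLpNorm (p := 1) one_ne_zero
      (fun n => (hmeas n).aestronglyMeasurable) aestronglyMeasurable_const ?_)
  rw [ENNReal.tendsto_nhds_zero]
  intro ε hε
  obtain ⟨h, hh, -⟩ := hgL.exists_boundedContinuous_eLpNorm_sub_le ENNReal.one_ne_top
    (ENNReal.div_pos hε.ne' (by simp : (3 : ENNReal) ≠ ⊤)).ne'
  obtain ⟨η, hη0, hη⟩ : ∃ η : ℝ, 0 < η ∧ ENNReal.ofReal η ≤ ε / 3 := by
    have h3 : 0 < ε / 3 := ENNReal.div_pos hε.ne' (by simp)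
    obtain ⟨η, hη0, hη⟩ := ENNReal.lt_iff_exists_nnreal_btwn.1 h3
    exact ⟨η, by exact_mod_cast hη0, by rw [ENNReal.ofReal_coe_nnreal]; exact hη.le⟩
  obtain ⟨δ, hδ0, hδ⟩ := Metric.uniformContinuous_iff.1
    (CompactSpace.uniformContinuous_of_continuous h.continuous) η hη0
  have hlim := tendsto_pow_atTop_nhds_zero_of_lt_one (max_rate_pos h0).le (max_rate_lt_one h0 h1)
  filter_upwards [hlim.eventually (gt_mem_nhds hδ0)] with n hn
  have hhm : AEStronglyMeasurable (g - ⇑h) ν :=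
    (hg.sub h.continuous.measurable).aestronglyMeasurable
  have e : ((fun q => g ((baker a)^[n] q.1) - g ((baker a)^[n] (q.1.1, q.2))) - fun _ => (0 : ℝ)) =
      ((g - ⇑h) ∘ (fun q => (baker a)^[n] q.1) - (g - ⇑h) ∘ fun q => (baker a)^[n] (q.1.1, q.2)) +
      fun q : (UnitAddCircle × UnitAddCircle) × UnitAddCircle =>
        h ((baker a)^[n] q.1) - h ((baker a)^[n] (q.1.1, q.2)) := by
    funext q
    simp only [Pi.sub_apply, Pi.add_apply, Function.comp_apply]
    ring
  have hm1 := hhm.comp_measurePreserving (m1 n)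
  have hm2 := hhm.comp_measurePreserving (m2 n)
  rw [e]
  refine (eLpNorm_add_le (hm1.sub hm2) (((h.continuous.measurable.comp (m1 n).measurable).sub
    (h.continuous.measurable.comp (m2 n).measurable)).aestronglyMeasurable) le_rfl).trans ?_
  refine (add_le_add_left (eLpNorm_sub_le hm1 hm2 le_rfl) _).trans ?_
  rw [eLpNorm_comp_measurePreserving hhm (m1 n), eLpNorm_comp_measurePreserving hhm (m2 n)]
  have hb : eLpNorm (fun q : (UnitAddCircle × UnitAddCircle) × UnitAddCircle =>
        h ((baker a)^[n] q.1) - h ((baker a)^[n] (q.1.1, q.2))) 1 Q ≤ ε / 3 := by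
    refine (eLpNorm_le_of_ae_bound (C := η) (ae_of_all _ fun q => ?_)).trans (by simpa using hη)
    rw [← dist_eq_norm]
    refine (hδ ?_).le
    rw [Prod.dist_eq, max_lt_iff]
    constructor
    · rw [baker_iterate_fst, baker_iterate_fst, dist_self]; exact hδ0
    · rw [← coe_rep ((baker a)^[n] q.1).2, ← coe_rep ((baker a)^[n] (q.1.1, q.2)).2]
      exact ((dist_coe_le _ _).trans (abs_rep_baker_iterate_sub h0 h1 n _ _ _)).trans_lt hn
  calc _ ≤ ε / 3 + ε / 3 + ε / 3 := add_le_add (add_le_add hh hh) hb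
    _ = ε := ENNReal.add_thirds ε

/-- The pattern is `P - A ≤ |P - P'| + |Z - P'| + |Y - A|`. In the application `A` follows `φ*` over
`x`, `P` and `P'` follow a bounding graph over `x` and `x'`, `Y` follows the leaf over `x'`, and `Z
≤ Y` follows a point attracted by that bounding graph. -/
theorem tendsto_sub_of_squeeze {A P P' Y Z : ℕ → ℝ} {ns : ℕ → ℕ} (hns : StrictMono ns)
    (hAP : ∀ n, A n ≤ P n) (hZY : ∀ n, Z n ≤ Y n)
    (hZ : Tendsto (fun n => |Z n - P' n|) atTop (𝓝 0))
    (hY : Tendsto (fun n => |Y n - A n|) atTop (𝓝 0))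
    (hP : Tendsto (fun k => P (ns k) - P' (ns k)) atTop (𝓝 0)) :
    Tendsto (fun k => P (ns k) - A (ns k)) atTop (𝓝 0) := by
  have h := ((hP.abs).add (hZ.comp hns.tendsto_atTop)).add (hY.comp hns.tendsto_atTop)
  simp only [abs_zero, add_zero] at h
  refine squeeze_zero (fun k => sub_nonneg.2 (hAP _)) (fun k => ?_) h
  have h1 := le_abs_self (P (ns k) - P' (ns k))
  have h2 := neg_abs_le (Z (ns k) - P' (ns k))
  have h3 := le_abs_self (Y (ns k) - A (ns k))
  have h4 := hZY (ns k)
  simp only [Function.comp_apply]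
  linarith

/-- Points on a leaf through a graph have orbits asymptotic to the graph. -/
theorem IsBakerDrivenSystem.tendsto_leaf_sub (hF : IsBakerDrivenSystem a F iL iU jL jU)
    {ξ x x' : UnitAddCircle} {D : Set ℝ} {l : ℝ → ℝ} (hD : D ⊆ Set.Icc 0 1) (hc : D.OrdConnected)
    (hJ : Set.MapsTo l D (Set.Icc jL jU)) (hl : IsLeafOn a F jL jU (rep ξ) D l)
    (hx : rep x ∈ D) (hx' : rep x' ∈ D) :
    Tendsto (fun n : ℕ => |((skew a F)^[n] ((ξ, x'), l (rep x'))).2 -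
      ((skew a F)^[n] ((ξ, x), l (rep x))).2|) atTop (𝓝 0) := by
  obtain ⟨C, hC0, hC⟩ := hF.exists_leaf_contraction
  have hlim : Tendsto (fun n : ℕ => C * max a (1 - a) ^ n * |rep x' - rep x|) atTop (𝓝 0) := by
    have := ((tendsto_pow_atTop_nhds_zero_of_lt_one (max_rate_pos hF.a_pos).le
      (max_rate_lt_one hF.a_pos hF.a_lt_one)).const_mul C).mul_const |rep x' - rep x|
    simpa using this
  refine squeeze_zero (fun _ => abs_nonneg _) (fun n => ?_) hlim
  have := hC n (rep ξ) D l hD hc hJ hl _ hx' _ hx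
  rwa [skewI_iterate_rep hF.a_pos hF.a_lt_one F n (ξ, x') _,
    skewI_iterate_rep hF.a_pos hF.a_lt_one F n (ξ, x) _] at this

/-- If the leaf were above `φ*` over `x'`, then its minimum with `φ⁺` there would be attracted by
`φ⁺`, while the leaf stays asymptotic to `φ*` over `x`. Since `φ⁺` merges over the two points along
`ns`, the gap `φ⁺ - φ*` would tend to zero, against `hnot`. -/
theorem IsBakerDrivenSystem.leaf_le_phiStar (hF : IsBakerDrivenSystem a F iL iU jL jU)
    {ξ x x' : UnitAddCircle} {D : Set ℝ} {l : ℝ → ℝ} (hD : D ⊆ Set.Icc 0 1) (hc : D.OrdConnected)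
    (hJ : Set.MapsTo l D (Set.Icc jL jU)) (hl : IsLeafOn a F jL jU (rep ξ) D l)
    (hx : rep x ∈ D) (hx' : rep x' ∈ D) (hlx : l (rep x) = phiStar a F (ξ, x))
    {ns : ℕ → ℕ} (hns : StrictMono ns)
    (hP : Tendsto (fun k => phiPlus a F ((baker a)^[ns k] (ξ, x)) -
      phiPlus a F ((baker a)^[ns k] (ξ, x'))) atTop (𝓝 0))
    (hlt : phiStar a F (ξ, x') < phiPlus a F (ξ, x'))
    (hup : ∀ y, phiStar a F (ξ, x') < y → y ≤ phiPlus a F (ξ, x') →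
      Tendsto (fun n : ℕ => |((skew a F)^[n] ((ξ, x'), y)).2 -
        phiPlus a F ((baker a)^[n] (ξ, x'))|) atTop (𝓝 0))
    (hnot : ¬ Tendsto (fun k => phiPlus a F ((baker a)^[ns k] (ξ, x)) -
      phiStar a F ((baker a)^[ns k] (ξ, x))) atTop (𝓝 0)) :
    l (rep x') ≤ phiStar a F (ξ, x') := by
  by_contra h
  refine hnot ?_
  have ht := hF.tendsto_leaf_sub hD hc hJ hl hx hx'
  simp only [hlx, hF.isInvariantGraph_phiStar.iterate] at ht
  exact tendsto_sub_of_squeeze (A := fun n => phiStar a F ((baker a)^[n] (ξ, x)))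
    (P := fun n => phiPlus a F ((baker a)^[n] (ξ, x))) hns
    (fun n => hF.phiStar_le_phiPlus _)
    (fun n => (hF.skew_iterate_strictMono n (ξ, x')).monotone (min_le_left (l (rep x')) _))
    (hup _ (lt_min (not_le.1 h) hlt) (min_le_right _ _)) ht hP

/-- The same argument from below, applied to negated sequences. Attraction to `φ⁻` below `φ*` holds
by the definition of `φ*`. -/
theorem IsBakerDrivenSystem.phiStar_le_leaf (hF : IsBakerDrivenSystem a F iL iU jL jU)
    {ξ x x' : UnitAddCircle} {D : Set ℝ} {l : ℝ → ℝ} (hD : D ⊆ Set.Icc 0 1) (hc : D.OrdConnected)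
    (hJ : Set.MapsTo l D (Set.Icc jL jU)) (hl : IsLeafOn a F jL jU (rep ξ) D l)
    (hx : rep x ∈ D) (hx' : rep x' ∈ D) (hlx : l (rep x) = phiStar a F (ξ, x))
    {ns : ℕ → ℕ} (hns : StrictMono ns)
    (hP : Tendsto (fun k => phiMinus a F ((baker a)^[ns k] (ξ, x)) -
      phiMinus a F ((baker a)^[ns k] (ξ, x'))) atTop (𝓝 0))
    (hlt : phiMinus a F (ξ, x') < phiStar a F (ξ, x'))
    (hnot : ¬ Tendsto (fun k => phiStar a F ((baker a)^[ns k] (ξ, x)) -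
      phiMinus a F ((baker a)^[ns k] (ξ, x))) atTop (𝓝 0)) :
    phiStar a F (ξ, x') ≤ l (rep x') := by
  by_contra h
  refine hnot ?_
  have ht := hF.tendsto_leaf_sub hD hc hJ hl hx hx'
  simp only [hlx, hF.isInvariantGraph_phiStar.iterate] at ht
  have hz := hF.tendsto_of_lt_phiStar (le_max_right (l (rep x')) _) (max_lt (not_le.1 h) hlt)
  have := tendsto_sub_of_squeeze (A := fun n => -phiStar a F ((baker a)^[n] (ξ, x)))
    (P := fun n => -phiMinus a F ((baker a)^[n] (ξ, x)))
    (P' := fun n => -phiMinus a F ((baker a)^[n] (ξ, x')))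
    (Y := fun n => -((skew a F)^[n] ((ξ, x'), l (rep x'))).2)
    (Z := fun n => -((skew a F)^[n] ((ξ, x'), max (l (rep x')) (phiMinus a F (ξ, x')))).2) hns
    (fun n => neg_le_neg (hF.phiMinus_le_phiStar _))
    (fun n => neg_le_neg ((hF.skew_iterate_strictMono n (ξ, x')).monotone (le_max_left _ _)))
    (by simpa only [← neg_sub', abs_neg] using hz) (by simpa only [← neg_sub', abs_neg] using ht)
    (by simpa only [← neg_sub', neg_zero] using hP.neg)
  simpa only [neg_sub_neg] using this

end Coupling

/-! ### Rigidity of the graph `φ*` along leaves -/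

section Rigidity

variable {a : ℝ} {F : UnitAddCircle → ℝ → ℝ} {iL iU jL jU : ℝ}
  {ν : Measure (UnitAddCircle × UnitAddCircle)}
  {κ : ProbabilityTheory.Kernel UnitAddCircle UnitAddCircle}

theorem exists_mem_of_measure_pos {Ω : Type*} [MeasurableSpace Ω] {m : Measure Ω} {A : Set Ω}
    (h : 0 < m A) {P : Ω → Prop} (hP : ∀ᵐ x ∂m, P x) : ∃ x ∈ A, P x :=
  ((frequently_ae_mem_iff.2 h.ne').and_eventually hP).exists

theorem mem_closure_of_ae {m : Measure UnitAddCircle}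
    (hpos : ∀ s t : ℝ, 0 ≤ s → s < t → t ≤ 1 → 0 < m {x | s < rep x ∧ rep x < t})
    {P : UnitAddCircle → Prop} (hP : ∀ᵐ x ∂m, P x) {s t u : ℝ} (hs : 0 ≤ s) (hst : s < t)
    (ht : t ≤ 1) (hu : u ∈ Set.Icc s t) :
    u ∈ closure {v : ℝ | v ∈ Set.Ioo s t ∧ P (v : UnitAddCircle)} := by
  rw [Metric.mem_closure_iff]
  intro ε hε
  obtain ⟨x, hx, hPx⟩ := exists_mem_of_measure_pos
    (hpos (max s (u - ε)) (min t (u + ε)) (le_max_of_le_left hs)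
      (by rw [max_lt_iff, lt_min_iff, lt_min_iff]
          exact ⟨⟨hst, by linarith [hu.1]⟩, by linarith [hu.2], by linarith⟩)
      (min_le_of_left_le ht)) hP
  obtain ⟨h1, h2⟩ := hx
  rw [max_lt_iff] at h1
  rw [lt_min_iff] at h2
  refine ⟨rep x, ⟨⟨h1.1, h2.1⟩, by rwa [coe_rep]⟩, ?_⟩
  rw [Real.dist_eq, abs_lt]
  constructor <;> linarith [h1.2, h2.2]

/-- Leaf contraction is available only while the leaf stays in `J`. As leaves have uniformly bounded
slope and `I` lies inside `J`, this holds up to a uniform distance from a point in `I`. -/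
theorem IsBakerDrivenSystem.exists_leaf_radius (hF : IsBakerDrivenSystem a F iL iU jL jU) :
    ∃ r : ℝ, 0 < r ∧ ∀ ξ (l : ℝ → ℝ), IsLeafOn a F jL jU ξ (Set.Icc 0 1) l →
      ∀ x ∈ Set.Icc (0 : ℝ) 1, ∀ x' ∈ Set.Icc (0 : ℝ) 1, l x ∈ Set.Icc iL iU → |x - x'| ≤ r →
        Set.MapsTo l (Set.uIcc x x') (Set.Icc jL jU) := by
  obtain ⟨C, hC0, hC⟩ := hF.exists_leaf_lipschitz
  have h1 := hF.jL_lt_iL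
  have h2 := hF.iU_lt_jU
  refine ⟨min (iL - jL) (jU - iU) / C, div_pos (lt_min (by linarith) (by linarith)) hC0,
    fun ξ l hl x hx x' hx' hlx hr t ht => ?_⟩
  have htI : t ∈ Set.Icc (0 : ℝ) 1 := Set.uIcc_subset_Icc hx hx' ht
  have h3 := hC ξ _ l subset_rfl Set.ordConnected_Icc hl t htI x hx
  have h4 : |t - x| ≤ |x' - x| := Set.abs_sub_left_of_mem_uIcc ht
  rw [abs_sub_comm, le_div_iff₀ hC0] at hr
  have h5 : C * |t - x| ≤ min (iL - jL) (jU - iU) := by nlinarith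
  have h6 := abs_le.1 (h3.trans h5)
  have h7 := min_le_left (iL - jL) (jU - iU)
  have h8 := min_le_right (iL - jL) (jU - iU)
  constructor <;> linarith [hlx.1, hlx.2, h6.1, h6.2]

/-- For almost every pair, a one-sided comparison holds in both orders. A leaf through one point
that misses `φ*` at the other would, by non-crossing, violate one of the two. -/
theorem IsBakerDrivenSystem.exists_ae_leaf_eq [IsProbabilityMeasure ν]
    [ProbabilityTheory.IsMarkovKernel κ] (hF : IsBakerDrivenSystem a F iL iU jL jU)
    (hA : filledClosure (phiPlus a F) ∩ filledClosure (phiMinus a F) = ∅)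
    (hν : Ergodic (baker a) ν) (hκ : (ν.map Prod.fst).compProd κ = ν) :
    ∃ r : ℝ, 0 < r ∧ ∀ᵐ q ∂(fibreCoupling ν κ), |rep q.1.2 - rep q.2| ≤ r →
      ∀ l : ℝ → ℝ, IsLeafOn a F jL jU (rep q.1.1) (Set.Icc 0 1) l →
        l (rep q.1.2) = phiStar a F q.1 → l (rep q.2) = phiStar a F (q.1.1, q.2) := by
  obtain ⟨r, hr0, hr⟩ := hF.exists_leaf_radius
  refine ⟨r, hr0, ?_⟩
  have hT := hν.toMeasurePreserving
  have hp1 : MeasurePreserving Prod.fst (fibreCoupling ν κ) ν :=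
    measurePreserving_fibreCoupling_fst
  have hp2 : MeasurePreserving (fun q : (UnitAddCircle × UnitAddCircle) × UnitAddCircle =>
      (q.1.1, q.2)) (fibreCoupling ν κ) ν := measurePreserving_fibreCoupling_snd hκ
  have hbd : ∀ y ∈ Set.Icc iL iU, |y| ≤ max |iL| |iU| := fun y hy => abs_le_max_abs_abs hy.1 hy.2
  have hS := hF.isInvariantGraph_phiStar.mono hF
  obtain ⟨hup, -⟩ := hF.trichotomy hA hν
  have hsub : ∀ x x' : UnitAddCircle, Set.uIcc (rep x) (rep x') ⊆ Set.Icc 0 1 := fun x x' =>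
    Set.uIcc_subset_Icc (rep_mem_Icc _) (rep_mem_Icc _)
  -- one-sided comparison for both orders of a pair implies equality
  have hfin : ∀ {ξ x x' : UnitAddCircle} (s : ℝ), |s| = 1 → |rep x - rep x'| ≤ r →
      (∀ z z', |rep z - rep z'| ≤ r → (z = x ∧ z' = x' ∨ z = x' ∧ z' = x) → ∀ l : ℝ → ℝ,
        IsLeafOn a F jL jU (rep ξ) (Set.Icc 0 1) l → l (rep z) = phiStar a F (ξ, z) →
        s * l (rep z') ≤ s * phiStar a F (ξ, z')) →
      ∀ l : ℝ → ℝ, IsLeafOn a F jL jU (rep ξ) (Set.Icc 0 1) l →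
        l (rep x) = phiStar a F (ξ, x) → l (rep x') = phiStar a F (ξ, x') := by
    intro ξ x x' s hs hxx h l hl hlx
    obtain ⟨l', hl', hlx'⟩ := hF.exists_leaf (rep ξ) (rep_mem_Icc x') (phiStar a F (ξ, x'))
    have h1 := h x x' hxx (Or.inl ⟨rfl, rfl⟩) l hl hlx
    have h2 := h x' x (by rwa [abs_sub_comm]) (Or.inr ⟨rfl, rfl⟩) l' hl' hlx'
    rw [← hlx] at h2
    rw [← hlx'] at h1 ⊢
    rcases lt_trichotomy (l (rep x')) (l' (rep x')) with h3 | h3 | h3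
    · have h4 := hF.leaf_lt hl hl' (rep_mem_Icc x') (rep_mem_Icc x) h3
      rcases eq_or_eq_neg_of_abs_eq hs with rfl | rfl <;> linarith
    · exact h3
    · have h4 := hF.leaf_lt hl' hl (rep_mem_Icc x') (rep_mem_Icc x) h3
      rcases eq_or_eq_neg_of_abs_eq hs with rfl | rfl <;> linarith
  -- The comparison needs a bounding graph separated from `φ*`. This is `φ⁺` unless `φ* = φ⁺` almost
  -- everywhere, and in that case `φ⁻` lies strictly below because the filled closures are disjoint.
  rcases hF.ae_eq_or_ae_lt hν hS (hF.isInvariantGraph_phiPlus.mono hF) hF.phiStar_le_phiPlus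
    with heq | hlt
  · have hlt : ∀ᵐ θ ∂ν, phiMinus a F θ < phiStar a F θ := by
      filter_upwards [heq] with θ hθ
      rw [hθ]
      exact (hF.phiMinus_le_phiMinusPlus θ).trans_lt
        ((hF.phiMinusPlus_lt hA θ).trans_le (hF.phiPlusMinus_le θ))
    obtain ⟨ns, hns, hconv⟩ := exists_seq_tendsto_coupling hκ hF.a_pos hF.a_lt_one hT
      hF.measurable_phiMinus fun θ => hbd _ (hF.phiMinus_mem θ)
    have hnot := hT.ae_not_tendsto_zero (hF.measurable_phiStar.sub hF.measurable_phiMinus)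
      (hlt.mono fun θ hθ => sub_pos.2 hθ) ns
    filter_upwards [hconv, hp1.quasiMeasurePreserving.ae hlt, hp2.quasiMeasurePreserving.ae hlt,
      hp1.quasiMeasurePreserving.ae hnot, hp2.quasiMeasurePreserving.ae hnot]
    rintro ⟨⟨ξ, x⟩, x'⟩ c1 c2 c3 c4 c5 hxx
    refine hfin (-1) (by simp) hxx ?_
    rintro z z' hz (⟨rfl, rfl⟩ | ⟨rfl, rfl⟩) l hl hlz
    · have := hF.phiStar_le_leaf (hsub z z') Set.ordConnected_uIcc
        (hr _ l hl _ (rep_mem_Icc z) _ (rep_mem_Icc z') (hlz ▸ hF.phiStar_mem _) hz)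
        (hl.mono (hsub z z')) Set.left_mem_uIcc Set.right_mem_uIcc hlz hns c1 c3 c4
      linarith
    · have := hF.phiStar_le_leaf (hsub z z') Set.ordConnected_uIcc
        (hr _ l hl _ (rep_mem_Icc z) _ (rep_mem_Icc z') (hlz ▸ hF.phiStar_mem _) hz)
        (hl.mono (hsub z z')) Set.left_mem_uIcc Set.right_mem_uIcc hlz hns
        (by simpa only [neg_sub, neg_zero] using c1.neg) c2 c5
      linarith
  · obtain ⟨ns, hns, hconv⟩ := exists_seq_tendsto_coupling hκ hF.a_pos hF.a_lt_one hT
      hF.measurable_phiPlus fun θ => hbd _ (hF.phiPlus_mem θ)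
    have hnot := hT.ae_not_tendsto_zero (hF.measurable_phiPlus.sub hF.measurable_phiStar)
      (hlt.mono fun θ hθ => sub_pos.2 hθ) ns
    filter_upwards [hconv, hp1.quasiMeasurePreserving.ae hlt, hp2.quasiMeasurePreserving.ae hlt,
      hp1.quasiMeasurePreserving.ae hnot, hp2.quasiMeasurePreserving.ae hnot,
      hp1.quasiMeasurePreserving.ae hup, hp2.quasiMeasurePreserving.ae hup]
    rintro ⟨⟨ξ, x⟩, x'⟩ c1 c2 c3 c4 c5 c6 c7 hxx
    refine hfin 1 (by simp) hxx ?_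
    rintro z z' hz (⟨rfl, rfl⟩ | ⟨rfl, rfl⟩) l hl hlz
    · have := hF.leaf_le_phiStar (hsub z z') Set.ordConnected_uIcc
        (hr _ l hl _ (rep_mem_Icc z) _ (rep_mem_Icc z') (hlz ▸ hF.phiStar_mem _) hz)
        (hl.mono (hsub z z')) Set.left_mem_uIcc Set.right_mem_uIcc hlz hns c1 c3 c7 c4
      linarith
    · have := hF.leaf_le_phiStar (hsub z z') Set.ordConnected_uIcc
        (hr _ l hl _ (rep_mem_Icc z) _ (rep_mem_Icc z') (hlz ▸ hF.phiStar_mem _) hz)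
        (hl.mono (hsub z z')) Set.left_mem_uIcc Set.right_mem_uIcc hlz hns
        (by simpa only [neg_sub, neg_zero] using c1.neg) c2 c6 c5
      linarith

/-- The graph of `φ*` over almost every `ξ` is contained in a single leaf. -/
theorem IsBakerDrivenSystem.ae_exists_leaf [IsProbabilityMeasure ν]
    [ProbabilityTheory.IsMarkovKernel κ] (hF : IsBakerDrivenSystem a F iL iU jL jU)
    (hA : filledClosure (phiPlus a F) ∩ filledClosure (phiMinus a F) = ∅)
    (hν : Ergodic (baker a) ν) (hG : IsGibbs a ν) (hκ : (ν.map Prod.fst).compProd κ = ν) :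
    ∀ᵐ ξ ∂(ν.map Prod.fst), ∃ l : ℝ → ℝ, IsLeafOn a F jL jU (rep ξ) (Set.Icc 0 1) l ∧
      ∀ᵐ x ∂(κ ξ), l (rep x) = phiStar a F (ξ, x) := by
  have hprob : IsProbabilityMeasure (ν.map Prod.fst) :=
    Measure.isProbabilityMeasure_map measurable_fst.aemeasurable
  obtain ⟨r, hr0, hr⟩ := hF.exists_ae_leaf_eq hA hν hκ
  have h1 := Measure.ae_ae_of_ae_compProd hr
  rw [← hκ] at h1
  have h2 := Measure.ae_ae_of_ae_compProd h1
  filter_upwards [h2, hG.ae_pos hF.a_pos hF.a_lt_one hκ] with ξ hR hpos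
  simp only [ProbabilityTheory.Kernel.comap_apply] at hR
  -- Points in the same or in adjacent intervals of length `1 / N` are within distance `r`.
  obtain ⟨N, hN⟩ := exists_nat_gt (2 / r)
  have hN0 : (0 : ℝ) < N := (div_pos two_pos hr0).trans hN
  have hNr : 2 / (N : ℝ) ≤ r := by
    rw [div_le_iff₀ hN0]; rw [div_lt_iff₀ hr0] at hN; linarith
  have hdiv : ∀ i : ℕ, ((i : ℝ) + 1) / N = i / N + 1 / N := fun i => add_div _ _ _
  have h2N : 2 / (N : ℝ) = 1 / N + 1 / N := by ring
  have hN1 : 0 < 1 / (N : ℝ) := by positivity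
  have hposi : ∀ i < N, 0 < κ ξ {x | (i : ℝ) / N < rep x ∧ rep x < ((i : ℝ) + 1) / N} := by
    intro i hi
    refine hpos _ _ (by positivity) (by gcongr; linarith) ?_
    rw [div_le_one hN0]; exact_mod_cast hi
  have hch : ∀ i : ℕ, ∃ x l, i < N → ((i : ℝ) / N < rep x ∧ rep x < ((i : ℝ) + 1) / N) ∧
      IsLeafOn a F jL jU (rep ξ) (Set.Icc 0 1) l ∧
      ∀ᵐ x' ∂(κ ξ), |rep x - rep x'| ≤ r → l (rep x') = phiStar a F (ξ, x') := by
    intro i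
    by_cases hi : i < N
    · obtain ⟨x, hx, hRx⟩ := exists_mem_of_measure_pos (hposi i hi) hR
      obtain ⟨l, hl, hlx⟩ := hF.exists_leaf (rep ξ) (rep_mem_Icc x) (phiStar a F (ξ, x))
      exact ⟨x, l, fun _ => ⟨hx, hl, hRx.mono fun x' h hx' => h hx' l hl hlx⟩⟩
    · exact ⟨0, id, fun h => absurd h hi⟩
  choose x l hxl using hch
  -- The leaves chosen in adjacent intervals both pass through `φ*` at some common point of the
  -- second interval, which has positive measure; by uniqueness they coincide on `[0, 1]`.
  have hEq : ∀ i < N, Set.EqOn (l i) (l 0) (Set.Icc 0 1) := by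
    intro i
    induction i with
    | zero => exact fun _ _ _ => rfl
    | succ i ih =>
      intro hi
      obtain ⟨hx, hl, h⟩ := hxl i (by omega)
      obtain ⟨hx', hl', h'⟩ := hxl (i + 1) hi
      obtain ⟨z, hz, e1, e2⟩ := exists_mem_of_measure_pos (hposi (i + 1) hi) (h.and h')
      push_cast at hz hx'
      rw [hdiv] at hx
      simp only [Set.mem_ofPred_eq, add_div] at hz hx'
      have c1 := e1 (by rw [abs_le]; constructor <;> linarith [hx.1, hx.2, hz.1, hz.2])
      have c2 := e2 (by rw [abs_le]; constructor <;> linarith [hx'.1, hx'.2, hz.1, hz.2])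
      exact (hF.leaf_eqOn subset_rfl Set.ordConnected_Icc hl' hl (rep_mem_Icc z)
        (c2.trans c1.symm)).trans (ih (by omega))
  have hNpos : 0 < N := by exact_mod_cast hN0
  refine ⟨l 0, (hxl 0 hNpos).2.1, ?_⟩
  have hall : ∀ᵐ x' ∂(κ ξ), ∀ i, i < N → |rep (x i) - rep x'| ≤ r →
      l i (rep x') = phiStar a F (ξ, x') := by
    rw [ae_all_iff]
    intro i
    by_cases hi : i < N
    · exact (hxl i hi).2.2.mono fun x' h _ => h
    · exact ae_of_all _ fun _ h => absurd h hi
  filter_upwards [hall] with z hz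
  have hz0 : 0 ≤ N * rep z := mul_nonneg hN0.le (rep_nonneg z)
  have hi : ⌊N * rep z⌋₊ < N := by
    rw [Nat.floor_lt hz0]
    exact mul_lt_of_lt_one_right hN0 (rep_lt_one z)
  have h3 : ((⌊N * rep z⌋₊ : ℕ) : ℝ) / N ≤ rep z := by
    rw [div_le_iff₀ hN0, mul_comm (rep z)]; exact Nat.floor_le hz0
  have h4 : rep z < ((⌊N * rep z⌋₊ : ℕ) : ℝ) / N + 1 / N := by
    rw [← hdiv, lt_div_iff₀ hN0, mul_comm]; exact Nat.lt_floor_add_one _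
  have h5 := (hxl _ hi).1
  rw [hdiv] at h5
  rw [← hEq _ hi (rep_mem_Icc z)]
  exact hz _ hi (by rw [abs_le]; constructor <;> linarith [h5.1, h5.2])

theorem IsLeafOn.mem_of_ae {m : Measure UnitAddCircle}
    (hpos : ∀ s t : ℝ, 0 ≤ s → s < t → t ≤ 1 → 0 < m {x | s < rep x ∧ rep x < t})
    {ξ : ℝ} {l : ℝ → ℝ} (hl : IsLeafOn a F jL jU ξ (Set.Icc 0 1) l) {S : Set ℝ} (hS : IsClosed S)
    (h : ∀ᵐ x ∂m, l (rep x) ∈ S) : Set.MapsTo l (Set.Icc 0 1) S := by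
  intro u hu
  have hcl := mem_closure_of_ae hpos h le_rfl one_pos le_rfl hu
  have hsub : {v : ℝ | v ∈ Set.Ioo (0 : ℝ) 1 ∧ l (rep (v : UnitAddCircle)) ∈ S} ⊆ Set.Icc 0 1 :=
    fun v hv => Set.Ioo_subset_Icc_self hv.1
  have := ((hl.continuousOn u hu).mono hsub).mem_closure hcl (t := S) (fun v hv => by
    have h2 := hv.2
    rwa [rep_coe hv.1.1.le hv.1.2] at h2)
  rwa [hS.closure_eq] at this

end Rigidity

/-! ### Leaves and the graph `φ⁺⁻` -/

/-- The set of points that visit `S` infinitely often is invariant, and Poincaré recurrence keeps it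
from being null. -/
theorem Ergodic.ae_frequently_mem {Ω : Type*} [MeasurableSpace Ω] {μ : Measure Ω}
    [IsFiniteMeasure μ] {T : Ω → Ω} (hT : Ergodic T μ) {S : Set Ω} (hS : MeasurableSet S)
    (h0 : μ S ≠ 0) : ∀ᵐ x ∂μ, ∃ᶠ n in atTop, T^[n] x ∈ S := by
  let B : Set Ω := {x | ∃ᶠ n in atTop, T^[n] x ∈ S}
  have hB : MeasurableSet B := by
    have : B = ⋂ N : ℕ, ⋃ n : ℕ, ⋃ _ : N ≤ n, T^[n] ⁻¹' S := by
      ext x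
      simp [B, frequently_atTop]
    rw [this]
    exact MeasurableSet.iInter fun N => MeasurableSet.iUnion fun n => MeasurableSet.iUnion fun _ =>
      (hT.measurable.iterate n) hS
  have hinv : T ⁻¹' B = B := by
    ext x
    simp only [B, Set.mem_preimage, Set.mem_ofPred_eq, ← Function.iterate_succ_apply]
    conv_rhs => rw [← map_add_atTop_eq_nat 1, frequently_map]
  rcases hT.toPreErgodic.ae_empty_or_univ hB hinv with h | h
  · refine absurd (measure_mono_null_ae ?_ (ae_eq_empty.1 h)) h0
    exact hT.toMeasurePreserving.conservative.ae_mem_imp_frequently_image_mem hS.nullMeasurableSet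
  · exact eventuallyEq_univ.1 h

section PhiPlusMinus

variable {a : ℝ} {F : UnitAddCircle → ℝ → ℝ} {iL iU jL jU : ℝ}
  {ν : Measure (UnitAddCircle × UnitAddCircle)}
  {κ : ProbabilityTheory.Kernel UnitAddCircle UnitAddCircle}
  {φ : UnitAddCircle × UnitAddCircle → ℝ}

/-- Full support and upper semicontinuity extend `l ≤ φ⁺` to all interior points. The value `φ⁺⁻` is
a limit of values of `φ⁺` at nearby `x`, so it inherits the bound. The endpoints are excluded
because a neighbourhood of `0` on the circle also contains points near `1`, where `l` may have other
values. -/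
theorem IsBakerDrivenSystem.leaf_le_phiPlusMinus (hF : IsBakerDrivenSystem a F iL iU jL jU)
    {m : Measure UnitAddCircle}
    (hpos : ∀ s t : ℝ, 0 ≤ s → s < t → t ≤ 1 → 0 < m {x | s < rep x ∧ rep x < t})
    {ξ : UnitAddCircle} {l : ℝ → ℝ} (hl : ContinuousOn l (Set.Icc 0 1))
    (h : ∀ᵐ x ∂m, l (rep x) ≤ phiPlus a F (ξ, x)) {u : ℝ} (hu : u ∈ Set.Ioo (0 : ℝ) 1) :
    l u ≤ phiPlusMinus a F (ξ, (u : UnitAddCircle)) := by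
  have hlc : ∀ v ∈ Set.Ioo (0 : ℝ) 1, ContinuousAt l v := fun v hv =>
    hl.continuousAt (Icc_mem_nhds hv.1 hv.2)
  have hle : ∀ v ∈ Set.Ioo (0 : ℝ) 1, l v ≤ phiPlus a F (ξ, (v : UnitAddCircle)) := by
    intro v hv
    by_contra! hlt
    obtain ⟨c, hc1, hc2⟩ := exists_between hlt
    have e1 : ∀ᶠ w : ℝ in 𝓝 v, phiPlus a F (ξ, (w : UnitAddCircle)) < c :=
      (Continuous.tendsto (by fun_prop) v : Tendsto (fun w : ℝ => (ξ, (w : UnitAddCircle))) (𝓝 v)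
        (𝓝 (ξ, (v : UnitAddCircle)))).eventually (hF.phiPlus_upperSemicontinuous _ c hc1)
    have e2 : ∀ᶠ w : ℝ in 𝓝 v, c < l w := (hlc v hv).eventually (lt_mem_nhds hc2)
    obtain ⟨w, ⟨h1, h2⟩, hw, h3⟩ := mem_closure_iff_nhds.1
      (mem_closure_of_ae hpos h le_rfl one_pos le_rfl (Set.Ioo_subset_Icc_self hv)) _ (e1.and e2)
    rw [rep_coe hw.1.le hw.2] at h3
    linarith
  by_contra! hlt
  obtain ⟨c, hc1, hc2⟩ := exists_between hlt
  have e2 : ∀ᶠ w : ℝ in 𝓝 u, c < l w ∧ w ∈ Set.Ioo (0 : ℝ) 1 :=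
    ((hlc u hu).eventually (lt_mem_nhds hc2)).and (Ioo_mem_nhds hu.1 hu.2)
  have hU : ((Set.univ : Set UnitAddCircle) ×ˢ
      ((fun w : ℝ => (w : UnitAddCircle)) '' {w | c < l w ∧ w ∈ Set.Ioo (0 : ℝ) 1})) ×ˢ Set.Iio c ∈
      𝓝 ((ξ, (u : UnitAddCircle)), phiPlusMinus a F (ξ, (u : UnitAddCircle))) := by
    refine prod_mem_nhds (prod_mem_nhds univ_mem ?_) (Iio_mem_nhds hc1)
    rw [nhds_coe_circle]
    exact image_mem_map e2
  obtain ⟨θ', ⟨-, w, ⟨h1, hw⟩, h2⟩, h3⟩ := hF.exists_phiPlus_lt hU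
  have h4 := hle w hw
  have h5 : phiPlus a F (ξ, (w : UnitAddCircle)) = phiPlus a F θ' := hF.phiPlus_congr h2
  have h6 : phiPlus a F θ' < c := h3
  linarith

/-- A violation would be an open condition along the leaf, hence would occur at points of full
measure nearby. The endpoints cause no difficulty here. -/
theorem IsBakerDrivenSystem.phiPlusMinus_le_leaf (hF : IsBakerDrivenSystem a F iL iU jL jU)
    {m : Measure UnitAddCircle}
    (hpos : ∀ s t : ℝ, 0 ≤ s → s < t → t ≤ 1 → 0 < m {x | s < rep x ∧ rep x < t})
    {ξ : UnitAddCircle} {l : ℝ → ℝ} (hl : ContinuousOn l (Set.Icc 0 1))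
    (h : ∀ᵐ x ∂m, phiPlusMinus a F (ξ, x) ≤ l (rep x)) {u : ℝ} (hu : u ∈ Set.Icc (0 : ℝ) 1) :
    phiPlusMinus a F (ξ, (u : UnitAddCircle)) ≤ l u := by
  by_contra! hlt
  have hc : ContinuousWithinAt (fun w : ℝ => ((ξ, (w : UnitAddCircle)), l w)) (Set.Icc 0 1) u :=
    ContinuousWithinAt.prodMk (Continuous.continuousWithinAt (by fun_prop)) (hl u hu)
  have h1 : {w : ℝ | l w < phiPlusMinus a F (ξ, (w : UnitAddCircle))} ∈ 𝓝[Set.Icc 0 1] u :=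
    hc.preimage_mem_nhdsWithin (hF.isOpen_lt_phiPlusMinus.mem_nhds hlt)
  obtain ⟨V, hV, hVs⟩ := mem_nhdsWithin_iff_exists_mem_nhds_inter.1 h1
  obtain ⟨w, h2, hw, h3⟩ := mem_closure_iff_nhds.1
    (mem_closure_of_ae hpos h le_rfl one_pos le_rfl hu) V hV
  rw [rep_coe hw.1.le hw.2] at h3
  exact absurd (hVs ⟨h2, Set.Ioo_subset_Icc_self hw⟩) (not_lt.2 h3)

/-- The lower Gibbs bound charges both cylinders of length one, so a generic `ξ` exists on either
side of `a`. -/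
theorem IsGibbs.exists_side [IsFiniteMeasure ν] (hG : IsGibbs a ν) {P : UnitAddCircle → Prop}
    (hP : ∀ᵐ ξ ∂(ν.map Prod.fst), P ξ) (ξ₀ : UnitAddCircle) :
    ∃ ξ, (rep ξ < a ↔ rep ξ₀ < a) ∧ P ξ := by
  obtain ⟨-, ψ, -, Q, K, hK, hG⟩ := hG
  have h1 := (hG 1 (ξ₀, 0)).1
  have h2 : 0 < ν {θ' | SameItinerary a 1 ξ₀ θ'.1} := by
    refine pos_iff_ne_zero.2 fun h => ?_
    rw [measureReal_def, h, ENNReal.toReal_zero] at h1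
    exact absurd h1 (not_le.2 (by positivity))
  obtain ⟨θ, hθ, hPθ⟩ := exists_mem_of_measure_pos h2 (ae_of_ae_map measurable_fst.aemeasurable hP)
  exact ⟨θ.1, (hθ 0 one_pos).symm, hPθ⟩

theorem skewI_iterate_contraction (h0 : 0 < a) (h1 : a < 1) (F : UnitAddCircle → ℝ → ℝ) (n : ℕ)
    (ξ x y x' y' : ℝ) :
    |((skewI a F)^[n] (ξ, x, y)).2.1 - ((skewI a F)^[n] (ξ, x', y')).2.1| ≤
      max a (1 - a) ^ n * |x - x'| := by
  induction n generalizing ξ x y x' y' with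
  | zero => simp
  | succ n ih =>
    rw [Function.iterate_succ_apply, Function.iterate_succ_apply, skewI_eq, skewI_eq]
    refine (ih _ _ _ _ _).trans ?_
    rw [add_sub_add_right_eq_sub, ← mul_sub, abs_mul, abs_of_pos (sigmaRate_pos h0 h1 ξ), pow_succ,
      mul_assoc]
    have := sigmaRate_le (a := a) ξ
    have := (max_rate_pos (a := a) h0).le
    gcongr

/-- The region above the graph of `φ⁺⁻` is forward invariant. -/
theorem IsBakerDrivenSystem.phiPlusMinus_le_skewI (hF : IsBakerDrivenSystem a F iL iU jL jU)
    (ζ : UnitAddCircle) {ξ x y : ℝ} (hx : x ∈ Set.Icc (0 : ℝ) 1)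
    (h : phiPlusMinus a F (ζ, (x : UnitAddCircle)) ≤ y) (n : ℕ) :
    phiPlusMinus a F (ζ, (((skewI a F)^[n] (ξ, x, y)).2.1 : UnitAddCircle)) ≤
      ((skewI a F)^[n] (ξ, x, y)).2.2 := by
  induction n generalizing ξ x y with
  | zero => exact h
  | succ n ih =>
    rw [Function.iterate_succ_apply, skewI_eq]
    refine ih (branch_mem_Icc hF.a_pos hF.a_lt_one ξ hx) ?_
    exact (hF.phiPlusMinus_le_pull (θ' := (ζ, (x : UnitAddCircle)))
      (tau_coe_branch hF.a_pos hF.a_lt_one ξ hx)).trans ((hF.strictMono _).monotone h)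

/-- If an invariant graph that is carried by leaves is below `φ⁺⁻` with positive probability, then
almost all these leaves are strictly below `φ⁺⁻`. -/
theorem IsBakerDrivenSystem.ae_leaf_lt_phiPlusMinus [IsProbabilityMeasure ν]
    [ProbabilityTheory.IsMarkovKernel κ] (hF : IsBakerDrivenSystem a F iL iU jL jU)
    (hν : Ergodic (baker a) ν) (hκ : (ν.map Prod.fst).compProd κ = ν)
    (hφ : IsInvariantGraph a F jL jU φ) {ell : UnitAddCircle → ℝ → ℝ}
    (hell : ∀ᵐ ξ ∂(ν.map Prod.fst), IsLeafOn a F jL jU (rep ξ) (Set.Icc 0 1) (ell ξ) ∧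
      Set.MapsTo (ell ξ) (Set.Icc 0 1) (Set.Icc jL jU) ∧
      ∀ᵐ x ∂(κ ξ), ell ξ (rep x) = φ (ξ, x))
    (hlt : ¬ ∀ᵐ θ ∂ν, phiPlusMinus a F θ ≤ φ θ) :
    ∀ᵐ ξ ∂(ν.map Prod.fst), ∀ u ∈ Set.Icc (0 : ℝ) 1,
      ell ξ u < phiPlusMinus a F (ξ, (u : UnitAddCircle)) := by
  have hprob : IsProbabilityMeasure (ν.map Prod.fst) :=
    Measure.isProbabilityMeasure_map measurable_fst.aemeasurable
  have hgm : Measurable fun θ : UnitAddCircle × UnitAddCircle => (θ, φ θ) :=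
    measurable_id.prodMk hφ.measurable
  set O := {p : (UnitAddCircle × UnitAddCircle) × ℝ | p.2 < phiPlusMinus a F p.1} with hO
  have hOo : IsOpen O := hF.isOpen_lt_phiPlusMinus
  have hpos : 0 < graphMeasure ν φ O := by
    rw [graphMeasure, Measure.map_apply hgm hOo.measurableSet, pos_iff_ne_zero]
    intro h
    refine hlt (measure_mono_null (fun θ hθ => ?_) h)
    exact not_le.1 (show ¬ phiPlusMinus a F θ ≤ φ θ from hθ)
  -- A compact piece of the open region with a whole thickening inside the region. The orbit of the
  -- graph visits it infinitely often, and eventually the orbit of any other point of the leaf is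
  -- within the thickening at such times.
  obtain ⟨S, hSO, hS, hSpos⟩ := hOo.exists_lt_isCompact hpos
  obtain ⟨δ, hδ0, hδ⟩ := hS.exists_thickening_subset_open hOo hSO
  have hvisit := hν.ae_frequently_mem (hgm hS.measurableSet) (by
    rw [graphMeasure, Measure.map_apply hgm hS.measurableSet] at hSpos
    exact hSpos.ne')
  rw [← hκ] at hvisit
  obtain ⟨C, hC0, hC⟩ := hF.exists_leaf_contraction
  have hs0 := max_rate_pos (a := a) hF.a_pos
  filter_upwards [hell, Measure.ae_ae_of_ae_compProd hvisit] with ξ ⟨hl, hJ, hx⟩ hv u hu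
  by_contra! hge
  obtain ⟨x, hlx, hvx⟩ := (hx.and hv).exists
  have hlim : Tendsto (fun n : ℕ => (C + 1) * max a (1 - a) ^ n) atTop (𝓝 0) := by
    have := (tendsto_pow_atTop_nhds_zero_of_lt_one hs0.le
      (max_rate_lt_one hF.a_pos hF.a_lt_one)).const_mul (C + 1)
    simpa using this
  obtain ⟨n, hnS, hn⟩ := (hvx.and_eventually (hlim.eventually (gt_mem_nhds hδ0))).exists
  have hux : |u - rep x| ≤ 1 := by
    rw [abs_le]; constructor <;> linarith [hu.1, hu.2, rep_nonneg x, rep_lt_one x]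
  have c1 := hC n (rep ξ) _ (ell ξ) subset_rfl Set.ordConnected_Icc hJ hl u hu _ (rep_mem_Icc x)
  have c2 := skewI_iterate_contraction hF.a_pos hF.a_lt_one F n (rep ξ) u (ell ξ u) (rep x)
    (ell ξ (rep x))
  -- Since `φ⁺⁻` does not depend on `ξ`, the first coordinate may be replaced by that of the `n`-th
  -- iterate, where the comparison with `S` takes place.
  have hge' : phiPlusMinus a F (((baker a)^[n] (ξ, x)).1, (u : UnitAddCircle)) ≤ ell ξ u :=
    le_of_eq_of_le (hF.phiPlusMinus_congr (θ := (((baker a)^[n] (ξ, x)).1, (u : UnitAddCircle)))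
      (θ' := (ξ, (u : UnitAddCircle))) rfl) hge
  have c3 := hF.phiPlusMinus_le_skewI ((baker a)^[n] (ξ, x)).1 (ξ := rep ξ) hu
    (y := ell ξ u) hge' n
  have e := skewI_iterate_rep hF.a_pos hF.a_lt_one F n (ξ, x) (ell ξ (rep x))
  rw [hlx, hφ.iterate] at e
  rw [hlx, e] at c1 c2
  simp only at c1 c2
  set p := (skewI a F)^[n] (rep ξ, u, ell ξ u)
  have hpow : 0 < max a (1 - a) ^ n := pow_pos hs0 n
  have b1 : max a (1 - a) ^ n * |u - rep x| ≤ (C + 1) * max a (1 - a) ^ n := by nlinarith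
  have b2 : C * max a (1 - a) ^ n * |u - rep x| ≤ (C + 1) * max a (1 - a) ^ n := by
    have := mul_le_of_le_one_right (mul_nonneg hC0.le hpow.le) hux
    linarith
  have hmem : ((((baker a)^[n] (ξ, x)).1, (p.2.1 : UnitAddCircle)), p.2.2) ∈
      Metric.thickening δ S := by
    refine Metric.mem_thickening_iff.2 ⟨_, hnS, ?_⟩
    rw [Prod.dist_eq, max_lt_iff, Prod.dist_eq, max_lt_iff, dist_self, Real.dist_eq]
    refine ⟨⟨hδ0, ?_⟩, (c1.trans b2).trans_lt hn⟩
    rw [← coe_rep ((baker a)^[n] (ξ, x)).2]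
    exact ((dist_coe_le _ _).trans (c2.trans b1)).trans_lt hn
  exact absurd (hδ hmem) (not_lt.2 c3)

/-- If an invariant graph that is carried by leaves is not below `φ⁺⁻`, then it coincides with
`φ⁺⁻`, and so do the leaves. -/
theorem IsBakerDrivenSystem.ae_leaf_eq_phiPlusMinus [IsProbabilityMeasure ν]
    [ProbabilityTheory.IsMarkovKernel κ] (hF : IsBakerDrivenSystem a F iL iU jL jU)
    (hν : Ergodic (baker a) ν) (hG : IsGibbs a ν) (hκ : (ν.map Prod.fst).compProd κ = ν)
    (hφ : IsInvariantGraph a F jL jU φ) (hφle : ∀ θ, φ θ ≤ phiPlus a F θ)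
    {ell : UnitAddCircle → ℝ → ℝ}
    (hell : ∀ᵐ ξ ∂(ν.map Prod.fst), ContinuousOn (ell ξ) (Set.Icc 0 1) ∧
      ∀ᵐ x ∂(κ ξ), ell ξ (rep x) = φ (ξ, x))
    (hle : ∀ᵐ θ ∂ν, phiPlusMinus a F θ ≤ φ θ) :
    (∀ᵐ θ ∂ν, φ θ = phiPlusMinus a F θ) ∧
    ∀ᵐ ξ ∂(ν.map Prod.fst), ∀ u ∈ Set.Icc (0 : ℝ) 1,
      ell ξ u = phiPlusMinus a F (ξ, (u : UnitAddCircle)) := by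
  have hprob : IsProbabilityMeasure (ν.map Prod.fst) :=
    Measure.isProbabilityMeasure_map measurable_fst.aemeasurable
  have hsplit : ∀ {P : UnitAddCircle × UnitAddCircle → Prop}, (∀ᵐ θ ∂ν, P θ) →
      ∀ᵐ ξ ∂(ν.map Prod.fst), ∀ᵐ x ∂(κ ξ), P (ξ, x) := by
    intro P hP
    rw [← hκ] at hP
    exact Measure.ae_ae_of_ae_compProd hP
  have hjoin : ∀ {P : UnitAddCircle × UnitAddCircle → Prop}, MeasurableSet {θ | P θ} →
      (∀ᵐ ξ ∂(ν.map Prod.fst), ∀ᵐ x ∂(κ ξ), P (ξ, x)) → ∀ᵐ θ ∂ν, P θ := by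
    intro P hm hP
    rw [← hκ]
    exact Measure.ae_compProd_of_ae_ae hm hP
  have hpos := hG.ae_pos hF.a_pos hF.a_lt_one hκ
  have hint : ∀ᵐ ξ ∂(ν.map Prod.fst), ∀ u ∈ Set.Ioo (0 : ℝ) 1,
      ell ξ u = phiPlusMinus a F (ξ, (u : UnitAddCircle)) := by
    filter_upwards [hell, hpos, hsplit hle] with ξ ⟨hc, hx⟩ hp hm u hu
    refine le_antisymm (hF.leaf_le_phiPlusMinus hp hc (hx.mono fun x h => h ▸ hφle _) hu)
      (hF.phiPlusMinus_le_leaf hp hc ?_ (Set.Ioo_subset_Icc_self hu))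
    filter_upwards [hx, hm] with x h1 h2
    rwa [h1]
  -- So far the leaf is identified over the open interval only, so the points over `x = 0` are left
  -- out.
  have heq0 : ∀ᵐ θ ∂ν, rep θ.2 ≠ 0 → φ θ = phiPlusMinus a F θ := by
    refine hjoin ?_ ?_
    · have h1 : MeasurableSet {θ : UnitAddCircle × UnitAddCircle | rep θ.2 = 0} :=
        measurableSet_eq_fun (measurable_rep.comp measurable_snd) measurable_const
      have h2 := measurableSet_eq_fun hφ.measurable hF.measurable_phiPlusMinus
      convert h1.union h2 using 1
      ext θ
      simp only [Set.mem_ofPred_eq, Set.mem_union]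
      tauto
    · filter_upwards [hint, hell] with ξ h1 ⟨_, h2⟩
      filter_upwards [h2] with x hx hx0
      rw [← hx, h1 _ ⟨lt_of_le_of_ne (rep_nonneg x) (Ne.symm hx0), rep_lt_one x⟩, coe_rep]
  -- the leaf over `ξ` contains its image under the fibre maps
  have himg : ∀ᵐ ξ ∂(ν.map Prod.fst), ∀ u ∈ Set.Icc (0 : ℝ) 1,
      F (u : UnitAddCircle) (ell ξ u) =
        ell ξ (sigmaRate a (rep ξ) * u + branchOffset a (rep ξ)) := by
    filter_upwards [hell, hpos, hint,
      hsplit (hν.toMeasurePreserving.quasiMeasurePreserving.ae heq0)] with ξ ⟨hc, hx⟩ hp hi hT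
    have hb : ∀ u ∈ Set.Icc (0 : ℝ) 1,
        sigmaRate a (rep ξ) * u + branchOffset a (rep ξ) ∈ Set.Icc (0 : ℝ) 1 := fun u hu =>
      branch_mem_Icc hF.a_pos hF.a_lt_one _ hu
    have hae : ∀ᵐ x ∂(κ ξ), rep x ∈ Set.Ioo (0 : ℝ) 1 → F x (ell ξ (rep x)) =
        ell ξ (sigmaRate a (rep ξ) * rep x + branchOffset a (rep ξ)) := by
      filter_upwards [hx, hT] with x h1 h2 hx0
      have hr := rep_baker_snd hF.a_pos hF.a_lt_one (ξ, x)
      have hpos' : 0 < sigmaRate a (rep ξ) * rep x + branchOffset a (rep ξ) :=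
        add_pos_of_pos_of_nonneg (mul_pos (sigmaRate_pos hF.a_pos hF.a_lt_one _) hx0.1)
          (branchOffset_nonneg hF.a_pos _)
      have hlt1 := (branch_mem_Ico hF.a_pos hF.a_lt_one (rep ξ) ⟨hx0.1.le, hx0.2⟩).2
      rw [h1, hi _ ⟨hpos', hlt1⟩, ← hφ.baker (ξ, x), h2 (by rw [hr]; exact hpos'.ne')]
      exact hF.phiPlusMinus_congr (by rw [baker_snd])
    have hEq : Set.EqOn (fun u : ℝ => F (u : UnitAddCircle) (ell ξ u))
        (fun u => ell ξ (sigmaRate a (rep ξ) * u + branchOffset a (rep ξ)))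
        {v | v ∈ Set.Ioo (0 : ℝ) 1 ∧ (fun x : UnitAddCircle => rep x ∈ Set.Ioo (0 : ℝ) 1 →
          F x (ell ξ (rep x)) =
          ell ξ (sigmaRate a (rep ξ) * rep x + branchOffset a (rep ξ))) (v : UnitAddCircle)} := by
      rintro v ⟨hv, h⟩
      simp only [rep_coe hv.1.le hv.2] at h
      exact h hv
    refine hEq.of_subset_closure (t := Set.Icc 0 1) ?_ ?_
      (fun v hv => Set.Ioo_subset_Icc_self hv.1)
      (fun u hu => mem_closure_of_ae hp hae le_rfl one_pos le_rfl hu)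
    · exact hF.continuous.comp_continuousOn (f := fun u : ℝ => ((u : UnitAddCircle), ell ξ u))
        (continuous_coe_circle.continuousOn.prodMk hc)
    · exact hc.comp (by fun_prop) hb
  -- An endpoint that the branch sends to an interior point is controlled there, and the bound is
  -- pulled back by monotonicity of the fibre map.
  have hbd : ∀ {ξ : UnitAddCircle} {u : ℝ}, u ∈ Set.Icc (0 : ℝ) 1 →
      (∀ u ∈ Set.Ioo (0 : ℝ) 1, ell ξ u = phiPlusMinus a F (ξ, (u : UnitAddCircle))) →
      F (u : UnitAddCircle) (ell ξ u) =
        ell ξ (sigmaRate a (rep ξ) * u + branchOffset a (rep ξ)) →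
      sigmaRate a (rep ξ) * u + branchOffset a (rep ξ) ∈ Set.Ioo (0 : ℝ) 1 →
      ell ξ u ≤ phiPlusMinus a F (ξ, (u : UnitAddCircle)) := by
    intro ξ u hu hi h1 h2
    rw [hi _ h2] at h1
    refine (hF.strictMono (u : UnitAddCircle)).le_iff_le.1 (h1.trans_le ?_)
    exact hF.phiPlusMinus_le_pull (θ := (ξ, _)) (θ' := (ξ, (u : UnitAddCircle)))
      (tau_coe_branch hF.a_pos hF.a_lt_one _ hu)
  have hall := (hell.and hint).and himg
  -- The left branch sends `1` to `a` and the right branch sends `0` to `a`, so one generic `ξ` on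
  -- each side settles both endpoints.
  obtain ⟨ξ₀, hs₀, ⟨⟨hc₀, -⟩, hi₀⟩, him₀⟩ := hG.exists_side hall ((0 : ℝ) : UnitAddCircle)
  obtain ⟨ξ₁, hs₁, ⟨⟨hc₁, -⟩, hi₁⟩, him₁⟩ := hG.exists_side hall (a : UnitAddCircle)
  have hside₀ : rep ξ₀ < a := hs₀.2 (by rw [rep_coe le_rfl one_pos]; exact hF.a_pos)
  have hside₁ : ¬ rep ξ₁ < a := fun h => by
    have := hs₁.1 h
    rw [rep_coe hF.a_pos.le hF.a_lt_one] at this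
    exact lt_irrefl _ this
  have hone : ell ξ₀ 1 ≤ phiPlusMinus a F (ξ₀, ((1 : ℝ) : UnitAddCircle)) := by
    refine hbd (by simp) hi₀ (him₀ 1 (by simp)) ?_
    simp [sigmaRate, branchOffset, hside₀, hF.a_pos, hF.a_lt_one]
  have hzero : ell ξ₁ 0 ≤ phiPlusMinus a F (ξ₁, ((0 : ℝ) : UnitAddCircle)) := by
    refine hbd (by simp) hi₁ (him₁ 0 (by simp)) ?_
    simp [branchOffset, hside₁, hF.a_pos, hF.a_lt_one]
  have hglob : ∀ᵐ ξ ∂(ν.map Prod.fst), ∀ u ∈ Set.Icc (0 : ℝ) 1,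
      ell ξ u = phiPlusMinus a F (ξ, (u : UnitAddCircle)) := by
    filter_upwards [hell, hpos, hint, hsplit hle] with ξ ⟨hc, hx⟩ hp hi hm u hu
    -- All these leaves agree with `φ⁺⁻` on the interior, which does not depend on `ξ`, and hence by
    -- continuity with each other up to the endpoints.
    have hEqOn : ∀ {ζ}, ContinuousOn (ell ζ) (Set.Icc 0 1) →
        (∀ u ∈ Set.Ioo (0 : ℝ) 1, ell ζ u = phiPlusMinus a F (ζ, (u : UnitAddCircle))) →
        Set.EqOn (ell ξ) (ell ζ) (Set.Icc 0 1) := by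
      intro ζ hcζ hζ
      have : Set.EqOn (ell ξ) (ell ζ) (Set.Ioo 0 1) := fun v hv => by
        rw [hi v hv, hζ v hv]
        exact hF.phiPlusMinus_congr rfl
      exact this.of_subset_closure hc hcζ Set.Ioo_subset_Icc_self
        (by rw [closure_Ioo (zero_ne_one)])
    refine le_antisymm ?_ (hF.phiPlusMinus_le_leaf hp hc ?_ hu)
    · rcases hu.1.eq_or_lt with rfl | h0
      · rw [hEqOn hc₁ hi₁ hu]
        exact hzero.trans_eq (hF.phiPlusMinus_congr rfl)
      rcases hu.2.eq_or_lt with rfl | h1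
      · rw [hEqOn hc₀ hi₀ hu]
        exact hone.trans_eq (hF.phiPlusMinus_congr rfl)
      exact (hi u ⟨h0, h1⟩).le
    · filter_upwards [hx, hm] with x h1 h2
      rwa [h1]
  refine ⟨hjoin (measurableSet_eq_fun hφ.measurable hF.measurable_phiPlusMinus) ?_, hglob⟩
  filter_upwards [hglob, hell] with ξ h1 ⟨_, h2⟩
  filter_upwards [h2] with x hx
  rw [← hx, h1 _ (rep_mem_Icc x), coe_rep]

end PhiPlusMinus

/-! ### Reflection of the strong stable direction field -/

section Reflection

variable {a : ℝ} {F : UnitAddCircle → ℝ → ℝ} {iL iU jL jU : ℝ}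
  {ν : Measure (UnitAddCircle × UnitAddCircle)}
  {κ : ProbabilityTheory.Kernel UnitAddCircle UnitAddCircle}
  {φ : UnitAddCircle × UnitAddCircle → ℝ}

theorem skewI_reflect_iterate (n : ℕ) (ξ x y : ℝ) :
    (skewI a (reflectFibre F))^[n] (ξ, x, y) =
      (((skewI a F)^[n] (ξ, x, -y)).1, ((skewI a F)^[n] (ξ, x, -y)).2.1,
        -((skewI a F)^[n] (ξ, x, -y)).2.2) := by
  induction n with
  | zero => simp
  | succ n ih =>
    rw [Function.iterate_succ_apply', Function.iterate_succ_apply', ih, skewI_eq]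
    conv_rhs => rw [← Prod.mk.eta (p := (skewI a F)^[n] (ξ, x, -y)),
      ← Prod.mk.eta (p := ((skewI a F)^[n] (ξ, x, -y)).2), skewI_eq]
    simp [reflectFibre]

theorem gammaRatio_reflect (p : ℝ × ℝ × ℝ) :
    gammaRatio a (reflectFibre F) (p.1, p.2.1, -p.2.2) = gammaRatio a F p := by
  simp [gammaRatio, deriv_reflect]

theorem slopeTerm_reflect (p : ℝ × ℝ × ℝ) :
    slopeTerm (reflectFibre F) (p.1, p.2.1, -p.2.2) = -slopeTerm F p := by
  simp only [slopeTerm, deriv_reflect, reflectFibre, neg_neg, deriv.fun_neg, neg_div]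

theorem X3_reflect (ξ x y : ℝ) : X3 a (reflectFibre F) ξ x (-y) = -X3 a F ξ x y := by
  unfold X3
  simp only [skewI_reflect_iterate, neg_neg, gammaRatio_reflect, slopeTerm_reflect, mul_neg,
    tsum_neg]

theorem IsLeafOn.reflect {ξ : ℝ} {D : Set ℝ} {l : ℝ → ℝ} (hl : IsLeafOn a F jL jU ξ D l)
    (hJ : Set.MapsTo l D (Set.Icc jL jU)) :
    IsLeafOn a (reflectFibre F) (-jU) (-jL) ξ D fun t => -l t := by
  intro t ht
  have h1 := (hl t ht).neg
  rw [fibreField_eq (hJ ht), ← X3_reflect] at h1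
  have hm : -l t ∈ Set.Icc (-jU) (-jL) := ⟨neg_le_neg (hJ ht).2, neg_le_neg (hJ ht).1⟩
  rw [fibreField_eq hm]
  exact h1

theorem IsInvariantGraph.reflect (hφ : IsInvariantGraph a F jL jU φ) :
    IsInvariantGraph a (reflectFibre F) (-jU) (-jL) fun θ => -φ θ :=
  ⟨hφ.measurable.neg, fun θ => ⟨neg_le_neg (hφ.mem θ).2, neg_le_neg (hφ.mem θ).1⟩, fun θ => by
    simp only [hφ.baker, reflectFibre, neg_neg]⟩

theorem IsBakerDrivenSystem.ae_phiMinusPlus_lt_leaf [IsProbabilityMeasure ν]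
    [ProbabilityTheory.IsMarkovKernel κ] (hF : IsBakerDrivenSystem a F iL iU jL jU)
    (hν : Ergodic (baker a) ν) (hκ : (ν.map Prod.fst).compProd κ = ν)
    (hφ : IsInvariantGraph a F jL jU φ) {ell : UnitAddCircle → ℝ → ℝ}
    (hell : ∀ᵐ ξ ∂(ν.map Prod.fst), IsLeafOn a F jL jU (rep ξ) (Set.Icc 0 1) (ell ξ) ∧
      Set.MapsTo (ell ξ) (Set.Icc 0 1) (Set.Icc jL jU) ∧
      ∀ᵐ x ∂(κ ξ), ell ξ (rep x) = φ (ξ, x))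
    (hlt : ¬ ∀ᵐ θ ∂ν, φ θ ≤ phiMinusPlus a F θ) :
    ∀ᵐ ξ ∂(ν.map Prod.fst), ∀ u ∈ Set.Icc (0 : ℝ) 1,
      phiMinusPlus a F (ξ, (u : UnitAddCircle)) < ell ξ u := by
  have := hF.reflect.ae_leaf_lt_phiPlusMinus hν hκ hφ.reflect (ell := fun ξ u => -ell ξ u)
    (hell.mono fun ξ h => ⟨h.1.reflect h.2.1, fun u hu =>
      ⟨neg_le_neg (h.2.1 hu).2, neg_le_neg (h.2.1 hu).1⟩, h.2.2.mono fun x hx => by simp only [hx]⟩)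
    (by simpa only [phiPlusMinus_reflect, neg_le_neg_iff] using hlt)
  simpa only [phiPlusMinus_reflect, neg_lt_neg_iff] using this

theorem IsBakerDrivenSystem.ae_leaf_eq_phiMinusPlus [IsProbabilityMeasure ν]
    [ProbabilityTheory.IsMarkovKernel κ] (hF : IsBakerDrivenSystem a F iL iU jL jU)
    (hν : Ergodic (baker a) ν) (hG : IsGibbs a ν) (hκ : (ν.map Prod.fst).compProd κ = ν)
    (hφ : IsInvariantGraph a F jL jU φ) (hφle : ∀ θ, phiMinus a F θ ≤ φ θ)
    {ell : UnitAddCircle → ℝ → ℝ}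
    (hell : ∀ᵐ ξ ∂(ν.map Prod.fst), ContinuousOn (ell ξ) (Set.Icc 0 1) ∧
      ∀ᵐ x ∂(κ ξ), ell ξ (rep x) = φ (ξ, x))
    (hle : ∀ᵐ θ ∂ν, φ θ ≤ phiMinusPlus a F θ) :
    (∀ᵐ θ ∂ν, φ θ = phiMinusPlus a F θ) ∧
    ∀ᵐ ξ ∂(ν.map Prod.fst), ∀ u ∈ Set.Icc (0 : ℝ) 1,
      ell ξ u = phiMinusPlus a F (ξ, (u : UnitAddCircle)) := by
  have := hF.reflect.ae_leaf_eq_phiPlusMinus hν hG hκ hφ.reflect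
    (fun θ => by rw [phiPlus_reflect]; exact neg_le_neg (hφle θ)) (ell := fun ξ u => -ell ξ u)
    (hell.mono fun ξ h => ⟨h.1.neg, h.2.mono fun x hx => by simp only [hx]⟩)
    (by simpa only [phiPlusMinus_reflect, neg_le_neg_iff] using hle)
  simpa only [phiPlusMinus_reflect, neg_inj] using this

end Reflection

/-! ### The three cases -/

section Cases

variable {a : ℝ} {F : UnitAddCircle → ℝ → ℝ} {iL iU jL jU : ℝ}
  {ν : Measure (UnitAddCircle × UnitAddCircle)}

theorem IsInvariantLift.ae {μ : Measure ((UnitAddCircle × UnitAddCircle) × ℝ)}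
    (hμ : IsInvariantLift a F ν μ) {P : UnitAddCircle × UnitAddCircle → Prop}
    (h : ∀ᵐ θ ∂ν, P θ) : ∀ᵐ p ∂μ, P p.1 :=
  ae_of_ae_map measurable_fst.aemeasurable (hμ.2.symm ▸ h)

/-- Invariant lifts live on `φ⁻`, `φ*`, `φ⁺`, and here `φ*` avoids both filled closures almost
everywhere, so each closure supports only its own bounding graph. The strict inequalities exclude
the two degenerate alternatives of the trichotomy. -/
theorem IsBakerDrivenSystem.caseA1 [IsProbabilityMeasure ν]
    (hF : IsBakerDrivenSystem a F iL iU jL jU)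
    (hA : filledClosure (phiPlus a F) ∩ filledClosure (phiMinus a F) = ∅)
    (hν : Ergodic (baker a) ν) {ell : UnitAddCircle → ℝ → ℝ}
    (hup : ∀ᵐ θ ∂ν, phiStar a F θ < phiPlusMinus a F θ)
    (hlo : ∀ᵐ θ ∂ν, phiMinusPlus a F θ < phiStar a F θ)
    (hup' : ∀ᵐ ξ ∂(ν.map Prod.fst), ∀ u ∈ Set.Icc (0 : ℝ) 1,
      ell ξ u < phiPlusMinus a F (ξ, (u : UnitAddCircle)))
    (hlo' : ∀ᵐ ξ ∂(ν.map Prod.fst), ∀ u ∈ Set.Icc (0 : ℝ) 1,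
      phiMinusPlus a F (ξ, (u : UnitAddCircle)) < ell ξ u) :
    CaseA1 a F ν fun ξ => (fun u : ℝ => (u, ell ξ u)) '' Set.Icc 0 1 := by
  obtain ⟨hconv, htri⟩ := hF.trichotomy hA hν
  have hM := hF.isInvariantGraph_phiMinus
  have hP := hF.isInvariantGraph_phiPlus
  refine ⟨fun μ => ⟨fun ⟨hμ, hc⟩ => ?_, ?_⟩, fun μ => ⟨fun ⟨hμ, hc⟩ => ?_, ?_⟩, ?_, ?_⟩
  · refine eq_graphMeasure hP.measurable hμ.2 ?_
    filter_upwards [hF.ae_mem_graphs hconv hμ, hμ.ae hup, mem_ae_iff.2 hc] with p h1 h2 h3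
    have h4 := ((hF.mem_filledClosure p).1 h3).1
    have h5 := hF.phiMinus_le_phiMinusPlus p.1
    have h6 := hF.phiMinusPlus_lt hA p.1
    rcases h1 with h | h | h
    · linarith
    · linarith
    · exact h
  · rintro rfl
    refine ⟨(hP.mono hF).isInvariantLift hF hν.toMeasurePreserving, ?_⟩
    rw [ae_graphMeasure_iff hP.measurable hF.isClosed_filledClosure.measurableSet]
    exact ae_of_all _ fun θ => (hF.mem_filledClosure _).2 ⟨hF.phiPlusMinus_le θ, le_rfl⟩
  · refine eq_graphMeasure hM.measurable hμ.2 ?_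
    filter_upwards [hF.ae_mem_graphs hconv hμ, hμ.ae hlo, mem_ae_iff.2 hc] with p h1 h2 h3
    have h4 := ((hF.mem_filledClosure_phiMinus p).1 h3).2
    have h5 := hF.phiPlusMinus_le p.1
    have h6 := hF.phiMinusPlus_lt hA p.1
    rcases h1 with h | h | h
    · exact h
    · linarith
    · linarith
  · rintro rfl
    refine ⟨(hM.mono hF).isInvariantLift hF hν.toMeasurePreserving, ?_⟩
    rw [ae_graphMeasure_iff hM.measurable hF.isClosed_filledClosure_phiMinus.measurableSet]
    exact ae_of_all _ fun θ =>
      (hF.mem_filledClosure_phiMinus _).2 ⟨le_rfl, hF.phiMinus_le_phiMinusPlus θ⟩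
  · filter_upwards [hup', hlo'] with ξ h1 h2
    rintro _ ⟨u, hu, rfl⟩
    rw [hF.mem_filledClosure, hF.mem_filledClosure_phiMinus]
    exact ⟨fun h => absurd h.1 (not_le.2 (h1 u hu)), fun h => absurd h.2 (not_le.2 (h2 u hu))⟩
  · rcases htri with ⟨-, h⟩ | ⟨h, -⟩ | ⟨h, -⟩
    · exact h
    · obtain ⟨θ, h1, h2⟩ := (h.and hup).exists
      linarith [hF.phiPlusMinus_le θ]
    · obtain ⟨θ, h1, h2⟩ := (h.and hlo).exists
      linarith [hF.phiMinus_le_phiMinusPlus θ]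

theorem IsBakerDrivenSystem.lift_filledClosure (hF : IsBakerDrivenSystem a F iL iU jL jU)
    [IsProbabilityMeasure ν]
    (hA : filledClosure (phiPlus a F) ∩ filledClosure (phiMinus a F) = ∅)
    (hν : Ergodic (baker a) ν)
    (hS : ∀ᵐ θ ∂ν, (θ, phiStar a F θ) ∈ filledClosure (phiPlus a F) ∪ filledClosure (phiMinus a F))
    {μ : Measure ((UnitAddCircle × UnitAddCircle) × ℝ)} (hμ : IsInvariantLift a F ν μ) :
    μ (filledClosure (phiPlus a F) ∪ filledClosure (phiMinus a F))ᶜ = 0 := by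
  obtain ⟨hconv, -⟩ := hF.trichotomy hA hν
  rw [← mem_ae_iff]
  filter_upwards [hF.ae_mem_graphs hconv hμ, hμ.ae hS]
  rintro ⟨θ, y⟩ (h | h | h) h2
  · right
    exact (hF.mem_filledClosure_phiMinus _).2 ⟨h.ge, h.trans_le (hF.phiMinus_le_phiMinusPlus θ)⟩
  · simp only at h h2
    rwa [h]
  · left
    exact (hF.mem_filledClosure _).2 ⟨(hF.phiPlusMinus_le θ).trans h.ge, h.le⟩

theorem graphMeasure_range {φ ψ : UnitAddCircle × UnitAddCircle → ℝ} (hφ : Measurable φ)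
    (hψ : Measurable ψ) (h : ∀ᵐ θ ∂ν, φ θ = ψ θ) :
    graphMeasure ν φ (Set.range fun θ => (θ, ψ θ))ᶜ = 0 := by
  have hr : (Set.range fun θ => (θ, ψ θ)) = {p | p.2 = ψ p.1} := by
    ext ⟨θ, y⟩
    simp [eq_comm]
  have hm : MeasurableSet {p : (UnitAddCircle × UnitAddCircle) × ℝ | p.2 = ψ p.1} :=
    measurableSet_eq_fun measurable_snd (hψ.comp measurable_fst)
  rw [hr, ae_graphMeasure_iff hφ hm]
  exact h

theorem graphExponent_congr {φ ψ : UnitAddCircle × UnitAddCircle → ℝ}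
    (h : ∀ᵐ θ ∂ν, φ θ = ψ θ) : graphExponent F ν φ = graphExponent F ν ψ :=
  integral_congr_ae (h.mono fun θ hθ => by simp only [hθ])

/-- With `φ* = φ⁺⁻`, the alternative `φ* = φ⁻` contradicts the disjointness of the closures. The
remaining alternatives of the trichotomy are (a), where `φ* < φ⁺`, and (b), where `φ* = φ⁺`. -/
theorem IsBakerDrivenSystem.caseA2Plus [IsProbabilityMeasure ν]
    (hF : IsBakerDrivenSystem a F iL iU jL jU)
    (hA : filledClosure (phiPlus a F) ∩ filledClosure (phiMinus a F) = ∅)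
    (hν : Ergodic (baker a) ν) {ell : UnitAddCircle → ℝ → ℝ}
    (heq : ∀ᵐ θ ∂ν, phiStar a F θ = phiPlusMinus a F θ)
    (heq' : ∀ᵐ ξ ∂(ν.map Prod.fst), ∀ u ∈ Set.Icc (0 : ℝ) 1,
      ell ξ u = phiPlusMinus a F (ξ, (u : UnitAddCircle))) :
    CaseA2Plus a F ν fun ξ => (fun u : ℝ => (u, ell ξ u)) '' Set.Icc 0 1 := by
  obtain ⟨-, htri⟩ := hF.trichotomy hA hν
  refine ⟨fun μ hμ => hF.lift_filledClosure hA hν (heq.mono fun θ h => Or.inl ?_) hμ,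
    graphMeasure_range hF.measurable_phiStar hF.measurable_phiPlusMinus heq, ?_, ?_⟩
  · rw [hF.mem_filledClosure]
    exact ⟨h.ge, hF.phiStar_le_phiPlus θ⟩
  · filter_upwards [heq'] with ξ h
    exact Set.image_congr fun u hu => by rw [h u hu]
  · rcases htri with ⟨h, h'⟩ | ⟨h, h1, h2⟩ | ⟨h, -⟩
    · refine Or.inl ⟨?_, h'⟩
      filter_upwards [h, heq] with θ h1 h2
      rw [← h2]
      exact h1.2
    · refine Or.inr ⟨?_, h1, h2, (graphExponent_congr h).trans h2⟩
      filter_upwards [h, heq] with θ h1 h2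
      rw [← h2, h1]
    · obtain ⟨θ, h1, h2⟩ := (h.and heq).exists
      linarith [hF.phiMinus_le_phiMinusPlus θ, hF.phiMinusPlus_lt hA θ]

theorem IsBakerDrivenSystem.caseA2Minus [IsProbabilityMeasure ν]
    (hF : IsBakerDrivenSystem a F iL iU jL jU)
    (hA : filledClosure (phiPlus a F) ∩ filledClosure (phiMinus a F) = ∅)
    (hν : Ergodic (baker a) ν) {ell : UnitAddCircle → ℝ → ℝ}
    (heq : ∀ᵐ θ ∂ν, phiStar a F θ = phiMinusPlus a F θ)
    (heq' : ∀ᵐ ξ ∂(ν.map Prod.fst), ∀ u ∈ Set.Icc (0 : ℝ) 1,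
      ell ξ u = phiMinusPlus a F (ξ, (u : UnitAddCircle))) :
    CaseA2Minus a F ν fun ξ => (fun u : ℝ => (u, ell ξ u)) '' Set.Icc 0 1 := by
  obtain ⟨-, htri⟩ := hF.trichotomy hA hν
  refine ⟨fun μ hμ => hF.lift_filledClosure hA hν (heq.mono fun θ h => Or.inr ?_) hμ,
    graphMeasure_range hF.measurable_phiStar hF.measurable_phiMinusPlus heq, ?_, ?_⟩
  · rw [hF.mem_filledClosure_phiMinus]
    exact ⟨hF.phiMinus_le_phiStar θ, h.le⟩
  · filter_upwards [heq'] with ξ h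
    exact Set.image_congr fun u hu => by rw [h u hu]
  · rcases htri with ⟨h, h'⟩ | ⟨h, -⟩ | ⟨h, h1, h2⟩
    · refine Or.inl ⟨?_, h'⟩
      filter_upwards [h, heq] with θ h1 h2
      rw [← h2]
      exact h1.1
    · obtain ⟨θ, h1, h2⟩ := (h.and heq).exists
      linarith [hF.phiPlusMinus_le θ, hF.phiMinusPlus_lt hA θ]
    · refine Or.inr ⟨?_, h1, h2, (graphExponent_congr h).trans h2⟩
      filter_upwards [h, heq] with θ h1 h2
      rw [← h2, h1]

/-- The conditional measures of `ν_φ` on planes project to those of `ν` and are carried by the graph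
of `φ`. -/
theorem planeConditional_graphMeasure [IsProbabilityMeasure ν]
    {φ : UnitAddCircle × UnitAddCircle → ℝ} (hφ : Measurable φ) :
    (ν.map Prod.fst).compProd ((planeConditional (graphMeasure ν φ)).map Prod.fst) = ν ∧
    ∀ᵐ ξ ∂(ν.map Prod.fst), ∀ᵐ p ∂(planeConditional (graphMeasure ν φ) ξ), p.2 = φ (ξ, p.1) := by
  have hgm : Measurable fun θ : UnitAddCircle × UnitAddCircle => (θ, φ θ) :=
    measurable_id.prodMk hφ
  have hgm' : Measurable fun θ : UnitAddCircle × UnitAddCircle => (θ.1, θ.2, φ θ) := by fun_prop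
  have hm : (graphMeasure ν φ).map MeasurableEquiv.prodAssoc = ν.map fun θ => (θ.1, θ.2, φ θ) := by
    rw [graphMeasure, Measure.map_map MeasurableEquiv.prodAssoc.measurable hgm]
    rfl
  have hfst : ((graphMeasure ν φ).map MeasurableEquiv.prodAssoc).fst = ν.map Prod.fst := by
    rw [hm, Measure.fst, Measure.map_map measurable_fst hgm']
    rfl
  have hdis : ((graphMeasure ν φ).map MeasurableEquiv.prodAssoc).fst.compProd
      (planeConditional (graphMeasure ν φ)) = (graphMeasure ν φ).map MeasurableEquiv.prodAssoc :=
    Measure.disintegrate ((graphMeasure ν φ).map MeasurableEquiv.prodAssoc)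
      ((graphMeasure ν φ).map MeasurableEquiv.prodAssoc).condKernel
  rw [hfst] at hdis
  have hprob : IsProbabilityMeasure (ν.map Prod.fst) :=
    Measure.isProbabilityMeasure_map measurable_fst.aemeasurable
  have : ProbabilityTheory.IsMarkovKernel (planeConditional (graphMeasure ν φ)) := by
    unfold planeConditional; infer_instance
  constructor
  · rw [Measure.compProd_map measurable_fst, hdis, hm,
      Measure.map_map (measurable_id.prodMap measurable_fst) hgm']
    exact Measure.map_id
  · have h : ∀ᵐ p ∂((graphMeasure ν φ).map MeasurableEquiv.prodAssoc),
        p.2.2 = φ (p.1, p.2.1) := by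
      have hms : MeasurableSet {p : UnitAddCircle × UnitAddCircle × ℝ | p.2.2 = φ (p.1, p.2.1)} :=
        measurableSet_eq_fun (by fun_prop) (by fun_prop)
      rw [hm, ae_map_iff hgm'.aemeasurable hms]
      exact ae_of_all _ fun θ => rfl
    rw [← hdis] at h
    exact Measure.ae_ae_of_ae_compProd h

end Cases

/-! ### The main theorem -/

theorem mainTheorem2 (a : ℝ) (F : UnitAddCircle → ℝ → ℝ) (iL iU jL jU : ℝ)
    (hF : IsBakerDrivenSystem a F iL iU jL jU)
    (hA : filledClosure (phiPlus a F) ∩ filledClosure (phiMinus a F) = ∅)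
    (ν : Measure (UnitAddCircle × UnitAddCircle)) [IsProbabilityMeasure ν]
    (hν : Ergodic (baker a) ν) (hG : IsGibbs a ν) :
    ∃ γ : UnitAddCircle → Set (ℝ × ℝ),
      (∀ᵐ ξ ∂(ν.map Prod.fst),
        IsStrongStableFibre a F jL jU ξ (γ ξ) ∧
        IsCarriedBy (planeConditional (graphMeasure ν (phiStar a F)) ξ) (γ ξ) ∧
        ∀ γ' : Set (ℝ × ℝ), IsStrongStableFibre a F jL jU ξ γ' →
          IsCarriedBy (planeConditional (graphMeasure ν (phiStar a F)) ξ) γ' → γ' = γ ξ) ∧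
      (CaseA1 a F ν γ ∨ CaseA2Plus a F ν γ ∨ CaseA2Minus a F ν γ) ∧
      ¬ (CaseA1 a F ν γ ∧ CaseA2Plus a F ν γ) ∧
      ¬ (CaseA1 a F ν γ ∧ CaseA2Minus a F ν γ) ∧
      ¬ (CaseA2Plus a F ν γ ∧ CaseA2Minus a F ν γ) := by
  have hprob : IsProbabilityMeasure (ν.map Prod.fst) :=
    Measure.isProbabilityMeasure_map measurable_fst.aemeasurable
  obtain ⟨hκ, hcar⟩ := planeConditional_graphMeasure (ν := ν) hF.measurable_phiStar
  have hM0 : ProbabilityTheory.IsMarkovKernel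
      (planeConditional (graphMeasure ν (phiStar a F))) := by
    unfold planeConditional; infer_instance
  set κ₀ := planeConditional (graphMeasure ν (phiStar a F)) with hκ₀
  have hM1 : ProbabilityTheory.IsMarkovKernel (κ₀.map Prod.fst) :=
    ProbabilityTheory.Kernel.IsMarkovKernel.map _ measurable_fst
  -- The leaf is chosen for every `ξ`; the identity is a dummy value on the exceptional null set.
  have hex : ∀ ξ, ∃ l : ℝ → ℝ, (∃ l : ℝ → ℝ, IsLeafOn a F jL jU (rep ξ) (Set.Icc 0 1) l ∧
      ∀ᵐ x ∂(κ₀.map Prod.fst ξ), l (rep x) = phiStar a F (ξ, x)) →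
      IsLeafOn a F jL jU (rep ξ) (Set.Icc 0 1) l ∧
      ∀ᵐ x ∂(κ₀.map Prod.fst ξ), l (rep x) = phiStar a F (ξ, x) := by
    intro ξ
    by_cases h : ∃ l : ℝ → ℝ, IsLeafOn a F jL jU (rep ξ) (Set.Icc 0 1) l ∧
      ∀ᵐ x ∂(κ₀.map Prod.fst ξ), l (rep x) = phiStar a F (ξ, x)
    · exact ⟨h.choose, fun _ => h.choose_spec⟩
    · exact ⟨id, fun h' => absurd h' h⟩
  choose ell hell₀ using hex
  have hell : ∀ᵐ ξ ∂(ν.map Prod.fst), IsLeafOn a F jL jU (rep ξ) (Set.Icc 0 1) (ell ξ) ∧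
      Set.MapsTo (ell ξ) (Set.Icc 0 1) (Set.Icc jL jU) ∧
      ∀ᵐ x ∂(κ₀.map Prod.fst ξ), ell ξ (rep x) = phiStar a F (ξ, x) := by
    filter_upwards [hF.ae_exists_leaf hA hν hG hκ, hG.ae_pos hF.a_pos hF.a_lt_one hκ] with ξ h hp
    obtain ⟨h1, h2⟩ := hell₀ ξ h
    refine ⟨h1, fun u hu => hF.subset ?_, h2⟩
    exact h1.mem_of_ae hp isClosed_Icc (h2.mono fun x hx => hx ▸ hF.phiStar_mem (ξ, x)) hu
  have hjoin : ∀ {P : UnitAddCircle × UnitAddCircle → Prop}, MeasurableSet {θ | P θ} →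
      (∀ᵐ ξ ∂(ν.map Prod.fst), ∀ᵐ x ∂(κ₀.map Prod.fst ξ), P (ξ, x)) → ∀ᵐ θ ∂ν, P θ := by
    intro P hm hP
    rw [← hκ]
    exact Measure.ae_compProd_of_ae_ae hm hP
  have hS := hF.isInvariantGraph_phiStar.mono hF
  have h01 : (0 : ℝ) ∈ Set.Icc (0 : ℝ) 1 := by simp
  refine ⟨fun ξ => (fun u : ℝ => (u, ell ξ u)) '' Set.Icc 0 1, ?_, ?_, ?_, ?_, ?_⟩
  · filter_upwards [hell, hcar] with ξ ⟨hl, hJ, hx⟩ hc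
    rw [ProbabilityTheory.Kernel.map_apply _ measurable_fst] at hx
    have hx' : ∀ᵐ p ∂(κ₀ ξ), ell ξ (rep p.1) = p.2 := by
      filter_upwards [ae_of_ae_map measurable_fst.aemeasurable hx, hc] with p h1 h2
      rw [h1, h2]
    refine ⟨hF.isStrongStableFibre_leaf hl hJ, ?_, fun γ' hγ' hcar' => ?_⟩
    · refine measure_mono_null ?_ hx'
      intro p hp h
      exact hp ⟨rep p.1, rep_mem_Icc _, Prod.ext rfl h⟩
    · have hcar'' : ∀ᵐ p ∂(κ₀ ξ), (rep p.1, p.2) ∈ γ' := hcar'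
      -- Two sets that carry the same probability measure have a common point, and a fibre that
      -- meets the leaf is the leaf.
      obtain ⟨p, h1, h2⟩ := (hx'.and hcar'').exists
      rw [← h1] at h2
      exact hF.strongStableFibre_eq_leaf hl hJ hγ' h2
  · by_cases hup : ∀ᵐ θ ∂ν, phiPlusMinus a F θ ≤ phiStar a F θ
    · obtain ⟨h1, h2⟩ := hF.ae_leaf_eq_phiPlusMinus hν hG hκ hS hF.phiStar_le_phiPlus
        (hell.mono fun ξ h => ⟨h.1.continuousOn, h.2.2⟩) hup
      exact Or.inr (Or.inl (hF.caseA2Plus hA hν h1 h2))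
    by_cases hlo : ∀ᵐ θ ∂ν, phiStar a F θ ≤ phiMinusPlus a F θ
    · obtain ⟨h1, h2⟩ := hF.ae_leaf_eq_phiMinusPlus hν hG hκ hS hF.phiMinus_le_phiStar
        (hell.mono fun ξ h => ⟨h.1.continuousOn, h.2.2⟩) hlo
      exact Or.inr (Or.inr (hF.caseA2Minus hA hν h1 h2))
    have h1 := hF.ae_leaf_lt_phiPlusMinus hν hκ hS hell hup
    have h2 := hF.ae_phiMinusPlus_lt_leaf hν hκ hS hell hlo
    refine Or.inl (hF.caseA1 hA hν (hjoin ?_ ?_) (hjoin ?_ ?_) h1 h2)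
    · exact measurableSet_lt hF.measurable_phiStar hF.measurable_phiPlusMinus
    · filter_upwards [h1, hell] with ξ h ⟨_, _, hx⟩
      filter_upwards [hx] with x hx
      have := h _ (rep_mem_Icc x)
      rwa [hx, coe_rep] at this
    · exact measurableSet_lt hF.measurable_phiMinusPlus hF.measurable_phiStar
    · filter_upwards [h2, hell] with ξ h ⟨_, _, hx⟩
      filter_upwards [hx] with x hx
      have := h _ (rep_mem_Icc x)
      rwa [hx, coe_rep] at this
  -- For exclusiveness it is enough to look at the point over `u = 0` of one generic fibre: graphs
  -- of `φ⁺⁻` and `φ⁻⁺` lie in the filled closures, and the two graphs are disjoint.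
  · rintro ⟨h1, h2⟩
    obtain ⟨ξ, h3, h4⟩ := (h1.2.2.1.and h2.2.2.1).exists
    rw [h4] at h3
    exact (h3 _ ⟨0, h01, rfl⟩).1
      ((hF.mem_filledClosure _).2 ⟨le_rfl, hF.phiPlusMinus_le _⟩)
  · rintro ⟨h1, h2⟩
    obtain ⟨ξ, h3, h4⟩ := (h1.2.2.1.and h2.2.2.1).exists
    rw [h4] at h3
    exact (h3 _ ⟨0, h01, rfl⟩).2
      ((hF.mem_filledClosure_phiMinus _).2 ⟨hF.phiMinus_le_phiMinusPlus _, le_rfl⟩)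
  · rintro ⟨h1, h2⟩
    obtain ⟨ξ, h3, h4⟩ := (h1.2.2.1.and h2.2.2.1).exists
    have h5 : ((0 : ℝ), phiPlusMinus a F (ξ, ((0 : ℝ) : UnitAddCircle))) ∈
        (fun u : ℝ => (u, phiMinusPlus a F (ξ, (u : UnitAddCircle)))) '' Set.Icc 0 1 := by
      rw [← h4, h3]
      exact ⟨0, h01, rfl⟩
    obtain ⟨u, -, hu⟩ := h5
    obtain ⟨rfl, h6⟩ := Prod.mk.inj hu
    exact absurd h6 (hF.phiMinusPlus_lt hA _).ne
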